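/- Let $d\ge1$, let $\mathcal N=\mathbb Z^d$ or $\mathbb N^d$ (with $0\in\mathbb N$), and let $\mathcal Z=\mathcal N\times\{\pm1\}$. For $j=(a,\delta)\in\mathcal Z$ put $\bar j=(a,-\delta)$ and $|j|=|a|=\max(1,a_1^2+\dots+a_d^2)^{1/2}$. For $s\in\mathbb R$ let $\mathcal P_s$ be the Hilbert space of the $z\in\mathbb C^{\mathcal Z}$ with $\|z\|_s^2=\sum_j|j|^{2s}|z_j|^2<\infty$. Let $\rho(z)_j=z_{\bar j}$, and call $z$ real if $\rho(z)=\bar z$. For a finite multi-index $\boldsymbol j$ over $\mathcal Z$ let $\mu(\boldsymbol j)$ be the third largest of the moduli $|j_i|$ ($\mu=1$ if there are fewer than three), and $S(\boldsymbol j)$ the difference of the largest and the second largest. Consider the system $$ i\dot z_j=\omega_jz_j+F_j(z),\qquad j\in\mathcal Z, \tag{1}$$ under the following assumptions. Frequencies: $\omega\in\mathbb R^{\mathcal Z}$, $\omega_{\bar j}=-\omega_j$; $|\omega_{(a,1)}|\le C|a|^{p}$ for all $a\in\mathcal N$, for some $C,p>0$; and $\omega$ is non-resonant: for every integer $r\ge3$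 there are $\gamma,\alpha>0$ such that $|\sum_{i=1}^n\delta_i\omega_{(a_i,1)}|\ge\gamma\,\mu(\boldsymbol j)^{-\alpha}$ for all $1\le n\le r$ and all $\boldsymbol j=((a_1,\delta_1),\dots,(a_n,\delta_n))\in\mathcal Z^n$ that are not equal to $\bar{\boldsymbol j}$ up to a permutation of the entries. Nonlinearity: $F$ is a reversible vector field of class $\mathcal T$, that is, there is $s_*\ge0$ such that 1. for every $s\ge s_*$, on some ball around the origin of $\mathcal P_s$, $F$ takes values in $\mathcal P_s$, is Lipschitz continuous, satisfies $\|F(z)\|_s\le C\|z\|_s^2$, and for real $z$ satisfies $F_{\bar j}(z)=-\overline{F_j(z)}$ and $\rho(F(z))=-F(\rho(z))$; 2. there are coefficients $a_{j\boldsymbol\ell}\in\mathbb C$ ($j\in\mathcal Z$, $\boldsymbol\ell\in\mathcal Z^m$, $m\ge2$) with $a_{\bar j\bar{\boldsymbol\ell}}=-\overline{a_{j\boldsymbol\ell}}=-a_{j\boldsymbol\ell}$ such that for every $k\ge1$ there is $\nu\ge0$ for which: for every $M\in\mathbb N$ there is $C$ with $|a_{j\boldsymbol\ell}|\le C\,\mu(j,\boldsymbol\ell)^{M+\nu}/(\mu(j,\boldsymbol\ell)+S(j,\boldsymbol\ell))^M$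 for all $j$, all $\boldsymbol\ell\in\mathcal Z^m$ and $2\le m\le k$; and for every $s\ge s_*$ with $s>\nu+d/2$, $\big\|F(z)-\big(\sum_{m=2}^k\sum_{\boldsymbol\ell\in\mathcal Z^m}a_{j\boldsymbol\ell}z_{\ell_1}\cdots z_{\ell_m}\big)_j\big\|_s=O(\|z\|_s^{k+1})$ as $z\to0$ in $\mathcal P_s$. Then for every integer $r\ge3$ there is $s_0(r)>0$, and for every $s>s_0(r)$ there is $\epsilon_s>0$, such that for every real $z_0\in\mathcal P_s$ with $\epsilon:=\|z_0\|_s<\epsilon_s/2$ the solution of (1) with initial datum $z_0$ exists on an interval $[-T_\epsilon,T_\epsilon]$ with $T_\epsilon\ge\epsilon^{-r}$ (on every interval $[-T,T]$ if $z_0=0$) and satisfies $$\|z(t)\|_s\le2\epsilon\qquad\text{for all }t\in[-T_\epsilon,T_\epsilon].$$ This solution is unique among the functions that are continuous with values in $\mathcal P_s$ and satisfy (1) component by component (also on every shorter interval $[-T',T']$). It belongs to $C([-T_\epsilon,T_\epsilon],\mathcal P_s)\cap C^1([-T_\epsilon,T_\epsilon],\mathcal P_{s-p})$, and it belongs to $C^1([-T_\epsilon,T_\epsilon],\mathcal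 P_s)$ whenever $(\omega_jz_{0,j})_j\in\mathcal P_s$. -/

import Mathlib

open scoped NNReal

noncomputable section

namespace RevSys

/-- The index set `𝒩 × {±1}`, where `𝒩 ⊆ ℤ^d`. -/
abbrev Mode {d : ℕ} (N : Set (Fin d → ℤ)) : Type := N × ℤˣ

section Modes

variable {d : ℕ} {N : Set (Fin d → ℤ)}

/-- The modulus `|a| = max(1, a₁² + ⋯ + a_d²)^{1/2}`. -/
def latAbs (a : Fin d → ℤ) : ℝ := Real.sqrt (max 1 (∑ i, (a i : ℝ) ^ 2))

/-- The modulus `|j| = |a|` of the index `j = (a, δ)`. -/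
def modeAbs (j : Mode N) : ℝ := latAbs (j.1 : Fin d → ℤ)

theorem one_le_modeAbs (j : Mode N) : 1 ≤ modeAbs j :=
  Real.one_le_sqrt.2 (le_max_left _ _)

theorem modeAbs_pos (j : Mode N) : 0 < modeAbs j :=
  lt_of_lt_of_le one_pos (one_le_modeAbs j)

/-- The conjugate index: `j = (a, δ)` is sent to `(a, -δ)`. -/
def conjMode (j : Mode N) : Mode N := (j.1, -j.2)

/-- The involution `ρ(z)_j = z_{conj j}`. -/
def rho (z : Mode N → ℂ) : Mode N → ℂ := fun j => z (conjMode j)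

/-- A sequence is real when `ρ(z)` is its complex conjugate. -/
def IsReal (z : Mode N → ℂ) : Prop := ∀ j, rho z j = (starRingEnd ℂ) (z j)

/-- The `k`-th largest (counting from `0`, with multiplicity) of the moduli `|j_1|, …, |j_n|`;
by convention it is `1` if there are at most `k` indices. -/
def kthAbs (k : ℕ) {n : ℕ} (v : Fin n → Mode N) : ℝ :=
  ((List.ofFn fun i => modeAbs (v i)).insertionSort (· ≥ ·)).getD k 1

/-- `μ`: the third largest modulus. -/
def mu {n : ℕ} (v : Fin n → Mode N) : ℝ := kthAbs 2 v

/-- `S`: the difference between the largest and the second largest modulus. -/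
def gapS {n : ℕ} (v : Fin n → Mode N) : ℝ := kthAbs 0 v - kthAbs 1 v

/-- `Ω(j_1, …, j_n) = δ_1 ω_{a_1} + ⋯ + δ_n ω_{a_n}`, where `j_i = (a_i, δ_i)` and `ω_a` is the
frequency of `(a, +1)`. -/
def bigOmega (ω : Mode N → ℝ) {n : ℕ} (v : Fin n → Mode N) : ℝ :=
  ∑ i, (((v i).2 : ℤ) : ℝ) * ω ((v i).1, 1)

/-- The multi-index agrees with its conjugate up to the order of its entries, that is, the monomial
`z_{j_1} ⋯ z_{j_n}` is a product of actions `z_l z_{conj l}`. -/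
def IsActionIndex {n : ℕ} (v : Fin n → Mode N) : Prop :=
  ∃ σ : Equiv.Perm (Fin n), ∀ i, v (σ i) = conjMode (v i)

/-- Non-resonant frequency vectors. -/
def NonResonant (ω : Mode N → ℝ) : Prop :=
  ∀ r : ℕ, 3 ≤ r → ∃ γ : ℝ, 0 < γ ∧ ∃ α : ℝ, 0 < α ∧
    ∀ n : ℕ, 1 ≤ n → n ≤ r → ∀ v : Fin n → Mode N, ¬ IsActionIndex v →
      γ / mu v ^ α ≤ |bigOmega ω v|

end Modes

section Space

variable {d : ℕ} (N : Set (Fin d → ℤ)) (s : ℝ)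

/-- The sequences `z` with `∑_j |j|^{2s} |z_j|² < ∞`, as a linear subspace of `ℂ^𝒵`. -/
def sobSubmodule : Submodule ℂ (Mode N → ℂ) where
  carrier := {z | Memℓp (fun j => ((modeAbs j ^ s : ℝ) : ℂ) * z j) 2}
  add_mem' := by
    intro x y hx hy
    have h := Memℓp.add hx hy
    have e : (fun j => ((modeAbs j ^ s : ℝ) : ℂ) * (x + y) j)
        = (fun j => ((modeAbs j ^ s : ℝ) : ℂ) * x j)
          + (fun j => ((modeAbs j ^ s : ℝ) : ℂ) * y j) := by
      funext j
      simp [mul_add]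
    show Memℓp _ 2
    rw [e]
    exact h
  zero_mem' := by
    have e : (fun j : Mode N => ((modeAbs j ^ s : ℝ) : ℂ) * (0 : Mode N → ℂ) j) = 0 := by
      funext j
      simp
    show Memℓp _ 2
    rw [e]
    exact zero_memℓp
  smul_mem' := by
    intro c x hx
    have h := Memℓp.const_smul hx c
    have e : (fun j => ((modeAbs j ^ s : ℝ) : ℂ) * (c • x) j)
        = c • (fun j => ((modeAbs j ^ s : ℝ) : ℂ) * x j) := by
      funext j
      simp only [Pi.smul_apply, smul_eq_mul]
      ring
    show Memℓp _ 2
    rw [e]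
    exact h

/-- The weighted space `𝒫_s`. It is a type of its own, so that it carries the topology of its norm
and not the one of pointwise convergence. -/
def Sob : Type := sobSubmodule N s

instance : AddCommGroup (Sob N s) := inferInstanceAs (AddCommGroup (sobSubmodule N s))

instance : Module ℂ (Sob N s) := inferInstanceAs (Module ℂ (sobSubmodule N s))

variable {N s}

/-- The sequence underlying an element of `𝒫_s`. -/
def Sob.seq (z : Sob N s) : Mode N → ℂ := (z : sobSubmodule N s).1

variable (N s)

/-- The isometry `z ↦ (|j|^s z_j)_j` from `𝒫_s` to `ℓ²`, which defines the norm of `𝒫_s`. -/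
def Sob.toLp : Sob N s →ₗ[ℂ] lp (fun _ : Mode N => ℂ) 2 where
  toFun z := ⟨fun j => ((modeAbs j ^ s : ℝ) : ℂ) * z.seq j, (z : sobSubmodule N s).2⟩
  map_add' x y := by
    apply Subtype.ext
    funext j
    exact mul_add _ (x.seq j) (y.seq j)
  map_smul' c x := by
    apply Subtype.ext
    funext j
    exact mul_left_comm _ c (x.seq j)

theorem Sob.toLp_injective : Function.Injective (Sob.toLp N s) := by
  intro x y h
  apply Subtype.ext
  funext j
  have hj : ((modeAbs j ^ s : ℝ) : ℂ) * x.seq j = ((modeAbs j ^ s : ℝ) : ℂ) * y.seq j :=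
    congrFun (congrArg Subtype.val h) j
  have h0 : ((modeAbs j ^ s : ℝ) : ℂ) ≠ 0 :=
    Complex.ofReal_ne_zero.2 (Real.rpow_pos_of_pos (modeAbs_pos j) s).ne'
  exact mul_left_cancel₀ h0 hj

instance : NormedAddCommGroup (Sob N s) :=
  NormedAddCommGroup.induced (Sob N s) (lp (fun _ : Mode N => ℂ) 2) (Sob.toLp N s)
    (Sob.toLp_injective N s)

instance : NormedSpace ℂ (Sob N s) := NormedSpace.induced ℂ (Sob N s) _ (Sob.toLp N s)

/-- The norm is the one given by `‖z‖_s² = ∑_j |j|^{2s} |z_j|²`. -/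
theorem Sob.norm_sq (z : Sob N s) :
    ‖z‖ ^ 2 = ∑' j : Mode N, modeAbs j ^ (2 * s) * ‖z.seq j‖ ^ 2 := by
  have h := lp.norm_rpow_eq_tsum (p := 2) (by norm_num) (Sob.toLp N s z)
  have h2 : ‖z‖ = ‖Sob.toLp N s z‖ := rfl
  rw [h2]
  simp only [ENNReal.toReal_ofNat, Real.rpow_ofNat] at h
  rw [h]
  refine tsum_congr fun j => ?_
  have e : (Sob.toLp N s z : Mode N → ℂ) j = ((modeAbs j ^ s : ℝ) : ℂ) * z.seq j := rfl
  have hp : (0 : ℝ) ≤ modeAbs j := (modeAbs_pos j).le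
  rw [e, norm_mul, mul_pow, Complex.norm_real, Real.norm_of_nonneg (Real.rpow_nonneg hp s),
    mul_comm 2 s, Real.rpow_mul hp, Real.rpow_ofNat]

end Space

section Fields

variable {d : ℕ} {N : Set (Fin d → ℤ)}

/-- The coefficients `a_{j l}` of a polynomial vector field, `l ∈ 𝒵^m`, for all degrees `m`. -/
abbrev Coeffs (N : Set (Fin d → ℤ)) : Type := (m : ℕ) → Mode N → (Fin m → Mode N) → ℂ

/-- The polynomial vector field `∑_{m=2}^k ∑_{l ∈ 𝒵^m} a_{j l} z_{l_1} ⋯ z_{l_m}`. -/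
def polyField (a : Coeffs N) (k : ℕ) (z : Mode N → ℂ) : Mode N → ℂ :=
  fun j => ∑ m ∈ Finset.Icc 2 k, ∑' l : Fin m → Mode N, a m j l * ∏ i, z (l i)

/-- The coefficients of degree `2, …, k` define a field in `𝒯_k^{∞,ν}`, the intersection over
`M ∈ ℕ` of the classes `𝒯_k^{M,ν}`. -/
def InTInfty (a : Coeffs N) (k : ℕ) (ν : ℝ) : Prop :=
  ∀ M : ℕ, ∃ C : ℝ, ∀ m ∈ Finset.Icc 2 k, ∀ (j : Mode N) (l : Fin m → Mode N),
    ‖a m j l‖ ≤ C * (mu (Fin.cons j l : Fin (m + 1) → Mode N) ^ ((M : ℝ) + ν) /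
      (mu (Fin.cons j l : Fin (m + 1) → Mode N)
        + gapS (Fin.cons j l : Fin (m + 1) → Mode N)) ^ M)

/-- Near the origin of `𝒫_s`, the field `F` takes values in `𝒫_s`, is Lipschitz continuous, has a
zero of order at least `2` at the origin, and satisfies the reality condition
`F_{conj j}(z) = - conj (F_j(z))` and the reversibility condition `ρ(F(z)) = -F(ρ(z))`
at all real `z`. -/
def RegularRevAt (F : (Mode N → ℂ) → (Mode N → ℂ)) (s : ℝ) : Prop :=
  ∃ δ : ℝ, 0 < δ ∧
    (∃ f : Sob N s → Sob N s, (∀ z ∈ Metric.ball (0 : Sob N s) δ, (f z).seq = F z.seq) ∧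
      (∃ K : ℝ≥0, LipschitzOnWith K f (Metric.ball 0 δ)) ∧
      (∃ C : ℝ, ∀ z ∈ Metric.ball (0 : Sob N s) δ, ‖f z‖ ≤ C * ‖z‖ ^ 2)) ∧
    (∀ z ∈ Metric.ball (0 : Sob N s) δ, IsReal z.seq →
      (∀ j, F z.seq (conjMode j) = -(starRingEnd ℂ) (F z.seq j)) ∧
      (∀ j, rho (F z.seq) j = -F (rho z.seq) j))

/-- `polyField a k` is the Taylor expansion of degree `k` of `F` at the origin of `𝒫_s`. -/
def IsTaylorAt (F : (Mode N → ℂ) → (Mode N → ℂ)) (a : Coeffs N) (k : ℕ) (s : ℝ) : Prop :=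
  ∃ δ : ℝ, 0 < δ ∧ ∃ C : ℝ, ∀ z ∈ Metric.ball (0 : Sob N s) δ,
    ∃ R : Sob N s, R.seq = F z.seq - polyField a k z.seq ∧ ‖R‖ ≤ C * ‖z‖ ^ (k + 1)

/-- The reversible vector fields of class `𝒯`. For `s > ν + d/2` the series that define a field in
`𝒯_k^{∞,ν}` converge absolutely on `𝒫_s`. -/
def ReversibleClassT (F : (Mode N → ℂ) → (Mode N → ℂ)) : Prop :=
  ∃ s₀ : ℝ, 0 ≤ s₀ ∧ (∀ s : ℝ, s₀ ≤ s → RegularRevAt F s) ∧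
    ∃ a : Coeffs N,
      (∀ (m : ℕ) (j : Mode N) (l : Fin m → Mode N),
        a m (conjMode j) (fun i => conjMode (l i)) = -(starRingEnd ℂ) (a m j l) ∧
        a m (conjMode j) (fun i => conjMode (l i)) = -a m j l) ∧
      ∀ k : ℕ, 1 ≤ k → ∃ ν : ℝ, 0 ≤ ν ∧ InTInfty a k ν ∧
        ∀ s : ℝ, s₀ ≤ s → ν + (d : ℝ) / 2 < s → IsTaylorAt F a k s

/-- `z` is a solution on `[-T, T]`, continuous with values in `𝒫_s`, of the system
`i ż_j = ω_j z_j + F_j(z)`, `j ∈ 𝒵`. -/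
def IsSolution (ω : Mode N → ℝ) (F : (Mode N → ℂ) → (Mode N → ℂ)) {s : ℝ} (T : ℝ)
    (z : ℝ → Sob N s) : Prop :=
  ContinuousOn z (Set.Icc (-T) T) ∧
    ∀ t ∈ Set.Icc (-T) T, ∀ j : Mode N, ∃ v : ℂ,
      HasDerivWithinAt (fun τ => (z τ).seq j) v (Set.Icc (-T) T) t ∧
      Complex.I * v = (ω j : ℂ) * (z t).seq j + F (z t).seq j

end Fields

end RevSys

end

/-! Along the free flow `Φ_τ : z_j ↦ e^{-iω_jτ} z_j` the norm of `𝒫_s` is constant, so `‖z(t)‖²`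
moves only through the nonlinearity. On real sequences it equals the quadratic form
`Q_2(z) = ∑_j |j|^{2s} z_j z_{j̄}` (`normForm`), and it is corrected to a modified energy
`Q_2 + Q_3 + ⋯ + Q_R` with `R = r + 2`. Let `G_m` be the part of degree `m` in the derivative of
`Q_2 + ⋯ + Q_{m-1}` along the Taylor polynomial of the field (`lieSum`); the correction `Q_m` is
chosen so that its derivative along the free flow is `-G_m` up to a small error
(`exists_modified_energy`). The terms that are left have size `ε^{R+1}`, or carry a small factor; so
the energy of a solution of size `ε` is almost constant over a time `ε^{-r}`, and a continuity
argument gives `‖z(t)‖ ≤ 2ε` (`exists_growth_bound`, `bootstrap`).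

The form `G_m` is odd under the involution `ρ`, because the field is reversible and the forms `Q_k`
are even. A product of actions `z_l z_{l̄}` is invariant under `ρ`, so it has coefficient zero in
`G_m`; every other monomial has a divisor `Ω ≠ 0` (`exists_homological`). Two difficulties remain.

* Dividing the coefficients of a bounded form by `iΩ` need not give a bounded form. With a kernel
  `κ` of integral one whose Fourier transform vanishes outside `(-1, 1)`
  (`exists_bandlimited_kernel`), the average `∫ κ(σ) ∫_0^{σ/c} G(Φ_τ z) dτ dσ` divides by `iΩ` all
  monomials with `|Ω| ≥ c`, and as `Φ_τ` is isometric, it is bounded by a constant times `1/c` times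
  the bound of `G` (`avgForm_single`, `norm_avgForm_le`). No absolute summation over monomials takes
  place.

* The lower bound on `Ω` deteriorates with the third largest modulus `μ` of the monomial. So only
  the part of `G_m` with at most two arguments in the modes `|j| > K` is divided (`truncForm`);
  there `μ ≤ K` and `|Ω| ≥ γ K^{-α}`. For the rest, all forms are also controlled by the mixed
  seminorm `p(z) = ‖z‖_t + λ‖z‖_s`, with `t < s` and `λ = K^{t-s}`, in the sense
  `|B(v)| ≤ C λ⁻² ∏ p(v_i)` (`IsForm`); as `p(z) ≤ 2λ‖z‖_s` on high modes, three high arguments gain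
  `λ³` and the rest is `O(λ)`. This control passes through the construction because the homogeneous
  parts of the field are bounded for `p` uniformly in `λ`, which is the tame estimate
  `‖A(z)‖_s ≤ C ‖z‖_s ‖z‖_t^{q-1}` (`exists_tame_bound`).

With `K = ε^{-1/(2Rα)}` all divisors together cost `ε^{-1/2}`, and `λ ≤ ε^r` as soon as
`s - t ≥ 2Rαr` (`exists_cutoff`).

The Cauchy problem is an ordinary differential equation for `u(t) = Φ_{-t} z(t)`, after an extension
of the field on real sequences to a bounded and globally Lipschitz one (`exists_global_field`,
`exists_solution`). Uniqueness is Grönwall's inequality for `u` together with a continuity argument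
(`eqOn_of_isSolution`). Regularity in time follows from the coordinates
(`hasDerivWithinAt_of_coord`), once the candidate for `ż` is known to be a continuous curve: in
`𝒫_{s-p}` by the growth of `ω`, and in `𝒫_s` for data in the domain of `ω` by difference quotients
(`contDiffOn_one_of_domain`). -/

noncomputable section

namespace RevSys

section Spaces

variable {d : ℕ} {N : Set (Fin d → ℤ)} {s t : ℝ}

/-! ### The weighted sequence spaces -/

theorem Sob.ext {x y : Sob N s} (h : ∀ j, x.seq j = y.seq j) : x = y := Subtype.ext (funext h)

@[simp] theorem Sob.seq_zero (j : Mode N) : (0 : Sob N s).seq j = 0 := rfl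

@[simp] theorem Sob.seq_add (x y : Sob N s) (j : Mode N) :
    (x + y).seq j = x.seq j + y.seq j := rfl

@[simp] theorem Sob.seq_sub (x y : Sob N s) (j : Mode N) :
    (x - y).seq j = x.seq j - y.seq j := rfl

@[simp] theorem Sob.seq_neg (x : Sob N s) (j : Mode N) : (-x).seq j = -x.seq j := rfl

@[simp] theorem Sob.seq_smul (c : ℂ) (x : Sob N s) (j : Mode N) :
    (c • x).seq j = c * x.seq j := rfl

/-- The weight `|j|^s`. -/
def wt (s : ℝ) (j : Mode N) : ℝ := modeAbs j ^ s

theorem wt_pos (s : ℝ) (j : Mode N) : 0 < wt s j := Real.rpow_pos_of_pos (modeAbs_pos j) s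

theorem wt_nonneg (s : ℝ) (j : Mode N) : 0 ≤ wt s j := (wt_pos s j).le

theorem wt_mono (h : t ≤ s) (j : Mode N) : wt t j ≤ wt s j :=
  Real.rpow_le_rpow_of_exponent_le (one_le_modeAbs j) h

theorem wt_add (s t : ℝ) (j : Mode N) : wt (s + t) j = wt s j * wt t j :=
  Real.rpow_add (modeAbs_pos j) s t

theorem norm_ofReal_wt (s : ℝ) (j : Mode N) : ‖((modeAbs j ^ s : ℝ) : ℂ)‖ = wt s j := by
  rw [Complex.norm_real]
  exact Real.norm_of_nonneg (wt_nonneg s j)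

theorem norm_toLp_apply (z : Sob N s) (j : Mode N) :
    ‖(Sob.toLp N s z : Mode N → ℂ) j‖ = wt s j * ‖z.seq j‖ := by
  have e : (Sob.toLp N s z : Mode N → ℂ) j = ((modeAbs j ^ s : ℝ) : ℂ) * z.seq j := rfl
  rw [e, norm_mul, norm_ofReal_wt]

theorem Sob.norm_eq_toLp (z : Sob N s) : ‖z‖ = ‖Sob.toLp N s z‖ := rfl

theorem Sob.hasSum_sq (z : Sob N s) :
    HasSum (fun j => (wt s j * ‖z.seq j‖) ^ 2) (‖z‖ ^ 2) := by
  have h := lp.hasSum_norm (p := 2) (by norm_num) (Sob.toLp N s z)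
  simpa [norm_toLp_apply, Sob.norm_eq_toLp] using h

theorem Sob.wt_mul_norm_le (z : Sob N s) (j : Mode N) : wt s j * ‖z.seq j‖ ≤ ‖z‖ := by
  rw [← norm_toLp_apply]
  exact lp.norm_apply_le_norm (by norm_num) _ j

theorem Sob.sum_sq_le (z : Sob N s) (S : Finset (Mode N)) :
    ∑ j ∈ S, (wt s j * ‖z.seq j‖) ^ 2 ≤ ‖z‖ ^ 2 :=
  sum_le_hasSum S (fun _ _ => sq_nonneg _) z.hasSum_sq

/-- A sequence whose finite partial sums of `|j|^{2s} |z_j|²` are bounded by `C²` is an element of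
`𝒫_s` of norm at most `C`. -/
theorem Sob.exists_of_sum_le (f : Mode N → ℂ) {C : ℝ} (hC : 0 ≤ C)
    (h : ∀ S : Finset (Mode N), ∑ j ∈ S, (wt s j * ‖f j‖) ^ 2 ≤ C ^ 2) :
    ∃ z : Sob N s, z.seq = f ∧ ‖z‖ ≤ C := by
  have e : ∀ j, ‖((modeAbs j ^ s : ℝ) : ℂ) * f j‖ = wt s j * ‖f j‖ := fun j => by
    rw [norm_mul, norm_ofReal_wt]
  have hm : Memℓp (fun j => ((modeAbs j ^ s : ℝ) : ℂ) * f j) 2 := by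
    apply memℓp_gen' (C := C ^ 2)
    intro S
    simp only [e, ENNReal.toReal_ofNat, Real.rpow_ofNat]
    exact h S
  let z : Sob N s := (⟨f, hm⟩ : sobSubmodule N s)
  refine ⟨z, rfl, ?_⟩
  rw [Sob.norm_eq_toLp z]
  apply lp.norm_le_of_forall_sum_le (by norm_num) hC
  intro S
  simp only [norm_toLp_apply, ENNReal.toReal_ofNat, Real.rpow_ofNat]
  exact h S

theorem Sob.norm_le_of_sum_le (z : Sob N s) {C : ℝ} (hC : 0 ≤ C)
    (h : ∀ S : Finset (Mode N), ∑ j ∈ S, (wt s j * ‖z.seq j‖) ^ 2 ≤ C ^ 2) : ‖z‖ ≤ C := by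
  obtain ⟨w, hw, hn⟩ := Sob.exists_of_sum_le z.seq hC h
  have : w = z := Sob.ext fun j => congrFun hw j
  rwa [← this]

/-- Comparison of weighted sequences, component by component. -/
theorem Sob.exists_of_forall_le (f : Mode N → ℂ) (z : Sob N t) {c : ℝ} (hc : 0 ≤ c)
    (h : ∀ j, wt s j * ‖f j‖ ≤ c * (wt t j * ‖z.seq j‖)) :
    ∃ w : Sob N s, w.seq = f ∧ ‖w‖ ≤ c * ‖z‖ := by
  apply Sob.exists_of_sum_le f (by positivity)
  intro S
  calc ∑ j ∈ S, (wt s j * ‖f j‖) ^ 2 ≤ ∑ j ∈ S, c ^ 2 * (wt t j * ‖z.seq j‖) ^ 2 := by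
        refine Finset.sum_le_sum fun j _ => ?_
        rw [← mul_pow]
        exact pow_le_pow_left₀ (mul_nonneg (wt_nonneg s j) (norm_nonneg _)) (h j) 2
    _ = c ^ 2 * ∑ j ∈ S, (wt t j * ‖z.seq j‖) ^ 2 := by rw [Finset.mul_sum]
    _ ≤ c ^ 2 * ‖z‖ ^ 2 := by gcongr; exact z.sum_sq_le S
    _ = (c * ‖z‖) ^ 2 := by ring

theorem Sob.norm_le_of_forall_le (w : Sob N s) (z : Sob N t) {c : ℝ} (hc : 0 ≤ c)
    (h : ∀ j, wt s j * ‖w.seq j‖ ≤ c * (wt t j * ‖z.seq j‖)) : ‖w‖ ≤ c * ‖z‖ := by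
  obtain ⟨w', hw, hn⟩ := Sob.exists_of_forall_le w.seq z hc h
  have : w' = w := Sob.ext fun j => congrFun hw j
  rwa [← this]

/-- `𝒫_s` is isometric to `ℓ²`. -/
def Sob.toLpEquiv (N : Set (Fin d → ℤ)) (s : ℝ) :
    Sob N s ≃ₗᵢ[ℂ] lp (fun _ : Mode N => ℂ) 2 where
  toLinearEquiv := LinearEquiv.ofBijective (Sob.toLp N s) ⟨Sob.toLp_injective N s, by
    intro y
    have hw : ∀ j : Mode N, ((modeAbs j ^ s : ℝ) : ℂ) ≠ 0 := fun j =>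
      Complex.ofReal_ne_zero.2 (wt_pos s j).ne'
    have hm : Memℓp (fun j : Mode N => ((modeAbs j ^ s : ℝ) : ℂ) *
        ((((modeAbs j ^ s : ℝ) : ℂ))⁻¹ * y.1 j)) 2 := by
      have e : (fun j : Mode N => ((modeAbs j ^ s : ℝ) : ℂ) *
          ((((modeAbs j ^ s : ℝ) : ℂ))⁻¹ * y.1 j)) = y.1 := by
        funext j
        rw [mul_inv_cancel_left₀ (hw j)]
      rw [e]
      exact y.2
    refine ⟨(⟨_, hm⟩ : sobSubmodule N s), ?_⟩
    apply Subtype.ext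
    funext j
    exact mul_inv_cancel_left₀ (hw j) _⟩
  norm_map' _ := rfl

instance : CompleteSpace (Sob N s) :=
  (Sob.toLpEquiv N s).toIsometryEquiv.completeSpace

/-- The coordinate `z ↦ z_j`. -/
def Sob.coord (j : Mode N) : Sob N s →L[ℂ] ℂ :=
  LinearMap.mkContinuous
    { toFun := fun z => z.seq j
      map_add' := fun _ _ => rfl
      map_smul' := fun _ _ => rfl } ((wt s j)⁻¹) (fun z => by
        have := z.wt_mul_norm_le j
        rw [inv_mul_eq_div, le_div_iff₀ (wt_pos s j), mul_comm]
        exact this)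

@[simp] theorem Sob.coord_apply (j : Mode N) (z : Sob N s) : Sob.coord j z = z.seq j := rfl

@[simp] theorem Sob.seq_sum {ι : Type*} (S : Finset ι) (f : ι → Sob N s) (j : Mode N) :
    (∑ i ∈ S, f i).seq j = ∑ i ∈ S, (f i).seq j := by
  exact map_sum (Sob.coord (s := s) j) f S

/-- The bounded operator from `𝒫_s` to `𝒫_t` induced by a linear map of sequences that does not
increase the norm. -/
def Sob.ofSeqMap (g : (Mode N → ℂ) →ₗ[ℂ] (Mode N → ℂ))
    (h : ∀ z : Sob N s, ∃ w : Sob N t, w.seq = g z.seq ∧ ‖w‖ ≤ 1 * ‖z‖) : Sob N s →L[ℂ] Sob N t :=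
  LinearMap.mkContinuous
    { toFun := fun z => (h z).choose
      map_add' := fun x y => Sob.ext fun j => by
        rw [Sob.seq_add, (h _).choose_spec.1, (h _).choose_spec.1, (h _).choose_spec.1]
        exact congrFun (g.map_add x.seq y.seq) j
      map_smul' := fun a x => Sob.ext fun j => by
        rw [RingHom.id_apply, Sob.seq_smul, (h _).choose_spec.1, (h _).choose_spec.1]
        exact congrFun (g.map_smul a x.seq) j }
    1 (fun z => (h z).choose_spec.2)

theorem Sob.ofSeqMap_seq (g : (Mode N → ℂ) →ₗ[ℂ] (Mode N → ℂ))
    (h : ∀ z : Sob N s, ∃ w : Sob N t, w.seq = g z.seq ∧ ‖w‖ ≤ 1 * ‖z‖) (z : Sob N s) :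
    (Sob.ofSeqMap g h z).seq = g z.seq := (h z).choose_spec.1

theorem Sob.norm_ofSeqMap_le (g : (Mode N → ℂ) →ₗ[ℂ] (Mode N → ℂ))
    (h : ∀ z : Sob N s, ∃ w : Sob N t, w.seq = g z.seq ∧ ‖w‖ ≤ 1 * ‖z‖) (z : Sob N s) :
    ‖Sob.ofSeqMap g h z‖ ≤ ‖z‖ := (h z).choose_spec.2.trans_eq (one_mul _)

/-- The diagonal operator with entries `c_j`, where `|c_j| ≤ 1`. -/
def Sob.diag (s : ℝ) (c : Mode N → ℂ) (hc : ∀ j, ‖c j‖ ≤ 1) : Sob N s →L[ℂ] Sob N s :=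
  Sob.ofSeqMap (LinearMap.mulLeft ℂ c) fun z => Sob.exists_of_forall_le _ z zero_le_one fun j => by
    rw [LinearMap.mulLeft_apply, Pi.mul_apply, norm_mul, one_mul]
    gcongr
    · exact wt_nonneg s j
    · exact mul_le_of_le_one_left (norm_nonneg _) (hc j)

@[simp] theorem Sob.diag_seq (c : Mode N → ℂ) (hc : ∀ j, ‖c j‖ ≤ 1) (z : Sob N s) (j : Mode N) :
    (Sob.diag s c hc z).seq j = c j * z.seq j :=
  congrFun (Sob.ofSeqMap_seq _ _ z) j

theorem Sob.norm_diag_le (c : Mode N → ℂ) (hc : ∀ j, ‖c j‖ ≤ 1) (z : Sob N s) :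
    ‖Sob.diag s c hc z‖ ≤ ‖z‖ := Sob.norm_ofSeqMap_le _ _ z

/-- The inclusion of `𝒫_s` in `𝒫_t` for `t ≤ s`. -/
def Sob.incl (h : t ≤ s) : Sob N s →L[ℂ] Sob N t :=
  Sob.ofSeqMap LinearMap.id fun z => Sob.exists_of_forall_le _ z zero_le_one fun j => by
    rw [one_mul]
    exact mul_le_mul_of_nonneg_right (wt_mono h j) (norm_nonneg _)

theorem Sob.incl_seq' (h : t ≤ s) (z : Sob N s) : (Sob.incl h z).seq = z.seq :=
  Sob.ofSeqMap_seq _ _ z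

@[simp] theorem Sob.incl_seq (h : t ≤ s) (z : Sob N s) (j : Mode N) :
    (Sob.incl h z).seq j = z.seq j := congrFun (Sob.incl_seq' h z) j

theorem Sob.norm_incl_le (h : t ≤ s) (z : Sob N s) : ‖Sob.incl h z‖ ≤ ‖z‖ :=
  Sob.norm_ofSeqMap_le _ _ z

theorem conjMode_conjMode (j : Mode N) : conjMode (conjMode j) = j := by
  simp [conjMode]

theorem modeAbs_conjMode (j : Mode N) : modeAbs (conjMode j) = modeAbs j := rfl

/-- Conjugation of modes as a permutation. -/
def conjEquiv : Mode N ≃ Mode N := ⟨conjMode, conjMode, conjMode_conjMode, conjMode_conjMode⟩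

/-- The involution `ρ` of `𝒫_s`. -/
def Sob.rhoL (N : Set (Fin d → ℤ)) (s : ℝ) : Sob N s →L[ℂ] Sob N s :=
  Sob.ofSeqMap (LinearMap.funLeft ℂ ℂ conjMode) fun z => by
    apply Sob.exists_of_sum_le _ (by positivity)
    intro S
    have h := z.sum_sq_le (S.map conjEquiv.toEmbedding)
    rw [Finset.sum_map] at h
    rw [one_mul]
    exact h

theorem Sob.rhoL_seq' (z : Sob N s) : (Sob.rhoL N s z).seq = rho z.seq :=
  Sob.ofSeqMap_seq _ _ z

@[simp] theorem Sob.rhoL_seq (z : Sob N s) (j : Mode N) :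
    (Sob.rhoL N s z).seq j = z.seq (conjMode j) := congrFun (Sob.rhoL_seq' z) j

theorem Sob.norm_rhoL_le (z : Sob N s) : ‖Sob.rhoL N s z‖ ≤ ‖z‖ :=
  Sob.norm_ofSeqMap_le _ _ z

open Classical in
theorem Sob.exists_single (s : ℝ) (j : Mode N) :
    ∃ w : Sob N s, (w.seq = fun k => if k = j then 1 else 0) ∧ ‖w‖ ≤ wt s j := by
  apply Sob.exists_of_sum_le _ (wt_nonneg s j)
  intro S
  have : ∀ k ∈ S, (wt s k * ‖(if k = j then (1 : ℂ) else 0)‖) ^ 2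
      = if k = j then wt s j ^ 2 else 0 := by
    intro k _
    split_ifs with h
    · simp [h]
    · simp
  rw [Finset.sum_congr rfl this, Finset.sum_ite_eq']
  split_ifs
  · exact le_rfl
  · positivity

/-- The basis vector of index `j`. -/
def Sob.single (s : ℝ) (j : Mode N) : Sob N s := (Sob.exists_single s j).choose

open Classical in
theorem Sob.single_seq (j k : Mode N) : (Sob.single s j).seq k = if k = j then 1 else 0 :=
  congrFun (Sob.exists_single s j).choose_spec.1 k

theorem Sob.hasSum_single (z : Sob N s) : HasSum (fun j => z.seq j • Sob.single s j) z := by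
  classical
  have h := lp.hasSum_single (p := 2) (by norm_num) (Sob.toLpEquiv N s z)
  have h2 := h.mapL (Sob.toLpEquiv N s).symm.toContinuousLinearEquiv.toContinuousLinearMap
  have e : (fun j => z.seq j • Sob.single s j) = fun j =>
      (Sob.toLpEquiv N s).symm (lp.single 2 j ((Sob.toLpEquiv N s z : Mode N → ℂ) j)) := by
    funext j
    rw [LinearIsometryEquiv.eq_symm_apply]
    apply Subtype.ext
    funext k
    have e1 : ∀ w : Sob N s, (Sob.toLpEquiv N s w : Mode N → ℂ) k
        = ((modeAbs k ^ s : ℝ) : ℂ) * w.seq k := fun _ => rfl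
    have e2 : ∀ k, (Sob.toLpEquiv N s z : Mode N → ℂ) k
        = ((modeAbs k ^ s : ℝ) : ℂ) * z.seq k := fun _ => rfl
    rw [e1, lp.coeFn_single, Pi.single_apply, Sob.seq_smul, Sob.single_seq, e2]
    split_ifs with hk
    · rw [hk, mul_one]
    · simp
  rw [e]
  simpa using h2

/-! ### The free flow and the frequency projections -/

/-- The flow of `i ż_j = ω_j z_j`. -/
def Sob.flow (s : ℝ) (ω : Mode N → ℝ) (τ : ℝ) : Sob N s →L[ℂ] Sob N s :=
  Sob.diag s (fun j => Complex.exp (-(ω j * τ : ℝ) * Complex.I)) (fun j => by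
    rw [← Complex.ofReal_neg, Complex.norm_exp_ofReal_mul_I])

theorem Sob.flow_seq (ω : Mode N → ℝ) (τ : ℝ) (z : Sob N s) (j : Mode N) :
    (Sob.flow s ω τ z).seq j = Complex.exp (-(ω j * τ : ℝ) * Complex.I) * z.seq j :=
  Sob.diag_seq _ _ z j

theorem Sob.flow_zero (ω : Mode N → ℝ) (z : Sob N s) : Sob.flow s ω 0 z = z :=
  Sob.ext fun j => by simp [Sob.flow_seq]

theorem Sob.flow_add (ω : Mode N → ℝ) (τ τ' : ℝ) (z : Sob N s) :
    Sob.flow s ω (τ + τ') z = Sob.flow s ω τ (Sob.flow s ω τ' z) :=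
  Sob.ext fun j => by
    rw [Sob.flow_seq, Sob.flow_seq, Sob.flow_seq, ← mul_assoc, ← Complex.exp_add]
    congr 2
    push_cast
    ring

theorem Sob.flow_neg_flow (ω : Mode N → ℝ) (τ : ℝ) (z : Sob N s) :
    Sob.flow s ω (-τ) (Sob.flow s ω τ z) = z := by
  rw [← Sob.flow_add, neg_add_cancel, Sob.flow_zero]

theorem Sob.flow_flow_neg (ω : Mode N → ℝ) (τ : ℝ) (z : Sob N s) :
    Sob.flow s ω τ (Sob.flow s ω (-τ) z) = z := by
  rw [← Sob.flow_add, add_neg_cancel, Sob.flow_zero]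

theorem Sob.norm_flow (ω : Mode N → ℝ) (τ : ℝ) (z : Sob N s) : ‖Sob.flow s ω τ z‖ = ‖z‖ := by
  apply le_antisymm (Sob.norm_diag_le _ _ z)
  conv_lhs => rw [← Sob.flow_neg_flow ω τ z]
  exact Sob.norm_diag_le _ _ _

/-- Continuous dependence of a diagonal operator on a parameter, in the strong topology. -/
theorem Sob.continuous_diag {X : Type*} [TopologicalSpace X] [FirstCountableTopology X]
    (c : X → Mode N → ℂ) (hc : ∀ x j, ‖c x j‖ ≤ 1) (hcont : ∀ j, Continuous fun x => c x j)
    (z : Sob N s) : Continuous fun x => Sob.diag s (c x) (hc x) z := by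
  rw [continuous_iff_continuousAt]
  intro x₀
  rw [ContinuousAt, tendsto_iff_norm_sub_tendsto_zero]
  have key : Filter.Tendsto (fun x => ‖Sob.diag s (c x) (hc x) z - Sob.diag s (c x₀) (hc x₀) z‖ ^ 2)
      (nhds x₀) (nhds 0) := by
    have h1 : ∀ x, ‖Sob.diag s (c x) (hc x) z - Sob.diag s (c x₀) (hc x₀) z‖ ^ 2
        = ∑' j, (wt s j * ‖(c x j - c x₀ j) * z.seq j‖) ^ 2 := by
      intro x
      rw [← (Sob.hasSum_sq _).tsum_eq]
      refine tsum_congr fun j => ?_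
      rw [Sob.seq_sub, Sob.diag_seq, Sob.diag_seq, sub_mul]
    simp only [h1]
    have h0 : (0 : ℝ) = ∑' j : Mode N, (0 : ℝ) := by simp
    rw [h0]
    refine tendsto_tsum_of_dominated_convergence
      (bound := fun j => 4 * (wt s j * ‖z.seq j‖) ^ 2) (z.hasSum_sq.summable.mul_left 4) ?_ ?_
    · intro j
      have : Continuous fun x => (wt s j * ‖(c x j - c x₀ j) * z.seq j‖) ^ 2 := by
        have := hcont j
        fun_prop
      simpa using this.tendsto x₀
    · refine Filter.Eventually.of_forall fun x j => ?_
      rw [Real.norm_of_nonneg (sq_nonneg _)]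
      have h2 : ‖c x j - c x₀ j‖ ≤ 2 := (norm_sub_le _ _).trans (by linarith [hc x j, hc x₀ j])
      have h3 : wt s j * ‖(c x j - c x₀ j) * z.seq j‖ ≤ 2 * (wt s j * ‖z.seq j‖) := by
        rw [norm_mul, mul_left_comm]
        gcongr
        exact mul_nonneg (wt_nonneg _ _) (norm_nonneg _)
      calc _ ≤ (2 * (wt s j * ‖z.seq j‖)) ^ 2 :=
            pow_le_pow_left₀ (mul_nonneg (wt_nonneg _ _) (norm_nonneg _)) h3 2
        _ = _ := by ring
  have := key.sqrt
  simpa using this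

theorem Sob.continuous_flow (ω : Mode N → ℝ) (z : Sob N s) :
    Continuous fun τ => Sob.flow s ω τ z := by
  apply Sob.continuous_diag (fun τ j => Complex.exp (-(ω j * τ : ℝ) * Complex.I))
  intro j
  fun_prop

/-- The free flow is jointly continuous, since it consists of isometries. -/
theorem Sob.continuous_flow_uncurry (ω : Mode N → ℝ) :
    Continuous fun q : ℝ × Sob N s => Sob.flow s ω q.1 q.2 := by
  apply continuous_prod_of_continuous_lipschitzWith' _ 1
  · intro τ
    refine LipschitzWith.of_dist_le_mul fun x y => ?_
    rw [dist_eq_norm, dist_eq_norm, ← map_sub, Sob.norm_flow, NNReal.coe_one, one_mul]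
  · exact fun z => Sob.continuous_flow ω z

open Classical in
/-- The projection on the modes with `|j| ≤ K`. -/
def Sob.low (s K : ℝ) : Sob N s →L[ℂ] Sob N s :=
  Sob.diag s (fun j => if modeAbs j ≤ K then 1 else 0) (fun j => by split_ifs <;> simp)

open Classical in
theorem Sob.low_seq (K : ℝ) (z : Sob N s) (j : Mode N) :
    (Sob.low s K z).seq j = if modeAbs j ≤ K then z.seq j else 0 := by
  rw [Sob.low, Sob.diag_seq]
  split_ifs <;> simp

open Classical in
/-- The projection on the modes with `|j| > K`. -/
def Sob.high (s K : ℝ) : Sob N s →L[ℂ] Sob N s :=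
  Sob.diag s (fun j => if modeAbs j ≤ K then 0 else 1) (fun j => by split_ifs <;> simp)

open Classical in
theorem Sob.high_seq (K : ℝ) (z : Sob N s) (j : Mode N) :
    (Sob.high s K z).seq j = if modeAbs j ≤ K then 0 else z.seq j := by
  rw [Sob.high, Sob.diag_seq]
  split_ifs <;> simp

theorem Sob.low_add_high (K : ℝ) (z : Sob N s) : Sob.low s K z + Sob.high s K z = z :=
  Sob.ext fun j => by
    rw [Sob.seq_add, Sob.low_seq, Sob.high_seq]
    split_ifs <;> simp

end Spaces

/-! ### Symmetric multilinear maps and polarization -/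

section Polarization

variable {E G : Type*} [AddCommGroup E] [Module ℂ E] [AddCommGroup G] [Module ℂ G] {m : ℕ}

/-- Invariance of a multilinear map under permutations of its arguments. -/
def IsSymmMap (B : MultilinearMap ℂ (fun _ : Fin m => E) G) : Prop :=
  ∀ (σ : Equiv.Perm (Fin m)) (v : Fin m → E), B (fun i => v (σ i)) = B v

/-- The polarization identity. -/
theorem IsSymmMap.factorial_smul {B : MultilinearMap ℂ (fun _ : Fin m => E) G} (hB : IsSymmMap B)
    (v : Fin m → E) :
    m.factorial • B v
      = ∑ S : Finset (Fin m), ((-1 : ℤ) ^ (Sᶜ).card) • B (fun _ => ∑ i ∈ S, v i) := by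
  classical
  have h1 : ∀ S : Finset (Fin m), B (fun _ => ∑ i ∈ S, v i)
      = ∑ f : Fin m → Fin m, if ∀ i, f i ∈ S then B (fun i => v (f i)) else 0 := by
    intro S
    rw [MultilinearMap.map_sum_finset B (fun _ i => v i) (fun _ => S), ← Finset.sum_filter]
    refine Finset.sum_congr ?_ fun _ _ => rfl
    ext f
    simp
  simp only [h1, Finset.smul_sum]
  rw [Finset.sum_comm]
  have h2 : ∀ f : Fin m → Fin m,
      ∑ S : Finset (Fin m), ((-1 : ℤ) ^ (Sᶜ).card) •
        (if ∀ i, f i ∈ S then B (fun i => v (f i)) else 0)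
      = if Function.Bijective f then B v else 0 := by
    intro f
    have h3 : ∑ S : Finset (Fin m), ((-1 : ℤ) ^ (Sᶜ).card) •
        (if ∀ i, f i ∈ S then B (fun i => v (f i)) else 0)
        = (∑ S ∈ (Finset.univ.image f)ᶜ.powerset, (-1 : ℤ) ^ S.card) • B (fun i => v (f i)) := by
      rw [Finset.sum_smul, ← Finset.sum_filter_add_sum_filter_not Finset.univ
        (fun S : Finset (Fin m) => ∀ i, f i ∈ S)]
      rw [Finset.sum_eq_zero (s := Finset.univ.filter fun S : Finset (Fin m) => ¬ ∀ i, f i ∈ S),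
        add_zero]
      · refine Finset.sum_bij' (fun S _ => Sᶜ) (fun S _ => Sᶜ) ?_ ?_ ?_ ?_ ?_
        · intro S hS
          rw [Finset.mem_powerset, Finset.compl_subset_compl]
          intro x hx
          obtain ⟨i, _, rfl⟩ := Finset.mem_image.1 hx
          exact (Finset.mem_filter.1 hS).2 i
        · intro S hS
          refine Finset.mem_filter.2 ⟨Finset.mem_univ _, fun i => ?_⟩
          rw [Finset.mem_compl]
          intro hi
          exact (Finset.mem_compl.1 (Finset.mem_powerset.1 hS hi))
            (Finset.mem_image_of_mem f (Finset.mem_univ i))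
        · intro S _; exact compl_compl S
        · intro S _; exact compl_compl S
        · intro S hS
          rw [if_pos (Finset.mem_filter.1 hS).2]
      · intro S hS
        rw [if_neg (Finset.mem_filter.1 hS).2, smul_zero]
    -- the alternating sum over the sets containing the range of `f` vanishes unless `f` is onto
    rw [h3, Finset.sum_powerset_neg_one_pow_card]
    have h4 : (Finset.univ.image f)ᶜ = ∅ ↔ Function.Bijective f := by
      rw [Finset.compl_eq_empty_iff, ← Finite.surjective_iff_bijective, Finset.eq_univ_iff_forall]
      simp [Function.Surjective]
    by_cases hf : Function.Bijective f
    · rw [if_pos (h4.2 hf), if_pos hf, one_smul]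
      exact hB (Equiv.ofBijective f hf) v
    · rw [if_neg (fun h => hf (h4.1 h)), if_neg hf, zero_smul]
  rw [Finset.sum_congr rfl fun f _ => h2 f, ← Finset.sum_filter, Finset.sum_const]
  congr 1
  have h5 : (Finset.univ.filter fun f : Fin m → Fin m => Function.Bijective f).card
      = Fintype.card (Equiv.Perm (Fin m)) := by
    rw [← Fintype.card_subtype]
    exact Fintype.card_congr (Equiv.ofBijective
      (fun f : {f : Fin m → Fin m // Function.Bijective f} => Equiv.ofBijective f.1 f.2)
      ⟨fun f g h => Subtype.ext (by
        funext i; exact DFunLike.congr_fun h i), fun e => ⟨⟨e, e.bijective⟩, by ext; rfl⟩⟩)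
  rw [h5, Fintype.card_perm, Fintype.card_fin]

/-- By polarization, a symmetric multilinear map is determined by its diagonal. -/
theorem IsSymmMap.eq_of_diag {B B' : MultilinearMap ℂ (fun _ : Fin m => E) G} (hB : IsSymmMap B)
    (hB' : IsSymmMap B') (h : ∀ z, B (fun _ => z) = B' (fun _ => z)) (v : Fin m → E) :
    B v = B' v := by
  have h1 := hB.factorial_smul v
  simp only [h] at h1
  rw [← hB'.factorial_smul v] at h1
  have h2 : (m.factorial : ℂ) • B v = (m.factorial : ℂ) • B' v := by
    simpa [Nat.cast_smul_eq_nsmul] using h1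
  exact smul_right_injective G (Nat.cast_ne_zero.2 m.factorial_ne_zero) h2

/-- A symmetric multilinear map is bounded by its values on the diagonal. -/
theorem IsSymmMap.bound_of_diag {B : MultilinearMap ℂ (fun _ : Fin m => E) G} (hB : IsSymmMap B)
    (p : Seminorm ℂ E) (q : Seminorm ℂ G) {C : ℝ} (hC : 0 ≤ C)
    (h : ∀ z, q (B fun _ => z) ≤ C * p z ^ m) (v : Fin m → E) :
    q (B v) ≤ (2 ^ m * m ^ m * C) * ∏ i, p (v i) := by
  classical
  have h1 : ∀ v : Fin m → E, (∀ i, p (v i) ≤ 1) → q (B v) ≤ 2 ^ m * m ^ m * C := by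
    intro v hv
    have h2 : q (m.factorial • B v) = m.factorial * q (B v) := by
      rw [← Nat.cast_smul_eq_nsmul ℂ, map_smul_eq_mul, Complex.norm_natCast]
    have h3 : q (m.factorial • B v) ≤ ∑ S : Finset (Fin m), C * m ^ m := by
      rw [hB.factorial_smul v]
      have hsum : ∀ (T : Finset (Finset (Fin m))) (g : Finset (Fin m) → G),
          q (∑ S ∈ T, g S) ≤ ∑ S ∈ T, q (g S) := fun T g =>
        Finset.le_sum_of_subadditive q (map_zero q).le (map_add_le_add q) T g
      refine (hsum _ _).trans (Finset.sum_le_sum fun S _ => ?_)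
      have h4 : q (((-1 : ℤ) ^ (Sᶜ).card) • B (fun _ => ∑ i ∈ S, v i))
          = q (B (fun _ => ∑ i ∈ S, v i)) := by
        rw [← Int.cast_smul_eq_zsmul ℂ, map_smul_eq_mul]
        simp
      rw [h4]
      refine (h _).trans ?_
      gcongr
      calc p (∑ i ∈ S, v i) ≤ ∑ i ∈ S, p (v i) :=
            Finset.le_sum_of_subadditive p (map_zero p).le (map_add_le_add p) S v
        _ ≤ ∑ i ∈ S, 1 := Finset.sum_le_sum fun i _ => hv i
        _ = S.card := by simp
        _ ≤ m := by exact_mod_cast (Finset.card_le_univ S).trans_eq (Fintype.card_fin m)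
    rw [h2, Finset.sum_const, Finset.card_univ, Fintype.card_finset, Fintype.card_fin,
      nsmul_eq_mul] at h3
    have h5 : (1 : ℝ) ≤ m.factorial := by exact_mod_cast m.factorial_pos
    have h6 : 0 ≤ q (B v) := apply_nonneg q _
    push_cast at h3
    nlinarith
  -- `p` may vanish on some `v i`, so the arguments are rescaled by `p (v i) + η` with `η → 0`
  have h2 : ∀ η : ℝ, 0 < η → q (B v) ≤ (2 ^ m * m ^ m * C) * ∏ i, (p (v i) + η) := by
    intro η hη
    have hpos : ∀ i, 0 < p (v i) + η := fun i => by
      have : 0 ≤ p (v i) := apply_nonneg p _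
      positivity
    have h3 := h1 (fun i => ((p (v i) + η : ℝ) : ℂ)⁻¹ • v i) (fun i => by
      rw [map_smul_eq_mul, norm_inv, Complex.norm_real, Real.norm_of_nonneg (hpos i).le,
        inv_mul_eq_div, div_le_one (hpos i)]
      linarith)
    rw [MultilinearMap.map_smul_univ, map_smul_eq_mul, norm_prod] at h3
    have h4 : ∏ i, ‖(((p (v i) + η : ℝ) : ℂ)⁻¹)‖ = (∏ i, (p (v i) + η))⁻¹ := by
      rw [← Finset.prod_inv_distrib]
      refine Finset.prod_congr rfl fun i _ => ?_
      rw [norm_inv, Complex.norm_real, Real.norm_of_nonneg (hpos i).le]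
    rw [h4, inv_mul_eq_div, div_le_iff₀ (Finset.prod_pos fun i _ => hpos i)] at h3
    exact h3
  have hcont : Filter.Tendsto (fun η : ℝ => (2 ^ m * m ^ m * C) * ∏ i, (p (v i) + η))
      (nhdsWithin 0 (Set.Ioi 0)) (nhds ((2 ^ m * m ^ m * C) * ∏ i, p (v i))) := by
    have : Continuous fun η : ℝ => (2 ^ m * m ^ m * C) * ∏ i, (p (v i) + η) := by fun_prop
    have h := (this.tendsto 0).mono_left (nhdsWithin_le_nhds (s := Set.Ioi 0))
    simpa using h
  exact ge_of_tendsto hcont (Filter.eventually_of_mem self_mem_nhdsWithin h2)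

/-- The symmetrization of a multilinear map. -/
def symmetrize (B : MultilinearMap ℂ (fun _ : Fin m => E) G) :
    MultilinearMap ℂ (fun _ : Fin m => E) G :=
  ((m.factorial : ℂ)⁻¹) • ∑ σ : Equiv.Perm (Fin m), B.domDomCongr σ

theorem symmetrize_apply (B : MultilinearMap ℂ (fun _ : Fin m => E) G) (v : Fin m → E) :
    symmetrize B v = ((m.factorial : ℂ)⁻¹) • ∑ σ : Equiv.Perm (Fin m), B (fun i => v (σ i)) := by
  simp [symmetrize]

theorem isSymmMap_symmetrize (B : MultilinearMap ℂ (fun _ : Fin m => E) G) :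
    IsSymmMap (symmetrize B) := by
  intro σ v
  rw [symmetrize_apply, symmetrize_apply]
  congr 1
  exact Fintype.sum_equiv (Equiv.mulLeft σ) _ _ fun τ => rfl

theorem symmetrize_diag (B : MultilinearMap ℂ (fun _ : Fin m => E) G) (z : E) :
    symmetrize B (fun _ => z) = B fun _ => z := by
  rw [symmetrize_apply, Finset.sum_const, Finset.card_univ, Fintype.card_perm, Fintype.card_fin,
    ← Nat.cast_smul_eq_nsmul ℂ, smul_smul, inv_mul_cancel₀ (Nat.cast_ne_zero.2 m.factorial_ne_zero),
    one_smul]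

theorem symmetrize_bound (B : MultilinearMap ℂ (fun _ : Fin m => E) G) (p : E → ℝ)
    (q : Seminorm ℂ G) {C : ℝ} (h : ∀ v, q (B v) ≤ C * ∏ i, p (v i)) (v : Fin m → E) :
    q (symmetrize B v) ≤ C * ∏ i, p (v i) := by
  rw [symmetrize_apply, map_smul_eq_mul, norm_inv, Complex.norm_natCast, inv_mul_eq_div,
    div_le_iff₀ (by exact_mod_cast m.factorial_pos)]
  calc q (∑ σ : Equiv.Perm (Fin m), B (fun i => v (σ i)))
      ≤ ∑ σ : Equiv.Perm (Fin m), q (B (fun i => v (σ i))) :=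
        Finset.le_sum_of_subadditive q (map_zero q).le (map_add_le_add q) _ _
    _ ≤ ∑ σ : Equiv.Perm (Fin m), C * ∏ i, p (v i) := by
        refine Finset.sum_le_sum fun σ _ => (h _).trans_eq ?_
        rw [Equiv.prod_comp σ (fun i => p (v i))]
    _ = C * (∏ i, p (v i)) * m.factorial := by
        rw [Finset.sum_const, Finset.card_univ, Fintype.card_perm, Fintype.card_fin, nsmul_eq_mul,
          mul_comm]

end Polarization

/-! ### Homogeneous forms bounded in two norms -/

section Forms

variable {E : Type*} [NormedAddCommGroup E] [NormedSpace ℂ E] {p : Seminorm ℂ E} {lam : ℝ}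
  {m : ℕ} {C C' : ℝ} {Q Q' : E → ℂ}

/-- `Q` is a homogeneous polynomial of degree `m`, the diagonal of a symmetric form `B` with
`|B(v)| ≤ C ∏ ‖v_i‖` and `|B(v)| ≤ C λ⁻² ∏ p(v_i)`. -/
def IsForm (p : Seminorm ℂ E) (lam : ℝ) (m : ℕ) (C : ℝ) (Q : E → ℂ) : Prop :=
  ∃ B : MultilinearMap ℂ (fun _ : Fin m => E) ℂ, IsSymmMap B ∧
    (∀ v, ‖B v‖ ≤ C * ∏ i, ‖v i‖) ∧ (∀ v, lam ^ 2 * ‖B v‖ ≤ C * ∏ i, p (v i)) ∧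
    ∀ z, Q z = B fun _ => z

theorem IsForm.of_map (B : MultilinearMap ℂ (fun _ : Fin m => E) ℂ)
    (h1 : ∀ v, ‖B v‖ ≤ C * ∏ i, ‖v i‖) (h2 : ∀ v, lam ^ 2 * ‖B v‖ ≤ C * ∏ i, p (v i)) :
    IsForm p lam m C (fun z => B fun _ => z) := by
  refine ⟨symmetrize B, isSymmMap_symmetrize B, ?_, ?_, fun z => (symmetrize_diag B z).symm⟩
  · exact symmetrize_bound B (fun z => ‖z‖) (normSeminorm ℂ ℂ) h1
  · rcases eq_or_ne lam 0 with hl | hl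
    · intro v
      have := h2 v
      simp only [hl] at this ⊢
      simpa using this
    · have h3 : ∀ v, normSeminorm ℂ ℂ (B v) ≤ (C / lam ^ 2) * ∏ i, p (v i) := by
        intro v
        rw [div_mul_eq_mul_div, le_div_iff₀ (by positivity), mul_comm]
        exact h2 v
      intro v
      have := symmetrize_bound B p (normSeminorm ℂ ℂ) h3 v
      rw [div_mul_eq_mul_div, le_div_iff₀ (by positivity), mul_comm] at this
      exact this

theorem IsForm.mono (h : IsForm p lam m C Q) (hC : C ≤ C') : IsForm p lam m C' Q := by
  obtain ⟨B, hs, h1, h2, h3⟩ := h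
  refine ⟨B, hs, fun v => (h1 v).trans ?_, fun v => (h2 v).trans ?_, h3⟩
  · gcongr
  · gcongr

theorem IsForm.zero : IsForm p lam m 0 (fun _ => 0) :=
  ⟨0, fun _ _ => rfl, fun v => by simp, fun v => by simp, fun _ => rfl⟩

theorem IsForm.add (h : IsForm p lam m C Q) (h' : IsForm p lam m C' Q') :
    IsForm p lam m (C + C') (fun z => Q z + Q' z) := by
  obtain ⟨B, hs, h1, h2, h3⟩ := h
  obtain ⟨B', hs', h1', h2', h3'⟩ := h'
  refine ⟨B + B', fun σ v => ?_, fun v => ?_, fun v => ?_, fun z => ?_⟩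
  · rw [add_apply, add_apply, hs, hs']
  · rw [add_apply, add_mul]
    exact (norm_add_le _ _).trans (add_le_add (h1 v) (h1' v))
  · rw [add_apply, add_mul]
    refine le_trans ?_ (add_le_add (h2 v) (h2' v))
    rw [← mul_add]
    gcongr
    exact norm_add_le _ _
  · rw [add_apply, ← h3, ← h3']

theorem IsForm.sum {ι : Type*} (S : Finset ι) (c : ι → ℝ) (q : ι → E → ℂ)
    (h : ∀ i ∈ S, IsForm p lam m (c i) (q i)) :
    IsForm p lam m (∑ i ∈ S, c i) (fun z => ∑ i ∈ S, q i z) := by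
  classical
  induction S using Finset.induction_on with
  | empty => simpa using IsForm.zero
  | insert a S ha ih =>
    simp only [Finset.sum_insert ha]
    exact (h a (Finset.mem_insert_self _ _)).add
      (ih fun i hi => h i (Finset.mem_insert_of_mem hi))

theorem IsForm.norm_le (h : IsForm p lam m C Q) (z : E) : ‖Q z‖ ≤ C * ‖z‖ ^ m := by
  obtain ⟨B, hs, h1, h2, h3⟩ := h
  rw [h3]
  simpa using h1 fun _ => z

/-- Strict differentiability, with which the derivative of a form along a merely strongly continuous
flow is computed. -/
theorem hasStrictFDerivAt_diag {B : MultilinearMap ℂ (fun _ : Fin m => E) ℂ}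
    (h1 : ∀ v, ‖B v‖ ≤ C * ∏ i, ‖v i‖) (h3 : ∀ z, Q z = B fun _ => z) (z : E) :
    HasStrictFDerivAt Q (((B.mkContinuous C h1).linearDeriv fun _ => z).comp
      (ContinuousLinearMap.pi fun _ : Fin m => ContinuousLinearMap.id ℂ E)) z := by
  have e : Q = fun z => B.mkContinuous C h1 fun _ => z := by
    funext z
    rw [h3]
    rfl
  rw [e]
  exact HasStrictFDerivAt.comp (g := B.mkContinuous C h1) z
    (ContinuousMultilinearMap.hasStrictFDerivAt (B.mkContinuous C h1) (fun _ => z))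
    (ContinuousLinearMap.pi fun _ : Fin m => ContinuousLinearMap.id ℂ E).hasStrictFDerivAt

theorem IsForm.hasStrictFDerivAt (h : IsForm p lam m C Q) (z : E) :
    HasStrictFDerivAt Q (fderiv ℂ Q z) z := by
  obtain ⟨B, hs, h1, h2, h3⟩ := h
  have hd := hasStrictFDerivAt_diag h1 h3 z
  rwa [hd.hasFDerivAt.fderiv]

theorem fderiv_diag {B : MultilinearMap ℂ (fun _ : Fin m => E) ℂ}
    (h1 : ∀ v, ‖B v‖ ≤ C * ∏ i, ‖v i‖) (h3 : ∀ z, Q z = B fun _ => z) (z w : E) :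
    fderiv ℂ Q z w = ∑ i, B (Function.update (fun _ => z) i w) := by
  rw [(hasStrictFDerivAt_diag h1 h3 z).hasFDerivAt.fderiv]
  rw [ContinuousLinearMap.comp_apply, ContinuousMultilinearMap.linearDeriv_apply]
  rfl

theorem IsForm.norm_fderiv_le (h : IsForm p lam m C Q) (z w : E) :
    ‖fderiv ℂ Q z w‖ ≤ m * C * ‖z‖ ^ (m - 1) * ‖w‖ := by
  obtain ⟨B, hs, h1, h2, h3⟩ := h
  rw [fderiv_diag h1 h3]
  calc _ ≤ ∑ i : Fin m, ‖B (Function.update (fun _ => z) i w)‖ := norm_sum_le _ _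
    _ ≤ ∑ i : Fin m, C * (‖w‖ * ‖z‖ ^ (m - 1)) := by
        refine Finset.sum_le_sum fun i _ => (h1 _).trans_eq ?_
        congr 1
        rw [← Finset.mul_prod_erase Finset.univ _ (Finset.mem_univ i), Function.update_self]
        congr 1
        rw [Finset.prod_congr rfl (g := fun _ => ‖z‖), Finset.prod_const,
          Finset.card_erase_of_mem (Finset.mem_univ i), Finset.card_univ, Fintype.card_fin]
        intro k hk
        rw [Function.update_of_ne (Finset.ne_of_mem_erase hk)]
    _ = _ := by
        rw [Finset.sum_const, Finset.card_univ, Fintype.card_fin, nsmul_eq_mul]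
        ring

/-- The derivative of a form along a homogeneous polynomial vector field is a form. -/
theorem IsForm.fderiv_comp (h : IsForm p lam m C Q) (hC : 0 ≤ C) {q n : ℕ} {K : ℝ}
    (hm : n + 1 = m + q) (hm1 : 1 ≤ m)
    (A : MultilinearMap ℂ (fun _ : Fin q => E) E) (hA1 : ∀ v, ‖A v‖ ≤ K * ∏ i, ‖v i‖)
    (hA2 : ∀ v, p (A v) ≤ K * ∏ i, p (v i)) :
    IsForm p lam n (m * (C * K)) (fun z => fderiv ℂ Q z (A fun _ => z)) := by
  obtain ⟨k, rfl⟩ : ∃ k, m = k + 1 := ⟨m - 1, by omega⟩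
  obtain rfl : n = q + k := by omega
  obtain ⟨B, hs, h1, h2, h3⟩ := h
  let B' : MultilinearMap ℂ (fun _ : Fin (q + k) => E) ℂ :=
    ((k + 1 : ℕ) : ℂ) • (MultilinearMap.uncurrySum
      ((B.curryLeft).compMultilinearMap A)).domDomCongr finSumFinEquiv
  have hB' : ∀ v, B' v = ((k + 1 : ℕ) : ℂ) *
      B (Fin.cons (A fun i => v (Fin.castAdd k i)) fun i => v (Fin.natAdd q i)) := by
    intro v
    simp only [B', smul_apply, MultilinearMap.domDomCongr_apply,
      MultilinearMap.uncurrySum_apply, LinearMap.compMultilinearMap_apply,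
      MultilinearMap.curryLeft_apply, smul_eq_mul, finSumFinEquiv_apply_left,
      finSumFinEquiv_apply_right]
  have key : ∀ (g : E → ℝ), (∀ z, 0 ≤ g z) → (∀ v, g (A v) ≤ K * ∏ i, g (v i)) →
      ∀ v : Fin (q + k) → E,
      C * ∏ i, g ((Fin.cons (A fun i => v (Fin.castAdd k i)) fun i => v (Fin.natAdd q i) :
        Fin (k + 1) → E) i) ≤ C * K * ∏ i, g (v i) := by
    intro g hg hA v
    rw [Fin.prod_univ_succ, Fin.prod_univ_add, mul_assoc]
    simp only [Fin.cons_zero, Fin.cons_succ]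
    rw [← mul_assoc K]
    gcongr
    · exact Finset.prod_nonneg fun _ _ => hg _
    · exact hA _
  have hnorm : ‖((k + 1 : ℕ) : ℂ)‖ = ((k + 1 : ℕ) : ℝ) := Complex.norm_natCast _
  have e : (fun z => fderiv ℂ Q z (A fun _ => z)) = fun z => B' fun _ => z := by
    funext z
    rw [fderiv_diag h1 h3, hB']
    have : ∀ i : Fin (k + 1), B (Function.update (fun _ => z) i (A fun _ => z))
        = B (Fin.cons (A fun _ => z) fun _ => z) := by
      intro i
      rw [← hs (Equiv.swap 0 i) (Fin.cons (A fun _ => z) fun _ => z)]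
      congr 1
      funext l
      rcases eq_or_ne l i with rfl | hl
      · simp
      · rw [Function.update_of_ne hl]
        have : Equiv.swap 0 i l ≠ 0 := by
          intro h0
          apply hl
          rw [Equiv.swap_apply_eq_iff] at h0
          simpa using h0
        obtain ⟨l', hl'⟩ := Fin.exists_succ_eq.2 this
        rw [← hl', Fin.cons_succ]
    rw [Finset.sum_congr rfl fun i _ => this i, Finset.sum_const, Finset.card_univ,
      Fintype.card_fin, nsmul_eq_mul]
  rw [e]
  apply IsForm.of_map
  · intro v
    rw [hB', norm_mul, hnorm, mul_assoc]
    gcongr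
    exact (h1 _).trans (key (fun z => ‖z‖) (fun _ => norm_nonneg _) hA1 v)
  · intro v
    rw [hB', norm_mul, hnorm, mul_left_comm, mul_assoc (((k + 1 : ℕ) : ℝ))]
    refine mul_le_mul_of_nonneg_left ?_ (Nat.cast_nonneg _)
    exact (h2 _).trans (key p (fun _ => apply_nonneg p _) hA2 v)

end Forms

/-! ### A kernel with compactly supported Fourier transform -/

open MeasureTheory in
open scoped FourierTransform ContDiff in
/-- There is a rapidly decreasing kernel of integral `1` whose Fourier transform vanishes outside
`(-1, 1)`: the inverse Fourier transform of a bump function. -/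
theorem exists_bandlimited_kernel : ∃ κ : ℝ → ℂ, Continuous κ ∧ Integrable κ ∧
    Integrable (fun σ => |σ| * ‖κ σ‖) ∧ ∫ σ, κ σ = 1 ∧
    ∀ x : ℝ, 1 ≤ |x| → ∫ σ, κ σ * Complex.exp (-(x * σ : ℝ) * Complex.I) = 0 := by
  -- The transform of Mathlib has the phase `2πσw`, so the support in `x = 2πw` has to stay in
  -- `(-1, 1)`: hence the radius `1/8 < 1/(2π)`.
  let χ : ContDiffBump (0 : ℝ) := ⟨1 / 16, 1 / 8, by norm_num, by norm_num⟩
  let g : ℝ → ℂ := fun x => (χ x : ℂ)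
  have hg1 : HasCompactSupport g := χ.hasCompactSupport.comp_left (g := fun x : ℝ => (x : ℂ))
    (by simp)
  have hg2 : ContDiff ℝ ∞ g := Complex.ofRealCLM.contDiff.comp χ.contDiff
  let S : SchwartzMap ℝ ℂ := hg1.toSchwartzMap hg2
  let κ : SchwartzMap ℝ ℂ := 𝓕⁻ S
  have hF : ∀ w : ℝ, ∫ σ, Complex.exp ((-2 * Real.pi * σ * w : ℝ) * Complex.I) • κ σ = χ w := by
    intro w
    have h1 : 𝓕 κ = S := FourierTransform.fourier_fourierInv_eq S
    have h2 : (𝓕 κ : SchwartzMap ℝ ℂ) w = χ w := by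
      rw [h1]
      rfl
    rw [SchwartzMap.fourier_coe, Real.fourier_real_eq_integral_exp_smul] at h2
    exact h2
  refine ⟨κ, κ.continuous, κ.integrable, ?_, ?_, ?_⟩
  · simpa using κ.integrable_pow_mul volume 1
  · have h := hF 0
    have h1 : χ (0 : ℝ) = 1 := χ.one_of_mem_closedBall (by simp [χ])
    rw [h1] at h
    simpa using h
  · intro x hx
    have h := hF (x / (2 * Real.pi))
    have h1 : χ (x / (2 * Real.pi)) = 0 := by
      apply χ.zero_of_le_dist
      rw [Real.dist_eq, sub_zero, abs_div, abs_of_pos (by positivity : 0 < 2 * Real.pi),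
        le_div_iff₀ (by positivity)]
      have := Real.pi_lt_four
      show 1 / 8 * (2 * Real.pi) ≤ |x|
      linarith
    rw [h1] at h
    rw [Complex.ofReal_zero] at h
    rw [← h]
    congr 1
    funext σ
    rw [smul_eq_mul, mul_comm]
    congr 3
    rw [← Complex.ofReal_neg]
    congr 1
    field_simp

/-! ### Averages along the free flow -/

section Averages

variable {d : ℕ} {N : Set (Fin d → ℤ)} {s t : ℝ} {m : ℕ}

/-- Bounded multilinear forms on `𝒫_s` that agree on the basis vectors are equal. -/
theorem multilinear_ext_single {B B' : MultilinearMap ℂ (fun _ : Fin m => Sob N s) ℂ} {C C' : ℝ}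
    (hB : ∀ v, ‖B v‖ ≤ C * ∏ i, ‖v i‖) (hB' : ∀ v, ‖B' v‖ ≤ C' * ∏ i, ‖v i‖)
    (h : ∀ v : Fin m → Mode N, B (fun i => Sob.single s (v i)) = B' (fun i => Sob.single s (v i))) :
    B = B' := by
  classical
  ext v
  have hfin : ∀ S : Finset (Mode N), B (fun i => ∑ j ∈ S, (v i).seq j • Sob.single s j)
      = B' (fun i => ∑ j ∈ S, (v i).seq j • Sob.single s j) := by
    intro S
    rw [MultilinearMap.map_sum_finset B (fun i j => (v i).seq j • Sob.single s j) fun _ => S,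
      MultilinearMap.map_sum_finset B' (fun i j => (v i).seq j • Sob.single s j) fun _ => S]
    refine Finset.sum_congr rfl fun f _ => ?_
    rw [MultilinearMap.map_smul_univ, MultilinearMap.map_smul_univ, h]
  have hlim : Filter.Tendsto
      (fun S : Finset (Mode N) => fun i => ∑ j ∈ S, (v i).seq j • Sob.single s j)
      Filter.atTop (nhds v) := tendsto_pi_nhds.2 fun i => (v i).hasSum_single
  have h1 := ((B.mkContinuous C hB).cont.tendsto v).comp hlim
  have h2 := ((B'.mkContinuous C' hB').cont.tendsto v).comp hlim
  refine tendsto_nhds_unique h1 (h2.congr fun S => ?_)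
  exact (hfin S).symm

/-- The form `v ↦ B(Φ_τ v)`. -/
def flowForm (ω : Mode N → ℝ) (B : MultilinearMap ℂ (fun _ : Fin m => Sob N s) ℂ) (τ : ℝ) :
    MultilinearMap ℂ (fun _ : Fin m => Sob N s) ℂ :=
  B.compLinearMap fun _ => (Sob.flow s ω τ).toLinearMap

theorem flowForm_apply (ω : Mode N → ℝ) (B : MultilinearMap ℂ (fun _ : Fin m => Sob N s) ℂ)
    (τ : ℝ) (v : Fin m → Sob N s) : flowForm ω B τ v = B fun i => Sob.flow s ω τ (v i) := rfl

theorem norm_flowForm_le (ω : Mode N → ℝ) {B : MultilinearMap ℂ (fun _ : Fin m => Sob N s) ℂ}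
    {C : ℝ} (hB : ∀ v, ‖B v‖ ≤ C * ∏ i, ‖v i‖) (τ : ℝ) (v : Fin m → Sob N s) :
    ‖flowForm ω B τ v‖ ≤ C * ∏ i, ‖v i‖ := by
  refine (hB _).trans_eq (congrArg _ (Finset.prod_congr rfl fun i _ => ?_))
  exact Sob.norm_flow ω τ (v i)

theorem continuous_flowForm (ω : Mode N → ℝ)
    {B : MultilinearMap ℂ (fun _ : Fin m => Sob N s) ℂ} {C : ℝ}
    (hB : ∀ v, ‖B v‖ ≤ C * ∏ i, ‖v i‖) (v : Fin m → Sob N s) :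
    Continuous fun τ => flowForm ω B τ v :=
  (B.mkContinuous C hB).cont.comp (continuous_pi fun i => Sob.continuous_flow ω (v i))

/-- The form `v ↦ ∫_0^σ B(Φ_τ v) dτ`. -/
def primForm (ω : Mode N → ℝ) {B : MultilinearMap ℂ (fun _ : Fin m => Sob N s) ℂ} {C : ℝ}
    (hB : ∀ v, ‖B v‖ ≤ C * ∏ i, ‖v i‖) (σ : ℝ) :
    MultilinearMap ℂ (fun _ : Fin m => Sob N s) ℂ :=
  MultilinearMap.mk' (fun v => ∫ τ in (0 : ℝ)..σ, flowForm ω B τ v)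
    (fun v i x y => by
      simp only [MultilinearMap.map_update_add]
      exact intervalIntegral.integral_add ((continuous_flowForm ω hB _).intervalIntegrable _ _)
        ((continuous_flowForm ω hB _).intervalIntegrable _ _))
    (fun v i c x => by
      simp only [MultilinearMap.map_update_smul]
      exact intervalIntegral.integral_smul _ _)

theorem primForm_apply (ω : Mode N → ℝ) {B : MultilinearMap ℂ (fun _ : Fin m => Sob N s) ℂ}
    {C : ℝ} (hB : ∀ v, ‖B v‖ ≤ C * ∏ i, ‖v i‖) (σ : ℝ) (v : Fin m → Sob N s) :
    primForm ω hB σ v = ∫ τ in (0 : ℝ)..σ, flowForm ω B τ v := rfl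

theorem norm_primForm_le (ω : Mode N → ℝ) {B : MultilinearMap ℂ (fun _ : Fin m => Sob N s) ℂ}
    {C : ℝ} (hB : ∀ v, ‖B v‖ ≤ C * ∏ i, ‖v i‖) (σ : ℝ) (v : Fin m → Sob N s) {R : ℝ}
    (hR : ∀ τ, ‖flowForm ω B τ v‖ ≤ R) : ‖primForm ω hB σ v‖ ≤ R * |σ| := by
  have := intervalIntegral.norm_integral_le_of_norm_le_const (a := 0) (b := σ)
    (f := fun τ => flowForm ω B τ v) (C := R) (fun τ _ => hR τ)
  simpa [primForm_apply] using this

theorem continuous_primForm (ω : Mode N → ℝ)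
    {B : MultilinearMap ℂ (fun _ : Fin m => Sob N s) ℂ} {C : ℝ}
    (hB : ∀ v, ‖B v‖ ≤ C * ∏ i, ‖v i‖) (v : Fin m → Sob N s) :
    Continuous fun σ => primForm ω hB σ v :=
  intervalIntegral.continuous_primitive
    (fun _ _ => (continuous_flowForm ω hB v).intervalIntegrable _ _) 0

theorem integrable_mul_primForm (ω : Mode N → ℝ)
    {B : MultilinearMap ℂ (fun _ : Fin m => Sob N s) ℂ} {C : ℝ}
    (hB : ∀ v, ‖B v‖ ≤ C * ∏ i, ‖v i‖) {κ : ℝ → ℂ} (hκ : Continuous κ)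
    (hκ1 : MeasureTheory.Integrable (fun σ => |σ| * ‖κ σ‖)) {c : ℝ} (hc : 0 < c)
    (v : Fin m → Sob N s) :
    MeasureTheory.Integrable fun σ => κ σ * primForm ω hB (σ / c) v := by
  refine (hκ1.const_mul (C * (∏ i, ‖v i‖) / c)).mono' ?_ (Filter.Eventually.of_forall fun σ => ?_)
  · have := continuous_primForm ω hB v
    exact (hκ.mul (this.comp (continuous_id.div_const c))).aestronglyMeasurable
  · rw [norm_mul]
    calc _ ≤ ‖κ σ‖ * (C * (∏ i, ‖v i‖) * |σ / c|) := by
          gcongr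
          exact norm_primForm_le ω hB _ v fun τ => norm_flowForm_le ω hB τ v
      _ = _ := by
          rw [abs_div, abs_of_pos hc]
          ring

/-- The form `v ↦ ∫ κ(σ) ∫_0^{σ/c} B(Φ_τ v) dτ dσ`. -/
def avgForm (ω : Mode N → ℝ) {B : MultilinearMap ℂ (fun _ : Fin m => Sob N s) ℂ} {C : ℝ}
    (hB : ∀ v, ‖B v‖ ≤ C * ∏ i, ‖v i‖) {κ : ℝ → ℂ} (hκ : Continuous κ)
    (hκ1 : MeasureTheory.Integrable (fun σ => |σ| * ‖κ σ‖)) {c : ℝ} (hc : 0 < c) :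
    MultilinearMap ℂ (fun _ : Fin m => Sob N s) ℂ :=
  MultilinearMap.mk' (fun v => ∫ σ, κ σ * primForm ω hB (σ / c) v)
    (fun v i x y => by
      simp only [MultilinearMap.map_update_add, mul_add]
      exact MeasureTheory.integral_add (integrable_mul_primForm ω hB hκ hκ1 hc _)
        (integrable_mul_primForm ω hB hκ hκ1 hc _))
    (fun v i a x => by
      simp only [MultilinearMap.map_update_smul, smul_eq_mul]
      rw [← MeasureTheory.integral_const_mul]
      congr 1
      funext σ
      ring)

variable {ω : Mode N → ℝ} {B : MultilinearMap ℂ (fun _ : Fin m => Sob N s) ℂ} {C : ℝ}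
    (hB : ∀ v, ‖B v‖ ≤ C * ∏ i, ‖v i‖) {κ : ℝ → ℂ} (hκ : Continuous κ)
    (hκ1 : MeasureTheory.Integrable (fun σ => |σ| * ‖κ σ‖)) {c : ℝ} (hc : 0 < c)

theorem avgForm_apply (v : Fin m → Sob N s) :
    avgForm ω hB hκ hκ1 hc v = ∫ σ, κ σ * primForm ω hB (σ / c) v := rfl

/-- Any bound of `B` that is uniform along the free flow is inherited, with a loss `O(1/c)`. -/
theorem norm_avgForm_le (v : Fin m → Sob N s) {R : ℝ} (hR : ∀ τ, ‖flowForm ω B τ v‖ ≤ R) :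
    ‖avgForm ω hB hκ hκ1 hc v‖ ≤ ((∫ σ, |σ| * ‖κ σ‖) / c) * R := by
  rw [avgForm_apply]
  refine (MeasureTheory.norm_integral_le_of_norm_le (hκ1.const_mul (R / c))
    (Filter.Eventually.of_forall fun σ => ?_)).trans_eq ?_
  · rw [norm_mul]
    calc _ ≤ ‖κ σ‖ * (R * |σ / c|) := by
          gcongr
          exact norm_primForm_le ω hB _ v hR
      _ = _ := by
          rw [abs_div, abs_of_pos hc]
          ring
  · rw [MeasureTheory.integral_const_mul]
    ring

theorem flow_single (τ : ℝ) (j : Mode N) :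
    Sob.flow s ω τ (Sob.single s j)
      = Complex.exp (-(ω j * τ : ℝ) * Complex.I) • Sob.single s j := by
  classical
  apply Sob.ext
  intro k
  rw [Sob.flow_seq, Sob.seq_smul, Sob.single_seq]
  split_ifs with h
  · rw [h]
  · simp

theorem flowForm_single (τ : ℝ) (v : Fin m → Mode N) :
    flowForm ω B τ (fun i => Sob.single s (v i))
      = Complex.exp (-((∑ i, ω (v i)) * τ : ℝ) * Complex.I) * B fun i => Sob.single s (v i) := by
  rw [flowForm_apply]
  simp only [flow_single]
  rw [MultilinearMap.map_smul_univ, ← Complex.exp_sum, smul_eq_mul]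
  congr 2
  push_cast
  rw [Finset.sum_mul, ← Finset.sum_mul, Finset.sum_neg_distrib]

theorem primForm_single (σ : ℝ) (v : Fin m → Mode N) (hv : ∑ i, ω (v i) ≠ 0) :
    primForm ω hB σ (fun i => Sob.single s (v i))
      = (1 - Complex.exp (-((∑ i, ω (v i)) * σ : ℝ) * Complex.I)) /
        (Complex.I * (∑ i, ω (v i) : ℝ)) * B fun i => Sob.single s (v i) := by
  rw [primForm_apply]
  simp only [flowForm_single]
  rw [intervalIntegral.integral_mul_const]
  congr 1
  set x : ℝ := ∑ i, ω (v i)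
  have hx : (x : ℂ) ≠ 0 := Complex.ofReal_ne_zero.2 hv
  have h1 : ∀ τ : ℝ, Complex.exp (-(x * τ : ℝ) * Complex.I)
      = Complex.exp (-(x * Complex.I) * τ) := fun τ => by
    congr 1
    push_cast
    ring
  simp only [h1]
  rw [integral_exp_mul_complex (by simp [hx])]
  field_simp
  simp only [Complex.ofReal_zero, mul_zero, neg_zero, Complex.exp_zero]
  ring

/-- The averaged form divides the coefficient of a basis monomial by `i Ω`, provided `|Ω| ≥ c`. -/
theorem avgForm_single (hκ0 : MeasureTheory.Integrable κ) (hint : ∫ σ, κ σ = 1)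
    (hband : ∀ x : ℝ, 1 ≤ |x| → ∫ σ, κ σ * Complex.exp (-(x * σ : ℝ) * Complex.I) = 0)
    (v : Fin m → Mode N) (hv : (B fun i => Sob.single s (v i)) ≠ 0 → c ≤ |∑ i, ω (v i)|) :
    avgForm ω hB hκ hκ1 hc (fun i => Sob.single s (v i))
      = (B fun i => Sob.single s (v i)) / (Complex.I * (∑ i, ω (v i) : ℝ)) := by
  by_cases hg : (B fun i => Sob.single s (v i)) = 0
  · rw [hg, zero_div, avgForm_apply]
    simp [primForm_apply, flowForm_single, hg]
  · have hx := hv hg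
    have hx0 : ∑ i, ω (v i) ≠ 0 := by
      intro h0
      rw [h0, abs_zero] at hx
      linarith
    rw [avgForm_apply]
    simp only [primForm_single hB _ v hx0]
    set x : ℝ := ∑ i, ω (v i)
    set g := B fun i => Sob.single s (v i)
    have h1 : ∀ σ : ℝ, κ σ * ((1 - Complex.exp (-(x * (σ / c) : ℝ) * Complex.I)) /
        (Complex.I * (x : ℝ)) * g) = (g / (Complex.I * (x : ℝ))) *
          (κ σ - κ σ * Complex.exp (-((x / c) * σ : ℝ) * Complex.I)) := by
      intro σ
      rw [show x * (σ / c) = x / c * σ by ring]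
      ring
    have hcb : 1 ≤ |x / c| := by
      rw [abs_div, abs_of_pos hc, le_div_iff₀ hc, one_mul]
      exact hx
    have hi : MeasureTheory.Integrable
        fun σ : ℝ => κ σ * Complex.exp (-((x / c) * σ : ℝ) * Complex.I) := by
      refine hκ0.norm.mono' ?_ (Filter.Eventually.of_forall fun σ => ?_)
      · exact (by fun_prop : Continuous fun σ : ℝ =>
          κ σ * Complex.exp (-((x / c) * σ : ℝ) * Complex.I)).aestronglyMeasurable
      · rw [norm_mul, ← Complex.ofReal_neg, Complex.norm_exp_ofReal_mul_I, mul_one]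
    simp only [h1]
    rw [MeasureTheory.integral_const_mul, MeasureTheory.integral_sub hκ0 hi, hint, hband _ hcb,
      sub_zero, mul_one]

/-- The averaged form is a primitive of `-B` along the free flow. -/
theorem avgForm_flow (hκ0 : MeasureTheory.Integrable κ) (hint : ∫ σ, κ σ = 1)
    (hband : ∀ x : ℝ, 1 ≤ |x| → ∫ σ, κ σ * Complex.exp (-(x * σ : ℝ) * Complex.I) = 0)
    (hnr : ∀ v : Fin m → Mode N, (B fun i => Sob.single s (v i)) ≠ 0 → c ≤ |∑ i, ω (v i)|)
    (h : ℝ) (v : Fin m → Sob N s) :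
    flowForm ω (avgForm ω hB hκ hκ1 hc) h v
      = avgForm ω hB hκ hκ1 hc v - ∫ τ in (0 : ℝ)..h, flowForm ω B τ v := by
  set D := avgForm ω hB hκ hκ1 hc with hD
  set M := (∫ σ, |σ| * ‖κ σ‖) / c
  have hDb : ∀ v, ‖D v‖ ≤ M * C * ∏ i, ‖v i‖ := fun v =>
    (norm_avgForm_le hB hκ hκ1 hc v fun τ => norm_flowForm_le ω hB τ v).trans_eq
      (mul_assoc _ _ _).symm
  have key : flowForm ω D h = D - primForm ω hB h := by
    refine multilinear_ext_single (norm_flowForm_le ω hDb h) (C' := M * C + C * |h|)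
      (fun v => ?_) fun v => ?_
    · rw [sub_apply, add_mul]
      refine (norm_sub_le _ _).trans (add_le_add (hDb v) ?_)
      refine (norm_primForm_le ω hB h v fun τ => norm_flowForm_le ω hB τ v).trans_eq ?_
      ring
    · rw [flowForm_single, sub_apply, hD,
        avgForm_single hB hκ hκ1 hc hκ0 hint hband v (hnr v)]
      by_cases hg : (B fun i => Sob.single s (v i)) = 0
      · simp [primForm_apply, flowForm_single, hg]
      · have hx0 : ∑ i, ω (v i) ≠ 0 := by
          intro h0
          have := hnr v hg
          rw [h0, abs_zero] at this
          linarith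
        rw [primForm_single hB h v hx0]
        ring
  rw [key, sub_apply, primForm_apply]

end Averages

/-! ### The homological equation -/

section Homological

variable {d : ℕ} {N : Set (Fin d → ℤ)} {s t : ℝ} {m : ℕ}

/-- The seminorm `‖z‖_t + λ ‖z‖_s` on `𝒫_s`. -/
def mixNorm (N : Set (Fin d → ℤ)) (h : t ≤ s) (lam : ℝ≥0) : Seminorm ℂ (Sob N s) :=
  (normSeminorm ℂ (Sob N t)).comp (Sob.incl h).toLinearMap + lam • normSeminorm ℂ (Sob N s)

theorem mixNorm_apply (h : t ≤ s) (lam : ℝ≥0) (z : Sob N s) :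
    mixNorm N h lam z = ‖Sob.incl h z‖ + lam * ‖z‖ := rfl

theorem mixNorm_diag_le (h : t ≤ s) (lam : ℝ≥0) (c : Mode N → ℂ) (hc : ∀ j, ‖c j‖ ≤ 1)
    (z : Sob N s) : mixNorm N h lam (Sob.diag s c hc z) ≤ mixNorm N h lam z := by
  rw [mixNorm_apply, mixNorm_apply]
  have e : Sob.incl h (Sob.diag s c hc z) = Sob.diag t c hc (Sob.incl h z) :=
    Sob.ext fun j => by simp
  rw [e]
  gcongr
  · exact Sob.norm_diag_le _ _ _
  · exact Sob.norm_diag_le _ _ _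

theorem mixNorm_le (h : t ≤ s) {lam : ℝ≥0} (hl : lam ≤ 1) (z : Sob N s) :
    mixNorm N h lam z ≤ 2 * ‖z‖ := by
  rw [mixNorm_apply]
  have h1 := Sob.norm_incl_le h z
  have h2 : (lam : ℝ) * ‖z‖ ≤ 1 * ‖z‖ := by gcongr; exact_mod_cast hl
  linarith

/-- On high modes the mixed norm gains a factor `λ`. -/
theorem mixNorm_high_le (h : t ≤ s) {lam : ℝ≥0} {K : ℝ} (hK : 1 ≤ K)
    (hlK : K ^ (t - s) ≤ lam) (z : Sob N s) :
    mixNorm N h lam (Sob.high s K z) ≤ 2 * lam * ‖z‖ := by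
  rw [mixNorm_apply]
  have h1 : ‖Sob.incl h (Sob.high s K z)‖ ≤ lam * ‖z‖ := by
    refine Sob.norm_le_of_forall_le _ z lam.2 fun j => ?_
    rw [Sob.incl_seq, Sob.high_seq]
    split_ifs with hj
    · rw [norm_zero, mul_zero]
      exact mul_nonneg lam.2 (mul_nonneg (wt_nonneg _ _) (norm_nonneg _))
    · rw [← mul_assoc]
      gcongr
      have e : wt t j = wt (t - s) j * wt s j := by rw [← wt_add, sub_add_cancel]
      rw [e]
      gcongr
      · exact wt_nonneg _ _
      · refine le_trans ?_ hlK
        exact Real.rpow_le_rpow_of_nonpos (by linarith) (not_le.1 hj).le (by linarith)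
  have h2 : (lam : ℝ) * ‖Sob.high s K z‖ ≤ lam * ‖z‖ := by
    gcongr
    exact Sob.norm_diag_le _ _ _
  linarith

/-- The projection on high modes for the indices in `A`, on low modes for the others. -/
def splitProj (s K : ℝ) (A : Finset (Fin m)) (i : Fin m) : Sob N s →L[ℂ] Sob N s :=
  if i ∈ A then Sob.high s K else Sob.low s K

theorem norm_splitProj_le (K : ℝ) (A : Finset (Fin m)) (i : Fin m) (z : Sob N s) :
    ‖splitProj s K A i z‖ ≤ ‖z‖ := by
  rw [splitProj]
  split_ifs
  · exact Sob.norm_diag_le _ _ _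
  · exact Sob.norm_diag_le _ _ _

theorem mixNorm_splitProj_le (h : t ≤ s) (lam : ℝ≥0) (K : ℝ) (A : Finset (Fin m)) (i : Fin m)
    (z : Sob N s) : mixNorm N h lam (splitProj s K A i z) ≤ mixNorm N h lam z := by
  rw [splitProj]
  split_ifs
  · exact mixNorm_diag_le _ _ _ _ _
  · exact mixNorm_diag_le _ _ _ _ _

theorem rhoL_single (j : Mode N) : Sob.rhoL N s (Sob.single s j) = Sob.single s (conjMode j) := by
  classical
  apply Sob.ext
  intro k
  rw [Sob.rhoL_seq, Sob.single_seq, Sob.single_seq]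
  congr 1
  rw [eq_iff_iff]
  exact ⟨fun h => by rw [← h, conjMode_conjMode], fun h => by rw [h, conjMode_conjMode]⟩

theorem splitProj_rhoL (K : ℝ) (A : Finset (Fin m)) (i : Fin m) (z : Sob N s) :
    splitProj s K A i (Sob.rhoL N s z) = Sob.rhoL N s (splitProj s K A i z) := by
  apply Sob.ext
  intro j
  rw [splitProj]
  split_ifs
  · rw [Sob.high_seq, Sob.rhoL_seq, Sob.rhoL_seq, Sob.high_seq, modeAbs_conjMode]
  · rw [Sob.low_seq, Sob.rhoL_seq, Sob.rhoL_seq, Sob.low_seq, modeAbs_conjMode]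

theorem splitProj_single (K : ℝ) (A : Finset (Fin m)) (i : Fin m) (j : Mode N)
    (h : ¬ (i ∈ A ↔ K < modeAbs j)) : splitProj s K A i (Sob.single s j) = 0 := by
  classical
  apply Sob.ext
  intro k
  rw [splitProj]
  split_ifs with hi
  · rw [Sob.high_seq, Sob.single_seq, Sob.seq_zero]
    split_ifs with h1 h2
    · rfl
    · subst h2
      exact absurd ⟨fun _ => not_le.1 h1, fun _ => hi⟩ h
    · rfl
  · rw [Sob.low_seq, Sob.single_seq, Sob.seq_zero]
    split_ifs with h1 h2
    · subst h2
      exact absurd ⟨fun h => absurd h hi, fun h2 => absurd h1 (not_le.2 h2)⟩ h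
    · rfl
    · rfl

/-- The part of a form in which at most two arguments are projected on high modes. -/
def truncForm (K : ℝ) (B : MultilinearMap ℂ (fun _ : Fin m => Sob N s) ℂ) :
    MultilinearMap ℂ (fun _ : Fin m => Sob N s) ℂ :=
  ∑ A : Finset (Fin m) with A.card ≤ 2,
    B.compLinearMap fun i => (splitProj s K A i).toLinearMap

theorem truncForm_apply (K : ℝ) (B : MultilinearMap ℂ (fun _ : Fin m => Sob N s) ℂ)
    (v : Fin m → Sob N s) :
    truncForm K B v = ∑ A : Finset (Fin m) with A.card ≤ 2, B fun i => splitProj s K A i (v i) := by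
  simp [truncForm]

theorem truncForm_bound (K : ℝ) {B : MultilinearMap ℂ (fun _ : Fin m => Sob N s) ℂ}
    (p : Sob N s → ℝ) (hp0 : ∀ z, 0 ≤ p z) (hp : ∀ A i z, p (splitProj (m := m) s K A i z) ≤ p z)
    {C lam : ℝ} (hC : 0 ≤ C) (hl : 0 ≤ lam) (hB : ∀ v, lam * ‖B v‖ ≤ C * ∏ i, p (v i))
    (v : Fin m → Sob N s) :
    lam * ‖truncForm K B v‖ ≤ 2 ^ m * C * ∏ i, p (v i) := by
  rw [truncForm_apply]
  have hP : 0 ≤ C * ∏ i, p (v i) := mul_nonneg hC (Finset.prod_nonneg fun _ _ => hp0 _)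
  calc _ ≤ ∑ A : Finset (Fin m) with A.card ≤ 2, lam * ‖B fun i => splitProj s K A i (v i)‖ := by
        rw [← Finset.mul_sum]
        gcongr
        exact norm_sum_le _ _
    _ ≤ ∑ A : Finset (Fin m) with A.card ≤ 2, C * ∏ i, p (v i) := by
        refine Finset.sum_le_sum fun A _ => (hB _).trans ?_
        gcongr with i
        · exact fun i _ => hp0 _
        · exact hp A i (v i)
    _ ≤ ∑ A : Finset (Fin m), C * ∏ i, p (v i) :=
        Finset.sum_le_sum_of_subset_of_nonneg (Finset.filter_subset _ _) fun _ _ _ => hP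
    _ = _ := by
        rw [Finset.sum_const, Finset.card_univ, Fintype.card_finset, Fintype.card_fin,
          nsmul_eq_mul]
        push_cast
        ring

/-- Solution of the homological equation: up to a remainder of size `λ`, which collects the
monomials with three or more high modes, a form `G` that is odd under `ρ` is minus the derivative of
a form `Q` along the free flow. -/
theorem exists_homological {κ : ℝ → ℂ} (hκ : Continuous κ) (hκ0 : MeasureTheory.Integrable κ)
    (hκ1 : MeasureTheory.Integrable (fun σ => |σ| * ‖κ σ‖)) (hint : ∫ σ, κ σ = 1)
    (hband : ∀ x : ℝ, 1 ≤ |x| → ∫ σ, κ σ * Complex.exp (-(x * σ : ℝ) * Complex.I) = 0)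
    {ω : Mode N → ℝ} (hodd : ∀ j, ω (conjMode j) = -ω j) (hts : t ≤ s) {lam : ℝ≥0}
    (hl0 : 0 < lam) (hl1 : lam ≤ 1) {K : ℝ} (hK : 1 ≤ K) (hlK : K ^ (t - s) ≤ lam) {c : ℝ}
    (hc : 0 < c)
    (hnr : ∀ v : Fin m → Mode N, ¬ IsActionIndex v →
      (Finset.univ.filter fun i => K < modeAbs (v i)).card ≤ 2 → c ≤ |∑ i, ω (v i)|)
    {C : ℝ} (hC : 0 ≤ C) {G : Sob N s → ℂ} (hG : IsForm (mixNorm N hts lam) lam m C G)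
    (hGrho : ∀ z, G (Sob.rhoL N s z) = -G z) :
    ∃ Q G' : Sob N s → ℂ,
      IsForm (mixNorm N hts lam) lam m (((∫ σ, |σ| * ‖κ σ‖) / c) * (2 ^ m * C)) Q ∧
      Continuous G' ∧
      (∀ z, Q (Sob.rhoL N s z) = Q z) ∧
      (∀ z, ‖G z - G' z‖ ≤ 4 ^ m * C * lam * ‖z‖ ^ m) ∧
      ∀ h z, Q (Sob.flow s ω h z) = Q z - ∫ τ in (0 : ℝ)..h, G' (Sob.flow s ω τ z) := by
  classical
  obtain ⟨B, hsym, hB1, hB2, hBG⟩ := hG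
  set B' := truncForm K B with hB'
  have hB'1 : ∀ v, ‖B' v‖ ≤ 2 ^ m * C * ∏ i, ‖v i‖ := fun v => by
    have := truncForm_bound K (B := B) (fun z => ‖z‖) (fun _ => norm_nonneg _)
      (fun A i z => norm_splitProj_le K A i z) hC zero_le_one
      (fun v => by rw [one_mul]; exact hB1 v) v
    rwa [one_mul] at this
  have hB'2 : ∀ v, (lam : ℝ) ^ 2 * ‖B' v‖ ≤ 2 ^ m * C * ∏ i, mixNorm N hts lam (v i) :=
    truncForm_bound K (mixNorm N hts lam) (fun _ => apply_nonneg _ _)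
      (fun A i z => mixNorm_splitProj_le hts lam K A i z) hC (by positivity) hB2
  -- the oddness of `G` passes to its polar form
  have hBrho : ∀ v : Fin m → Sob N s, B (fun i => Sob.rhoL N s (v i)) = -B v := by
    intro v
    have := IsSymmMap.eq_of_diag
      (B := B.compLinearMap fun _ => (Sob.rhoL N s).toLinearMap) (B' := -B)
      (fun σ v => hsym σ fun i => Sob.rhoL N s (v i))
      (fun σ v => by rw [neg_apply, neg_apply, hsym])
      (fun z => by
        rw [neg_apply, ← hBG, ← hGrho, hBG]
        rfl) v
    exact this
  have hB'rho : ∀ v : Fin m → Sob N s, B' (fun i => Sob.rhoL N s (v i)) = -B' v := by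
    intro v
    rw [hB', truncForm_apply, truncForm_apply, ← Finset.sum_neg_distrib]
    refine Finset.sum_congr rfl fun A _ => ?_
    simp only [splitProj_rhoL]
    exact hBrho _
  -- A basis monomial that survives in `B'` is not a product of actions and has at most two high
  -- modes, hence a lower bound on its divisor.
  have hB'nr : ∀ v : Fin m → Mode N, (B' fun i => Sob.single s (v i)) ≠ 0 → c ≤ |∑ i, ω (v i)| := by
    intro v hv
    apply hnr v
    · rintro ⟨σ, hσ⟩
      apply hv
      -- a product of actions is invariant under `ρ`, up to the order of its arguments
      have h1 : B' (fun i => Sob.single s (v i)) = -B' (fun i => Sob.single s (v i)) := by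
        have e1 : ∀ v : Fin m → Sob N s, B' (fun i => v (σ i)) = B' v := by
          intro v
          rw [hB', truncForm_apply, truncForm_apply]
          refine Finset.sum_bij' (fun A _ => A.map σ.toEmbedding)
            (fun A _ => A.map σ.symm.toEmbedding) ?_ ?_ ?_ ?_ ?_
          · intro A hA
            simpa using hA
          · intro A hA
            simpa using hA
          · intro A _
            ext i
            simp
          · intro A _
            ext i
            simp
          · intro A _
            rw [← hsym σ fun i => splitProj s K (A.map σ.toEmbedding) i (v i)]
            congr 1
            funext i
            simp [splitProj]
        have e2 := hB'rho fun i => Sob.single s (v i)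
        simp only [rhoL_single, ← hσ] at e2
        rw [e1 fun i => Sob.single s (v i)] at e2
        exact e2
      exact self_eq_neg.1 h1
    · by_contra hcard
      apply hv
      rw [hB', truncForm_apply]
      refine Finset.sum_eq_zero fun A hA => ?_
      have hA2 := (Finset.mem_filter.1 hA).2
      have : ∃ i, ¬ (i ∈ A ↔ K < modeAbs (v i)) := by
        by_contra hcon
        push Not at hcon
        apply hcard
        have : (Finset.univ.filter fun i => K < modeAbs (v i)) = A := by
          ext i
          simp [hcon i]
        rwa [this]
      obtain ⟨i, hi⟩ := this
      exact B.map_coord_zero i (splitProj_single K A i (v i) hi)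
  set D := avgForm ω hB'1 hκ hκ1 hc with hD
  have hDb1 : ∀ v, ‖D v‖ ≤ ((∫ σ, |σ| * ‖κ σ‖) / c) * (2 ^ m * C) * ∏ i, ‖v i‖ := fun v =>
    (norm_avgForm_le hB'1 hκ hκ1 hc v fun τ => norm_flowForm_le ω hB'1 τ v).trans_eq
      (mul_assoc _ _ _).symm
  have hl0' : (0 : ℝ) < lam := hl0
  refine ⟨fun z => D fun _ => z, fun z => B' fun _ => z, ?_, ?_, ?_, ?_, ?_⟩
  · apply IsForm.of_map
    · exact hDb1
    · intro v
      have h1 : ∀ τ, ‖flowForm ω B' τ v‖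
          ≤ 2 ^ m * C * (∏ i, mixNorm N hts lam (v i)) / lam ^ 2 := by
        intro τ
        rw [le_div_iff₀ (by positivity), mul_comm]
        refine (hB'2 _).trans ?_
        gcongr with i
        exact mixNorm_diag_le _ _ _ _ _
      have h2 := norm_avgForm_le hB'1 hκ hκ1 hc v h1
      rw [← mul_div_assoc, le_div_iff₀ (by positivity), mul_comm, ← mul_assoc] at h2
      exact h2
  · exact (B'.mkContinuous _ hB'1).cont.comp (continuous_pi fun _ => continuous_id)
  · intro z
    have : D.compLinearMap (fun _ => (Sob.rhoL N s).toLinearMap) = D := by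
      refine multilinear_ext_single
        (C := ((∫ σ, |σ| * ‖κ σ‖) / c) * (2 ^ m * C)) (fun v => ?_) hDb1 fun v => ?_
      · refine (hDb1 _).trans ?_
        have : 0 ≤ ∫ σ, |σ| * ‖κ σ‖ := MeasureTheory.integral_nonneg fun σ => by positivity
        gcongr with i
        exact Sob.norm_rhoL_le _
      · have e : (D.compLinearMap (fun _ => (Sob.rhoL N s).toLinearMap))
            (fun i => Sob.single s (v i)) = D fun i => Sob.single s (conjMode (v i)) := by
          simp only [MultilinearMap.compLinearMap_apply, ContinuousLinearMap.coe_coe, rhoL_single]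
        rw [e, hD, avgForm_single hB'1 hκ hκ1 hc hκ0 hint hband v (hB'nr v),
          avgForm_single hB'1 hκ hκ1 hc hκ0 hint hband _ (hB'nr _)]
        have e2 := hB'rho fun i => Sob.single s (v i)
        simp only [rhoL_single] at e2
        rw [e2]
        simp only [hodd, Finset.sum_neg_distrib]
        push_cast
        rw [mul_neg, neg_div_neg_eq]
    exact congrArg (fun M => M fun _ => z) this
  · intro z
    have e1 : G z = ∑ A : Finset (Fin m), B fun i => splitProj s K A i z := by
      rw [hBG]
      have : (fun _ : Fin m => z) = (fun _ => Sob.high s K z) + fun _ => Sob.low s K z := by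
        funext i
        rw [Pi.add_apply, add_comm, Sob.low_add_high]
      rw [this, MultilinearMap.map_add_univ]
      refine Finset.sum_congr rfl fun A _ => ?_
      congr 1
      funext i
      rw [Finset.piecewise, splitProj]
      split_ifs <;> rfl
    have e2 : G z - B' (fun _ => z)
        = ∑ A : Finset (Fin m) with ¬ A.card ≤ 2, B fun i => splitProj s K A i z := by
      rw [e1, hB', truncForm_apply, ← Finset.sum_filter_add_sum_filter_not Finset.univ
        (fun A : Finset (Fin m) => A.card ≤ 2), add_sub_cancel_left]
    show ‖G z - B' (fun _ => z)‖ ≤ _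
    rw [e2]
    calc _ ≤ ∑ A : Finset (Fin m) with ¬ A.card ≤ 2, ‖B fun i => splitProj s K A i z‖ :=
          norm_sum_le _ _
      _ ≤ ∑ A : Finset (Fin m) with ¬ A.card ≤ 2, 2 ^ m * C * lam * ‖z‖ ^ m := by
          refine Finset.sum_le_sum fun A hA => ?_
          have hA3 : 3 ≤ A.card := by
            have := (Finset.mem_filter.1 hA).2
            omega
          have h1 : ∏ i, mixNorm N hts lam (splitProj s K A i z)
              ≤ ∏ i, (if i ∈ A then 2 * lam * ‖z‖ else 2 * ‖z‖) := by
            refine Finset.prod_le_prod (fun _ _ => apply_nonneg _ _) fun i _ => ?_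
            rw [splitProj]
            split_ifs
            · exact mixNorm_high_le hts hK hlK z
            · exact (mixNorm_diag_le _ _ _ _ _).trans (mixNorm_le hts hl1 z)
          have h2 : ∏ i, (if i ∈ A then 2 * lam * ‖z‖ else 2 * ‖z‖)
              = (lam : ℝ) ^ A.card * (2 * ‖z‖) ^ m := by
            have : ∀ i : Fin m, (if i ∈ A then 2 * (lam : ℝ) * ‖z‖ else 2 * ‖z‖)
                = (if i ∈ A then (lam : ℝ) else 1) * (2 * ‖z‖) := by
              intro i
              split_ifs <;> ring
            simp only [this]
            rw [Finset.prod_mul_distrib, Finset.prod_const, Finset.card_univ, Fintype.card_fin,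
              Finset.prod_ite_mem, Finset.univ_inter, Finset.prod_const]
          have h3 : (lam : ℝ) ^ A.card ≤ lam ^ 3 :=
            pow_le_pow_of_le_one hl0'.le (by exact_mod_cast hl1) hA3
          have h4 : (lam : ℝ) ^ 2 * ‖B fun i => splitProj s K A i z‖
              ≤ lam ^ 2 * (2 ^ m * C * lam * ‖z‖ ^ m) := by
            calc _ ≤ C * ∏ i, mixNorm N hts lam (splitProj s K A i z) := hB2 _
              _ ≤ C * (lam ^ 3 * (2 * ‖z‖) ^ m) := by
                  rw [h2] at h1
                  gcongr
                  exact h1.trans (by gcongr)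
              _ = _ := by
                  rw [mul_pow]
                  ring
          exact le_of_mul_le_mul_left h4 (by positivity)
      _ ≤ ∑ A : Finset (Fin m), 2 ^ m * C * lam * ‖z‖ ^ m :=
          Finset.sum_le_sum_of_subset_of_nonneg (Finset.filter_subset _ _)
            fun _ _ _ => by positivity
      _ = _ := by
          rw [Finset.sum_const, Finset.card_univ, Fintype.card_finset, Fintype.card_fin,
            nsmul_eq_mul]
          push_cast
          rw [show (4 : ℝ) = 2 * 2 by norm_num, mul_pow]
          ring
  · intro h z
    exact avgForm_flow hB'1 hκ hκ1 hc hκ0 hint hband hB'nr h fun _ => z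

end Homological

/-! ### The modified energy -/

section Energy

variable {d : ℕ} {N : Set (Fin d → ℤ)} {s t : ℝ}

theorem Sob.summable_pairing (z w : Sob N s) :
    Summable fun j => ((wt s j : ℝ) : ℂ) * z.seq j * (((wt s j : ℝ) : ℂ) * w.seq (conjMode j)) := by
  refine Summable.of_norm_bounded (z.hasSum_sq.summable.add
    (Sob.rhoL N s w).hasSum_sq.summable) fun j => ?_
  rw [norm_mul, norm_mul, norm_mul, Complex.norm_real, Real.norm_of_nonneg (wt_nonneg s j),
    Sob.rhoL_seq]
  nlinarith [sq_nonneg (wt s j * ‖z.seq j‖ - wt s j * ‖w.seq (conjMode j)‖),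
    sq_nonneg (wt s j * ‖z.seq j‖), sq_nonneg (wt s j * ‖w.seq (conjMode j)‖)]

theorem Sob.norm_pairing_le (z w : Sob N s) :
    ‖∑' j, ((wt s j : ℝ) : ℂ) * z.seq j * (((wt s j : ℝ) : ℂ) * w.seq (conjMode j))‖
      ≤ ‖z‖ * ‖w‖ := by
  have e : ∀ j, ‖((wt s j : ℝ) : ℂ) * z.seq j * (((wt s j : ℝ) : ℂ) * w.seq (conjMode j))‖
      = (wt s j * ‖z.seq j‖) * (wt s j * ‖(Sob.rhoL N s w).seq j‖) := fun j => by
    rw [norm_mul, norm_mul, norm_mul, Complex.norm_real, Real.norm_of_nonneg (wt_nonneg s j),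
      Sob.rhoL_seq]
  have h0 : ∀ (z : Sob N s) j, 0 ≤ wt s j * ‖z.seq j‖ := fun z j =>
    mul_nonneg (wt_nonneg s j) (norm_nonneg _)
  have h1 := (Real.inner_le_Lp_mul_Lq_tsum_of_nonneg (p := 2) (q := 2)
    (by rw [Real.holderConjugate_iff]; norm_num)
    (h0 z) (h0 (Sob.rhoL N s w)) (by simpa using z.hasSum_sq.summable)
    (by simpa using (Sob.rhoL N s w).hasSum_sq.summable))
  have h2 : ∀ z : Sob N s, (∑' j, (wt s j * ‖z.seq j‖) ^ (2 : ℝ)) ^ (1 / (2 : ℝ)) = ‖z‖ := by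
    intro z
    rw [← Real.sqrt_eq_rpow]
    simp only [Real.rpow_ofNat]
    rw [z.hasSum_sq.tsum_eq, Real.sqrt_sq (norm_nonneg _)]
  rw [h2, h2] at h1
  refine (norm_tsum_le_tsum_norm (Sob.summable_pairing z w).norm).trans ?_
  rw [tsum_congr e]
  exact h1.trans (by gcongr; exact Sob.norm_rhoL_le w)

/-- The symmetric form `∑_j |j|^{2s} z_j w_{conj j}`. -/
def pairForm (N : Set (Fin d → ℤ)) (s : ℝ) : MultilinearMap ℂ (fun _ : Fin 2 => Sob N s) ℂ :=
  MultilinearMap.mk' (fun v => ∑' j : Mode N, ((wt s j : ℝ) : ℂ) * (v 0).seq j *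
      (((wt s j : ℝ) : ℂ) * (v 1).seq (conjMode j)))
    (fun v i x y => by
      rw [← (Sob.summable_pairing _ _).tsum_add (Sob.summable_pairing _ _)]
      refine tsum_congr fun j => ?_
      fin_cases i
      · simp [Function.update]
        ring
      · simp [Function.update]
        ring)
    (fun v i c x => by
      rw [smul_eq_mul, ← tsum_mul_left]
      refine tsum_congr fun j => ?_
      fin_cases i
      · simp [Function.update]
        ring
      · simp [Function.update]
        ring)

/-- The quadratic form `∑_j |j|^{2s} z_j z_{conj j}`, equal to `‖z‖²` for real `z`. -/
def normForm (N : Set (Fin d → ℤ)) (s : ℝ) (z : Sob N s) : ℂ := pairForm N s fun _ => z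

theorem normForm_eq (z : Sob N s) : normForm N s z
    = ∑' j : Mode N, ((wt s j : ℝ) : ℂ) * z.seq j * (((wt s j : ℝ) : ℂ) * z.seq (conjMode j)) := rfl

theorem isForm_normForm (hts : t ≤ s) (lam : ℝ≥0) :
    IsForm (mixNorm N hts lam) lam 2 1 (normForm N s) := by
  apply IsForm.of_map
  · intro v
    rw [one_mul, Fin.prod_univ_two]
    exact Sob.norm_pairing_le (v 0) (v 1)
  · intro v
    rw [one_mul, Fin.prod_univ_two]
    have h : ∀ z, lam * ‖z‖ ≤ mixNorm N hts lam z := fun z => by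
      rw [mixNorm_apply]
      linarith [norm_nonneg (Sob.incl hts z)]
    calc _ ≤ (lam : ℝ) ^ 2 * (‖v 0‖ * ‖v 1‖) := by
          gcongr
          exact Sob.norm_pairing_le (v 0) (v 1)
      _ = (lam * ‖v 0‖) * (lam * ‖v 1‖) := by ring
      _ ≤ _ := by
          gcongr
          · exact h _
          · exact h _

theorem normForm_rhoL (z : Sob N s) : normForm N s (Sob.rhoL N s z) = normForm N s z := by
  rw [normForm_eq, normForm_eq]
  refine tsum_congr fun j => ?_
  rw [Sob.rhoL_seq, Sob.rhoL_seq, conjMode_conjMode]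
  ring

/-- The quadratic energy is invariant under the free flow, since `ω` is odd under conjugation. -/
theorem normForm_flow {ω : Mode N → ℝ} (hodd : ∀ j, ω (conjMode j) = -ω j) (h : ℝ) (z : Sob N s) :
    normForm N s (Sob.flow s ω h z) = normForm N s z := by
  rw [normForm_eq, normForm_eq]
  refine tsum_congr fun j => ?_
  rw [Sob.flow_seq, Sob.flow_seq, hodd]
  have : Complex.exp (-(ω j * h : ℝ) * Complex.I) * Complex.exp (-(-ω j * h : ℝ) * Complex.I)
      = 1 := by
    rw [← Complex.exp_add, ← Complex.exp_zero]
    congr 1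
    push_cast
    ring
  linear_combination ((wt s j : ℝ) : ℂ) * z.seq j * ((wt s j : ℝ) : ℂ) * z.seq (conjMode j) * this

theorem normForm_of_isReal {z : Sob N s} (hz : IsReal z.seq) :
    normForm N s z = ((‖z‖ ^ 2 : ℝ) : ℂ) := by
  rw [normForm_eq, ← z.hasSum_sq.tsum_eq, Complex.ofReal_tsum]
  refine tsum_congr fun j => ?_
  have : z.seq (conjMode j) = (starRingEnd ℂ) (z.seq j) := hz j
  rw [this]
  push_cast
  have h2 := Complex.mul_conj' (z.seq j)
  rw [mul_pow, ← h2]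
  ring

/-- The homogeneous part of degree `m` of the derivative of `∑_k Q_k` along `∑_q A_q`. -/
def lieSum (Q : ℕ → Sob N s → ℂ) (A : ∀ q, MultilinearMap ℂ (fun _ : Fin q => Sob N s) (Sob N s))
    (m : ℕ) (z : Sob N s) : ℂ :=
  ∑ k ∈ Finset.Ico 2 m, fderiv ℂ (Q k) z (A (m + 1 - k) fun _ => z)

theorem fderiv_rhoL {Q : Sob N s → ℂ} (hQ : ∀ z, Q (Sob.rhoL N s z) = Q z)
    (hd : ∀ z, DifferentiableAt ℂ Q z) (z w : Sob N s) :
    fderiv ℂ Q (Sob.rhoL N s z) (Sob.rhoL N s w) = fderiv ℂ Q z w := by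
  have h1 : HasFDerivAt (fun z => Q (Sob.rhoL N s z))
      ((fderiv ℂ Q (Sob.rhoL N s z)).comp (Sob.rhoL N s)) z :=
    (hd _).hasFDerivAt.comp z (Sob.rhoL N s).hasFDerivAt
  have e : (fun z => Q (Sob.rhoL N s z)) = Q := funext hQ
  rw [e] at h1
  rw [h1.fderiv]
  rfl

/-- The corrections `Q_3, …, Q_R` of the quadratic energy: `Q_m` solves the homological equation
whose right-hand side is the homogeneous part of degree `m` produced by the previous ones. The
constant `b` depends neither on the frequency cut-off `K` nor on the lower bound `c` of the
divisors. -/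
theorem exists_modified_energy {κ : ℝ → ℂ} (hκ : Continuous κ) (hκ0 : MeasureTheory.Integrable κ)
    (hκ1 : MeasureTheory.Integrable (fun σ => |σ| * ‖κ σ‖)) (hint : ∫ σ, κ σ = 1)
    (hband : ∀ x : ℝ, 1 ≤ |x| → ∫ σ, κ σ * Complex.exp (-(x * σ : ℝ) * Complex.I) = 0)
    {ω : Mode N → ℝ} (hodd : ∀ j, ω (conjMode j) = -ω j) (hts : t ≤ s)
    (A : ∀ q, MultilinearMap ℂ (fun _ : Fin q => Sob N s) (Sob N s))
    (hArho : ∀ q z, A q (fun _ => Sob.rhoL N s z) = -Sob.rhoL N s (A q fun _ => z))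
    {CA : ℝ} (hCA : 0 ≤ CA) (R : ℕ) (hR : 2 ≤ R)
    (hA1 : ∀ q, 2 ≤ q → q ≤ R → ∀ v, ‖A q v‖ ≤ CA * ∏ i, ‖v i‖)
    (hA2 : ∀ lam : ℝ≥0, ∀ q, 2 ≤ q → q ≤ R → ∀ v,
      mixNorm N hts lam (A q v) ≤ CA * ∏ i, mixNorm N hts lam (v i)) :
    ∃ b : ℝ, 0 ≤ b ∧ ∀ lam : ℝ≥0, 0 < lam → lam ≤ 1 → ∀ K : ℝ, 1 ≤ K → K ^ (t - s) ≤ lam →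
      ∀ c : ℝ, 0 < c → c ≤ 1 →
      (∀ m, 1 ≤ m → m ≤ R → ∀ v : Fin m → Mode N, ¬ IsActionIndex v →
        (Finset.univ.filter fun i => K < modeAbs (v i)).card ≤ 2 → c ≤ |∑ i, ω (v i)|) →
      ∃ Q G' : ℕ → Sob N s → ℂ, Q 2 = normForm N s ∧
        (∀ m, 2 ≤ m → m ≤ R → IsForm (mixNorm N hts lam) lam m (b * (1 / c) ^ m) (Q m) ∧
          ∀ z, Q m (Sob.rhoL N s z) = Q m z) ∧
        ∀ m, 3 ≤ m → m ≤ R → Continuous (G' m) ∧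
          (∀ z, ‖lieSum Q A m z - G' m z‖ ≤ b * (1 / c) ^ m * lam * ‖z‖ ^ m) ∧
          ∀ h z, Q m (Sob.flow s ω h z) = Q m z - ∫ τ in (0 : ℝ)..h, G' m (Sob.flow s ω τ z) := by
  induction R, hR using Nat.le_induction with
  | base =>
    refine ⟨1, zero_le_one, fun lam hl0 hl1 K hK hlK c hc hc1 _ => ⟨fun _ => normForm N s,
      fun _ _ => 0, rfl, ?_, ?_⟩⟩
    · intro m hm hm'
      obtain rfl : m = 2 := by omega
      refine ⟨(isForm_normForm hts lam).mono ?_, normForm_rhoL⟩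
      rw [one_mul]
      exact one_le_pow₀ ((one_le_div hc).2 hc1)
    · intro m hm hm'
      omega
  | succ R hR ih =>
    obtain ⟨b, hb, ih⟩ := ih (fun q h1 h2 => hA1 q h1 (by omega))
      (fun lam q h1 h2 => hA2 lam q h1 (by omega))
    set M := ∫ σ, |σ| * ‖κ σ‖ with hM
    have hM0 : 0 ≤ M := MeasureTheory.integral_nonneg fun σ => by positivity
    set b1 : ℝ := ∑ k ∈ Finset.Ico 2 (R + 1), (k : ℝ) * (b * CA) with hb1
    have hb10 : 0 ≤ b1 := Finset.sum_nonneg fun k _ => by positivity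
    -- up to powers of `1/c`, `b1` bounds `lieSum`, the second term the new form and the third one
    -- the remainder
    refine ⟨b + M * (2 ^ (R + 1) * b1) + 4 ^ (R + 1) * b1, by positivity, ?_⟩
    intro lam hl0 hl1 K hK hlK c hc hc1 hnr
    have hD : 1 ≤ 1 / c := (one_le_div hc).2 hc1
    obtain ⟨Q, G', hQ2, hQ, hG'⟩ := ih lam hl0 hl1 K hK hlK c hc hc1
      fun m h1 h2 => hnr m h1 (by omega)
    have hform : IsForm (mixNorm N hts lam) lam (R + 1) (b1 * (1 / c) ^ R)
        (lieSum Q A (R + 1)) := by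
      rw [hb1, Finset.sum_mul]
      refine IsForm.sum _ _ _ fun k hk => ?_
      obtain ⟨hk2, hkR⟩ := Finset.mem_Ico.1 hk
      refine ((hQ k hk2 (by omega)).1.fderiv_comp (by positivity) (q := R + 1 + 1 - k)
        (K := CA) (by omega) (by omega) _ (hA1 _ (by omega) (by omega))
        (hA2 lam _ (by omega) (by omega))).mono ?_
      have : (1 / c) ^ k ≤ (1 / c) ^ R := pow_le_pow_right₀ hD (by omega)
      calc (k : ℝ) * (b * (1 / c) ^ k * CA) ≤ k * (b * (1 / c) ^ R * CA) := by gcongr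
        _ = _ := by ring
    have hodd' : ∀ z, lieSum Q A (R + 1) (Sob.rhoL N s z) = -lieSum Q A (R + 1) z := by
      intro z
      rw [lieSum, lieSum, ← Finset.sum_neg_distrib]
      refine Finset.sum_congr rfl fun k hk => ?_
      obtain ⟨hk2, hkR⟩ := Finset.mem_Ico.1 hk
      have h := hQ k hk2 (by omega)
      rw [hArho, map_neg, fderiv_rhoL h.2
        fun z => (h.1.hasStrictFDerivAt z).hasFDerivAt.differentiableAt]
    obtain ⟨Qn, Gn, h1, h2, h3, h4, h5⟩ := exists_homological hκ hκ0 hκ1 hint hband hodd hts hl0 hl1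
      hK hlK hc (hnr (R + 1) (by omega) le_rfl) (by positivity) hform hodd'
    have hpow : (1 / c) ^ R ≤ (1 / c) ^ (R + 1) := pow_le_pow_right₀ hD (by omega)
    have hlie : ∀ m, m ≤ R + 1 →
        lieSum (fun k => if k = R + 1 then Qn else Q k) A m = lieSum Q A m := by
      intro m hm
      funext z
      refine Finset.sum_congr rfl fun k hk => ?_
      have hk' : k ≠ R + 1 := by
        have := (Finset.mem_Ico.1 hk).2
        omega
      simp only [if_neg hk']
    have hbb : b ≤ b + M * (2 ^ (R + 1) * b1) + 4 ^ (R + 1) * b1 := by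
      have : 0 ≤ M * (2 ^ (R + 1) * b1) := by positivity
      have : 0 ≤ 4 ^ (R + 1) * b1 := by positivity
      linarith
    refine ⟨fun k => if k = R + 1 then Qn else Q k, fun k => if k = R + 1 then Gn else G' k,
      ?_, ?_, ?_⟩
    · simp only
      rw [if_neg (by omega), hQ2]
    · intro m hm2 hmR
      by_cases hm : m = R + 1
      · subst hm
        simp only [if_true]
        refine ⟨h1.mono ?_, h3⟩
        calc M / c * (2 ^ (R + 1) * (b1 * (1 / c) ^ R))
            = M * (2 ^ (R + 1) * b1) * (1 / c) ^ (R + 1) := by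
              rw [pow_succ]
              ring
          _ ≤ _ := by
              gcongr
              have : 0 ≤ 4 ^ (R + 1) * b1 := by positivity
              linarith
      · simp only [if_neg hm]
        have h := hQ m hm2 (by omega)
        exact ⟨h.1.mono (by gcongr), h.2⟩
    · intro m hm3 hmR
      rw [hlie m hmR]
      by_cases hm : m = R + 1
      · subst hm
        simp only [if_true]
        refine ⟨h2, fun z => (h4 z).trans ?_, h5⟩
        have : 4 ^ (R + 1) * (b1 * (1 / c) ^ R)
            ≤ (b + M * (2 ^ (R + 1) * b1) + 4 ^ (R + 1) * b1) * (1 / c) ^ (R + 1) := by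
          calc _ = 4 ^ (R + 1) * b1 * (1 / c) ^ R := by ring
            _ ≤ 4 ^ (R + 1) * b1 * (1 / c) ^ (R + 1) := by gcongr
            _ ≤ _ := by
              gcongr
              have : 0 ≤ M * (2 ^ (R + 1) * b1) := by positivity
              linarith
        gcongr
      · simp only [if_neg hm]
        have h := hG' m hm3 (by omega)
        refine ⟨h.1, fun z => (h.2.1 z).trans (by gcongr), h.2.2⟩

end Energy

/-! ### Ordered moduli -/

section Ordered

variable {d : ℕ} {N : Set (Fin d → ℤ)} {n m : ℕ}

theorem card_filter_eq_countP (v : Fin n → Mode N) (x : ℝ) :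
    (Finset.univ.filter fun i => x ≤ modeAbs (v i)).card
      = ((List.ofFn fun i => modeAbs (v i)).insertionSort (· ≥ ·)).countP
          fun y => decide (x ≤ y) := by
  rw [(List.perm_insertionSort (· ≥ ·) _).countP_eq, ← Multiset.coe_countP (fun y => x ≤ y),
    ← Fin.univ_val_map, Multiset.countP_map]
  rfl

theorem succ_le_card_kthAbs_le (v : Fin n → Mode N) {k : ℕ} (hk : k < n) :
    k + 1 ≤ (Finset.univ.filter fun i => kthAbs k v ≤ modeAbs (v i)).card := by
  rw [card_filter_eq_countP]
  set L := (List.ofFn fun i => modeAbs (v i)).insertionSort (· ≥ ·) with hL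
  have hlen : L.length = n := by rw [hL, List.length_insertionSort, List.length_ofFn]
  have hpw : L.Pairwise (· ≥ ·) := List.pairwise_insertionSort _ _
  have hkL : kthAbs k v = L[k]'(by omega) := List.getD_eq_getElem _ _ _
  have h1 : (L.take (k + 1)).countP (fun y => decide (kthAbs k v ≤ y)) = k + 1 := by
    rw [List.countP_eq_length.2, List.length_take, hlen]
    · omega
    · intro y hy
      obtain ⟨i, hi, rfl⟩ := List.getElem_of_mem hy
      rw [List.length_take] at hi
      rw [decide_eq_true_iff, hkL, List.getElem_take]
      rcases Nat.lt_or_ge i k with h | h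
      · exact List.pairwise_iff_getElem.1 hpw i k (by omega) (by omega) h
      · obtain rfl : i = k := by omega
        exact le_rfl
  rw [← h1]
  exact (List.take_sublist _ _).countP_le

theorem modeAbs_le_kthAbs_zero (v : Fin n → Mode N) (i : Fin n) : modeAbs (v i) ≤ kthAbs 0 v := by
  set L := (List.ofFn fun i => modeAbs (v i)).insertionSort (· ≥ ·) with hL
  have hlen : L.length = n := by rw [hL, List.length_insertionSort, List.length_ofFn]
  have hpw : L.Pairwise (· ≥ ·) := List.pairwise_insertionSort _ _
  have hmem : modeAbs (v i) ∈ L := by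
    rw [hL, List.mem_insertionSort, List.mem_ofFn]
    exact ⟨i, rfl⟩
  obtain ⟨k, hk, hkv⟩ := List.getElem_of_mem hmem
  have h0 : kthAbs 0 v = L[0]'(by omega) := List.getD_eq_getElem _ _ _
  rw [h0, ← hkv]
  rcases Nat.eq_zero_or_pos k with h | h
  · subst h
    exact le_rfl
  · exact List.pairwise_iff_getElem.1 hpw 0 k (by omega) (by omega) h

theorem kthAbs_of_le (v : Fin n → Mode N) {k : ℕ} (hk : n ≤ k) : kthAbs k v = 1 := by
  rw [kthAbs, List.getD_eq_default]
  rw [List.length_insertionSort, List.length_ofFn]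
  exact hk

theorem one_le_kthAbs (v : Fin n → Mode N) (k : ℕ) : 1 ≤ kthAbs k v := by
  rcases Nat.lt_or_ge k n with hk | hk
  · set L := (List.ofFn fun i => modeAbs (v i)).insertionSort (· ≥ ·) with hL
    have hlen : L.length = n := by rw [hL, List.length_insertionSort, List.length_ofFn]
    have hkL : kthAbs k v = L[k]'(by omega) := List.getD_eq_getElem _ _ _
    have hmem : kthAbs k v ∈ L := by
      rw [hkL]
      exact List.getElem_mem _
    rw [hL, List.mem_insertionSort, List.mem_ofFn] at hmem
    obtain ⟨i, hi⟩ := hmem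
    rw [← hi]
    exact one_le_modeAbs _
  · rw [kthAbs_of_le v hk]

theorem one_le_mu (v : Fin n → Mode N) : 1 ≤ mu v := one_le_kthAbs v 2

/-- The third largest modulus does not exceed `K` if at most two indices are above `K`. -/
theorem mu_le_of_card_le (v : Fin n → Mode N) {K : ℝ} (hK : 1 ≤ K)
    (h : (Finset.univ.filter fun i => K < modeAbs (v i)).card ≤ 2) : mu v ≤ K := by
  rcases Nat.lt_or_ge 2 n with hn | hn
  · by_contra hcon
    have h1 := succ_le_card_kthAbs_le v hn
    have h2 : (Finset.univ.filter fun i => kthAbs 2 v ≤ modeAbs (v i)).card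
        ≤ (Finset.univ.filter fun i => K < modeAbs (v i)).card := by
      apply Finset.card_le_card
      intro i hi
      rw [Finset.mem_filter] at hi ⊢
      exact ⟨hi.1, (not_le.1 hcon).trans_le hi.2⟩
    omega
  · rw [mu, kthAbs_of_le v hn]
    exact hK

/-- At least two arguments have modulus at least `μ(j, l)`, whatever the output mode `j`. -/
theorem exists_mu_le (j : Mode N) (l : Fin m → Mode N) (hm : 2 ≤ m) :
    ∃ i k, i ≠ k ∧ mu (Fin.cons j l : Fin (m + 1) → Mode N) ≤ modeAbs (l i) ∧
      mu (Fin.cons j l : Fin (m + 1) → Mode N) ≤ modeAbs (l k) := by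
  have h := succ_le_card_kthAbs_le (Fin.cons j l : Fin (m + 1) → Mode N) (k := 2) (by omega)
  set v : Fin (m + 1) → Mode N := Fin.cons j l with hv
  set S := (Finset.univ.filter fun i => kthAbs 2 v ≤ modeAbs (v i)) with hS
  have h2 : 1 < (S.erase 0).card := by
    have := Finset.pred_card_le_card_erase (s := S) (a := 0)
    omega
  obtain ⟨i, hi, k, hk, hik⟩ := Finset.one_lt_card.1 h2
  rw [Finset.mem_erase] at hi hk
  obtain ⟨i', rfl⟩ := Fin.exists_succ_eq.2 hi.1
  obtain ⟨k', rfl⟩ := Fin.exists_succ_eq.2 hk.1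
  refine ⟨i', k', fun h => hik (by rw [h]), ?_, ?_⟩
  · exact (Finset.mem_filter.1 hi.2).2
  · exact (Finset.mem_filter.1 hk.2).2

/-- An output mode far above all the arguments forces a large gap `S(j, l)`. -/
theorem sub_le_gapS (j : Mode N) (l : Fin m → Mode N) (hm : 1 ≤ m) {X : ℝ}
    (hX : ∀ i, modeAbs (l i) ≤ X) : modeAbs j - X ≤ gapS (Fin.cons j l : Fin (m + 1) → Mode N) := by
  have h := succ_le_card_kthAbs_le (Fin.cons j l : Fin (m + 1) → Mode N) (k := 1) (by omega)
  have h0 := modeAbs_le_kthAbs_zero (Fin.cons j l : Fin (m + 1) → Mode N) 0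
  rw [Fin.cons_zero] at h0
  set v : Fin (m + 1) → Mode N := Fin.cons j l with hv
  set S := (Finset.univ.filter fun i => kthAbs 1 v ≤ modeAbs (v i)) with hS
  have h2 : 0 < (S.erase 0).card := by
    have := Finset.pred_card_le_card_erase (s := S) (a := 0)
    omega
  obtain ⟨i, hi⟩ := Finset.card_pos.1 h2
  rw [Finset.mem_erase] at hi
  obtain ⟨i', rfl⟩ := Fin.exists_succ_eq.2 hi.1
  have h3 : kthAbs 1 v ≤ modeAbs (l i') := (Finset.mem_filter.1 hi.2).2
  have h4 := hX i'
  rw [gapS]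
  linarith

end Ordered

/-! ### Absolute summability -/

section Summability

/-- A product of summable families is summable over the multi-indices. -/
theorem summable_prod_pi {ι : Type*} {m : ℕ} (g : Fin m → ι → ℝ) (h0 : ∀ i x, 0 ≤ g i x)
    (hg : ∀ i, Summable (g i)) : Summable (fun l : Fin m → ι => ∏ i, g i (l i)) ∧
      ∑' l : Fin m → ι, ∏ i, g i (l i) ≤ ∏ i, ∑' x, g i x := by
  classical
  have key : ∀ T : Finset (Fin m → ι), ∑ l ∈ T, ∏ i, g i (l i) ≤ ∏ i, ∑' x, g i x := by
    intro T
    let S : Fin m → Finset ι := fun i => T.image fun l => l i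
    calc ∑ l ∈ T, ∏ i, g i (l i) ≤ ∑ l ∈ Fintype.piFinset S, ∏ i, g i (l i) := by
          refine Finset.sum_le_sum_of_subset_of_nonneg ?_
            fun l _ _ => Finset.prod_nonneg fun i _ => h0 _ _
          intro l hl
          rw [Fintype.mem_piFinset]
          exact fun i => Finset.mem_image_of_mem _ hl
      _ = ∏ i, ∑ x ∈ S i, g i x := (Finset.prod_univ_sum S g).symm
      _ ≤ _ := by
          refine Finset.prod_le_prod (fun i _ => Finset.sum_nonneg fun _ _ => h0 _ _) fun i _ => ?_
          exact (hg i).sum_le_tsum _ fun x _ => h0 i x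
  exact ⟨summable_of_sum_le (fun l => Finset.prod_nonneg fun i _ => h0 _ _) key,
    Real.tsum_le_of_sum_le (fun l => Finset.prod_nonneg fun i _ => h0 _ _) key⟩

variable {d : ℕ} {N : Set (Fin d → ℤ)}

theorem latAbs_sq (a : Fin d → ℤ) : latAbs a ^ 2 = max 1 (∑ i, (a i : ℝ) ^ 2) :=
  Real.sq_sqrt (le_trans zero_le_one (le_max_left _ _))

/-- The lattice sum `∑_j |j|^{-2(d+1)}` converges. -/
theorem summable_wt_neg (N : Set (Fin d → ℤ)) :
    Summable fun j : Mode N => wt (-((d : ℝ) + 1)) j ^ 2 := by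
  have h1 : Summable fun x : ℤ => 2 / (1 + (x : ℝ) ^ 2) := by
    have h := (Real.summable_one_div_int_pow (p := 2)).2 (by norm_num)
    refine Summable.of_norm_bounded_eventually (h.mul_left 2) ?_
    have : ∀ᶠ x : ℤ in Filter.cofinite, x ≠ 0 := by
      simpa using (Set.finite_singleton (0 : ℤ)).compl_mem_cofinite
    filter_upwards [this] with x hx
    have hx2 : (0 : ℝ) < (x : ℝ) ^ 2 := by positivity
    rw [Real.norm_of_nonneg (by positivity), mul_one_div]
    gcongr
    linarith
  have h2 := (summable_prod_pi (fun (_ : Fin d) (x : ℤ) => 2 / (1 + (x : ℝ) ^ 2))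
    (fun _ _ => by positivity) fun _ => h1).1
  have h3 : Summable fun a : N => ∏ i, 2 / (1 + (((a : Fin d → ℤ) i : ℤ) : ℝ) ^ 2) :=
    h2.subtype N
  have h4 : Summable fun j : Mode N => (∏ i, 2 / (1 + (((j.1 : Fin d → ℤ) i : ℤ) : ℝ) ^ 2)) * 1 :=
    h3.mul_of_nonneg (g := fun _ : ℤˣ => (1 : ℝ)) (Summable.of_finite)
      (fun a => Finset.prod_nonneg fun _ _ => by positivity) (fun _ => zero_le_one)
  refine Summable.of_nonneg_of_le (fun j => sq_nonneg _) (fun j => ?_) h4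
  have hx : 1 ≤ modeAbs j := one_le_modeAbs j
  have hx0 : 0 < modeAbs j := modeAbs_pos j
  have h5 : wt (-((d : ℝ) + 1)) j ^ 2 ≤ ((modeAbs j ^ 2) ^ d)⁻¹ := by
    rw [wt, ← Real.rpow_natCast, ← Real.rpow_mul hx0.le, ← pow_mul, ← Real.rpow_natCast,
      ← Real.rpow_neg hx0.le]
    apply Real.rpow_le_rpow_of_exponent_le hx
    push_cast
    nlinarith
  refine h5.trans ?_
  rw [mul_one]
  have h6 : ∀ i, (1 + (((j.1 : Fin d → ℤ) i : ℤ) : ℝ) ^ 2) / 2 ≤ modeAbs j ^ 2 := by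
    intro i
    have e : modeAbs j ^ 2 = max 1 (∑ i, (((j.1 : Fin d → ℤ) i : ℤ) : ℝ) ^ 2) := latAbs_sq _
    have h7 : (((j.1 : Fin d → ℤ) i : ℤ) : ℝ) ^ 2 ≤ ∑ i, (((j.1 : Fin d → ℤ) i : ℤ) : ℝ) ^ 2 :=
      Finset.single_le_sum (f := fun i => (((j.1 : Fin d → ℤ) i : ℤ) : ℝ) ^ 2)
        (fun i _ => sq_nonneg _) (Finset.mem_univ i)
    have h8 := le_max_left 1 (∑ i, (((j.1 : Fin d → ℤ) i : ℤ) : ℝ) ^ 2)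
    have h9 := le_max_right 1 (∑ i, (((j.1 : Fin d → ℤ) i : ℤ) : ℝ) ^ 2)
    linarith
  have h10 : ∏ i, (1 + (((j.1 : Fin d → ℤ) i : ℤ) : ℝ) ^ 2) / 2 ≤ (modeAbs j ^ 2) ^ d := by
    calc _ ≤ ∏ _i : Fin d, modeAbs j ^ 2 :=
          Finset.prod_le_prod (fun i _ => by positivity) fun i _ => h6 i
      _ = _ := by simp
  have h11 : ∏ i, 2 / (1 + (((j.1 : Fin d → ℤ) i : ℤ) : ℝ) ^ 2)
      = (∏ i, (1 + (((j.1 : Fin d → ℤ) i : ℤ) : ℝ) ^ 2) / 2)⁻¹ := by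
    rw [← Finset.prod_inv_distrib]
    exact Finset.prod_congr rfl fun i _ => by rw [inv_div]
  rw [h11]
  exact inv_anti₀ (Finset.prod_pos fun i _ => by positivity) h10

/-- For `z ∈ 𝒫_s` the series `∑_j |j|^σ |z_j|` converges as soon as `σ + d + 1 ≤ s`. -/
theorem exists_summable_wt (N : Set (Fin d → ℤ)) : ∃ Λ : ℝ, 0 ≤ Λ ∧
    (∀ S : Finset (Mode N), ∑ j ∈ S, wt (-((d : ℝ) + 1)) j ^ 2 ≤ Λ ^ 2) ∧
    ∀ s σ : ℝ, σ + ((d : ℝ) + 1) ≤ s → ∀ z : Sob N s,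
      Summable (fun j => wt σ j * ‖z.seq j‖) ∧ ∑' j, wt σ j * ‖z.seq j‖ ≤ Λ * ‖z‖ := by
  have hs := summable_wt_neg N
  set Λ := Real.sqrt (∑' j : Mode N, wt (-((d : ℝ) + 1)) j ^ 2) with hΛ
  have hΛ2 : Λ ^ 2 = ∑' j : Mode N, wt (-((d : ℝ) + 1)) j ^ 2 :=
    Real.sq_sqrt (tsum_nonneg fun _ => sq_nonneg _)
  have hΛS : ∀ S : Finset (Mode N), ∑ j ∈ S, wt (-((d : ℝ) + 1)) j ^ 2 ≤ Λ ^ 2 := fun S => by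
    rw [hΛ2]
    exact hs.sum_le_tsum S fun _ _ => sq_nonneg _
  refine ⟨Λ, Real.sqrt_nonneg _, hΛS, fun s σ hσ z => ?_⟩
  have h0 : ∀ j, 0 ≤ wt σ j * ‖z.seq j‖ := fun j => mul_nonneg (wt_nonneg _ _) (norm_nonneg _)
  have key : ∀ S : Finset (Mode N), ∑ j ∈ S, wt σ j * ‖z.seq j‖ ≤ Λ * ‖z‖ := by
    intro S
    calc _ ≤ ∑ j ∈ S, wt (-((d : ℝ) + 1)) j * (wt s j * ‖z.seq j‖) := by
          refine Finset.sum_le_sum fun j _ => ?_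
          rw [← mul_assoc, ← wt_add]
          gcongr
          exact wt_mono (by linarith) j
      _ ≤ Real.sqrt (∑ j ∈ S, wt (-((d : ℝ) + 1)) j ^ 2) *
            Real.sqrt (∑ j ∈ S, (wt s j * ‖z.seq j‖) ^ 2) := Real.sum_mul_le_sqrt_mul_sqrt _ _ _
      _ ≤ Λ * ‖z‖ := by
          gcongr
          · exact Real.sqrt_le_iff.2 ⟨Real.sqrt_nonneg _, hΛS S⟩
          · exact Real.sqrt_le_iff.2 ⟨norm_nonneg _, z.sum_sq_le S⟩
  exact ⟨summable_of_sum_le h0 key, Real.tsum_le_of_sum_le h0 key⟩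

end Summability

/-! ### The homogeneous parts of the vector field -/

section Homogeneous

variable {d : ℕ} {N : Set (Fin d → ℤ)} {s t : ℝ} {q : ℕ}

/-- The homogeneous part of degree `m` of the vector field with coefficients `a`. -/
def homPart (a : Coeffs N) (m : ℕ) (z : Mode N → ℂ) (j : Mode N) : ℂ :=
  ∑' l : Fin m → Mode N, a m j l * ∏ i, z (l i)

theorem one_le_wt {σ : ℝ} (hσ : 0 ≤ σ) (j : Mode N) : 1 ≤ wt σ j :=
  Real.one_le_rpow (one_le_modeAbs j) hσ

theorem wt_le_prod {σ : ℝ} (hσ : 0 ≤ σ) (l : Fin q → Mode N) (i : Fin q) :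
    wt σ (l i) ≤ ∏ k, wt σ (l k) := by
  rw [← Finset.mul_prod_erase Finset.univ _ (Finset.mem_univ i)]
  exact le_mul_of_one_le_right (wt_nonneg _ _)
    (Finset.one_le_prod fun k _ => one_le_wt hσ _)

/-- The coefficients grow at most polynomially in the moduli of the arguments alone. -/
theorem InTInfty.exists_bound {a : Coeffs N} {k : ℕ} {ν : ℝ} (h : InTInfty a k ν) (hν : 0 ≤ ν)
    (h2 : 2 ≤ q) (hq : q ≤ k) : ∃ C : ℝ, 0 ≤ C ∧ ∀ j (l : Fin q → Mode N),
      ‖a q j l‖ ≤ C * ∏ i, wt ν (l i) := by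
  obtain ⟨C, hC⟩ := h 0
  refine ⟨max C 0, le_max_right _ _, fun j l => ?_⟩
  refine (hC q (Finset.mem_Icc.2 ⟨h2, hq⟩) j l).trans ?_
  rw [pow_zero, div_one, Nat.cast_zero, zero_add]
  obtain ⟨i, _, _, hi, _⟩ := exists_mu_le j l h2
  have h0 := one_le_mu (Fin.cons j l : Fin (q + 1) → Mode N)
  gcongr
  · exact le_max_left _ _
  · exact (Real.rpow_le_rpow (by linarith) hi hν).trans (wt_le_prod hν l i)

section Series

variable {b : (Fin q → Mode N) → ℂ} {C ν : ℝ} (hb : ∀ l, ‖b l‖ ≤ C * ∏ i, wt ν (l i))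
  (hs : ν + ((d : ℝ) + 1) ≤ s)

theorem summable_series {b : (Fin q → Mode N) → ℂ} {C ν : ℝ}
    (hb : ∀ l, ‖b l‖ ≤ C * ∏ i, wt ν (l i)) (hs : ν + ((d : ℝ) + 1) ≤ s) (v : Fin q → Sob N s) :
    Summable fun l : Fin q → Mode N => b l * ∏ i, (v i).seq (l i) := by
  obtain ⟨Λ, -, -, hΛ⟩ := exists_summable_wt N
  have h := (summable_prod_pi (fun (i : Fin q) j => wt ν j * ‖(v i).seq j‖)
    (fun i j => mul_nonneg (wt_nonneg _ _) (norm_nonneg _)) fun i => (hΛ s ν hs (v i)).1).1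
  refine Summable.of_norm_bounded (h.mul_left C) fun l => ?_
  rw [norm_mul, norm_prod, Finset.prod_mul_distrib, ← mul_assoc]
  exact mul_le_mul_of_nonneg_right (hb l) (Finset.prod_nonneg fun _ _ => norm_nonneg _)

/-- The monomial `v ↦ ∏ (v_i)_{l_i}`. -/
def monomialForm (s : ℝ) (l : Fin q → Mode N) : MultilinearMap ℂ (fun _ : Fin q => Sob N s) ℂ :=
  (MultilinearMap.mkPiAlgebra ℂ (Fin q) ℂ).compLinearMap fun i => (Sob.coord (l i)).toLinearMap

theorem monomialForm_apply (l : Fin q → Mode N) (v : Fin q → Sob N s) :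
    monomialForm s l v = ∏ i, (v i).seq (l i) := by
  simp [monomialForm]

/-- The multilinear form given by an absolutely convergent power series. -/
def seriesForm : MultilinearMap ℂ (fun _ : Fin q => Sob N s) ℂ :=
  MultilinearMap.mk' (fun v => ∑' l : Fin q → Mode N, b l * monomialForm s l v)
    (fun v i x y => by
      simp only [MultilinearMap.map_update_add, mul_add]
      refine Summable.tsum_add ?_ ?_
      · simpa only [monomialForm_apply] using summable_series hb hs (Function.update v i x)
      · simpa only [monomialForm_apply] using summable_series hb hs (Function.update v i y))
    (fun v i c x => by
      simp only [MultilinearMap.map_update_smul, smul_eq_mul]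
      rw [← tsum_mul_left]
      exact tsum_congr fun l => mul_left_comm _ _ _)

theorem seriesForm_apply (v : Fin q → Sob N s) :
    seriesForm hb hs v = ∑' l : Fin q → Mode N, b l * ∏ i, (v i).seq (l i) :=
  tsum_congr fun l => by rw [monomialForm_apply]

end Series

/-- A homogeneous polynomial map of `𝒫_s` given by absolutely convergent series is the diagonal of
a symmetric multilinear map with values in `𝒫_s`. -/
theorem exists_symm_field {b : Mode N → (Fin q → Mode N) → ℂ} {C ν : ℝ}
    (hb : ∀ j l, ‖b j l‖ ≤ C * ∏ i, wt ν (l i)) (hs : ν + ((d : ℝ) + 1) ≤ s)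
    (hP : ∀ z : Sob N s, ∃ w : Sob N s, ∀ j, w.seq j = ∑' l, b j l * ∏ i, z.seq (l i)) :
    ∃ A : MultilinearMap ℂ (fun _ : Fin q => Sob N s) (Sob N s), IsSymmMap A ∧
      ∀ z j, (A fun _ => z).seq j = ∑' l, b j l * ∏ i, z.seq (l i) := by
  let B : Mode N → MultilinearMap ℂ (fun _ : Fin q => Sob N s) ℂ :=
    fun j => symmetrize (seriesForm (hb j) hs)
  have hBd : ∀ j z, (B j fun _ => z) = ∑' l, b j l * ∏ i, z.seq (l i) := fun j z => by
    rw [symmetrize_diag, seriesForm_apply]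
  choose W hW using hP
  have hv : ∀ v : Fin q → Sob N s, ∃ w : Sob N s, ∀ j, w.seq j = B j v := by
    intro v
    refine ⟨((q.factorial : ℂ)⁻¹) • ∑ S : Finset (Fin q),
      (((-1 : ℤ) ^ (Sᶜ).card : ℤ) : ℂ) • W (∑ i ∈ S, v i), fun j => ?_⟩
    have h := (isSymmMap_symmetrize (seriesForm (hb j) hs)).factorial_smul v
    have hq : (q.factorial : ℂ) ≠ 0 := Nat.cast_ne_zero.2 q.factorial_ne_zero
    rw [Sob.seq_smul, Sob.seq_sum, inv_mul_eq_iff_eq_mul₀ hq]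
    rw [nsmul_eq_mul] at h
    rw [h]
    refine Finset.sum_congr rfl fun S _ => ?_
    rw [Sob.seq_smul, hW, ← hBd, zsmul_eq_mul]
  choose A hA using hv
  refine ⟨MultilinearMap.mk' A (fun v i x y => Sob.ext fun j => ?_)
    (fun v i c x => Sob.ext fun j => ?_), fun σ v => Sob.ext fun j => ?_, fun z j => ?_⟩
  · rw [Sob.seq_add, hA, hA, hA, MultilinearMap.map_update_add]
  · rw [Sob.seq_smul, hA, hA, MultilinearMap.map_update_smul, smul_eq_mul]
  · show (A _).seq j = (A _).seq j
    rw [hA, hA]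
    exact isSymmMap_symmetrize _ σ v
  · show (A _).seq j = _
    rw [hA, hBd]

theorem homPart_smul (a : Coeffs N) (m : ℕ) (c : ℂ) (z : Mode N → ℂ) (j : Mode N) :
    homPart a m (fun k => c * z k) j = c ^ m * homPart a m z j := by
  rw [homPart, homPart, ← tsum_mul_left]
  refine tsum_congr fun l => ?_
  rw [Finset.prod_mul_distrib, Finset.prod_const, Finset.card_univ, Fintype.card_fin]
  ring

/-- Comparison of two consecutive Taylor expansions bounds the homogeneous parts. -/
theorem exists_homPart_bound {F : (Mode N → ℂ) → (Mode N → ℂ)} {a : Coeffs N} {k : ℕ}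
    (hk : 1 ≤ k) (h1 : IsTaylorAt F a k s) (h2 : IsTaylorAt F a (k + 1) s) :
    ∃ C : ℝ, 0 ≤ C ∧ ∀ z : Sob N s, ∃ w : Sob N s,
      (∀ j, w.seq j = homPart a (k + 1) z.seq j) ∧ ‖w‖ ≤ C * ‖z‖ ^ (k + 1) := by
  obtain ⟨δ1, hδ1, C1, h1⟩ := h1
  obtain ⟨δ2, hδ2, C2, h2⟩ := h2
  set δ := min (min δ1 δ2) 1 with hδdef
  have hδ : 0 < δ := lt_min (lt_min hδ1 hδ2) one_pos
  set C := max C1 0 + max C2 0 with hC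
  have hC0 : 0 ≤ C := add_nonneg (le_max_right _ _) (le_max_right _ _)
  have hsmall : ∀ z : Sob N s, ‖z‖ < δ → ∃ w : Sob N s,
      (∀ j, w.seq j = homPart a (k + 1) z.seq j) ∧ ‖w‖ ≤ C * ‖z‖ ^ (k + 1) := by
    intro z hz
    obtain ⟨R1, hR1, hR1n⟩ := h1 z (by
      rw [mem_ball_zero_iff]
      exact hz.trans_le ((min_le_left _ _).trans (min_le_left _ _)))
    obtain ⟨R2, hR2, hR2n⟩ := h2 z (by
      rw [mem_ball_zero_iff]
      exact hz.trans_le ((min_le_left _ _).trans (min_le_right _ _)))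
    refine ⟨R1 - R2, fun j => ?_, ?_⟩
    · rw [Sob.seq_sub, hR1, hR2, Pi.sub_apply, Pi.sub_apply]
      rw [polyField, polyField, Finset.sum_Icc_succ_top (by omega)]
      rw [homPart]
      ring
    · have hz1 : ‖z‖ ≤ 1 := hz.le.trans (min_le_right _ _)
      calc ‖R1 - R2‖ ≤ ‖R1‖ + ‖R2‖ := norm_sub_le _ _
        _ ≤ C1 * ‖z‖ ^ (k + 1) + C2 * ‖z‖ ^ (k + 1 + 1) := add_le_add hR1n hR2n
        _ ≤ max C1 0 * ‖z‖ ^ (k + 1) + max C2 0 * ‖z‖ ^ (k + 1) := by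
            have : ‖z‖ ^ (k + 1 + 1) ≤ ‖z‖ ^ (k + 1) :=
              pow_le_pow_of_le_one (norm_nonneg _) hz1 (by omega)
            refine add_le_add (by gcongr; exact le_max_left _ _) ?_
            calc _ ≤ max C2 0 * ‖z‖ ^ (k + 1 + 1) := by gcongr; exact le_max_left _ _
              _ ≤ _ := by gcongr
        _ = _ := by rw [hC]; ring
  -- by homogeneity, the bound extends from a ball to the whole space
  refine ⟨C, hC0, fun z => ?_⟩
  by_cases hz : z = 0
  · subst hz
    obtain ⟨w, hw, hn⟩ := hsmall 0 (by rw [norm_zero]; exact hδ)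
    exact ⟨w, hw, hn⟩
  · have hzn : 0 < ‖z‖ := norm_pos_iff.2 hz
    set r : ℝ := δ / (2 * ‖z‖) with hr
    have hr0 : 0 < r := by positivity
    have hrc : (r : ℂ) ≠ 0 := Complex.ofReal_ne_zero.2 hr0.ne'
    have hnorm : ‖(r : ℂ) • z‖ = r * ‖z‖ := by
      rw [norm_smul, Complex.norm_real, Real.norm_of_nonneg hr0.le]
    obtain ⟨w, hw, hn⟩ := hsmall ((r : ℂ) • z) (by
      rw [hnorm, hr]
      field_simp
      linarith)
    refine ⟨((r : ℂ)⁻¹ ^ (k + 1)) • w, fun j => ?_, ?_⟩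
    · rw [Sob.seq_smul, hw]
      have e : ((r : ℂ) • z).seq = fun i => (r : ℂ) * z.seq i := rfl
      rw [e, homPart_smul, ← mul_assoc, ← mul_pow, inv_mul_cancel₀ hrc, one_pow, one_mul]
    · rw [norm_smul, norm_pow, norm_inv, Complex.norm_real, Real.norm_of_nonneg hr0.le]
      calc _ ≤ r⁻¹ ^ (k + 1) * (C * (r * ‖z‖) ^ (k + 1)) := by rw [← hnorm]; gcongr
        _ = (r⁻¹ * r) ^ (k + 1) * (C * ‖z‖ ^ (k + 1)) := by rw [mul_pow, mul_pow]; ring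
        _ = _ := by rw [inv_mul_cancel₀ hr0.ne', one_pow, one_mul]

end Homogeneous

/-! ### Tame estimates -/

section Tame

variable {d : ℕ} {N : Set (Fin d → ℤ)} {s t : ℝ} {q : ℕ}

/-- The output at a mode `j` whose modulus is at least four times the moduli of all the arguments is
controlled by absolute values, thanks to the decay of the coefficients in `S ≥ 3|j|/4`. -/
theorem exists_far_bound (h2 : 2 ≤ q) {b : Mode N → (Fin q → Mode N) → ℂ} {ν : ℝ}
    (hb : ∀ M : ℕ, ∃ C : ℝ, ∀ j l, ‖b j l‖ ≤ C * (mu (Fin.cons j l : Fin (q + 1) → Mode N) ^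
      ((M : ℝ) + ν) / (mu (Fin.cons j l : Fin (q + 1) → Mode N)
        + gapS (Fin.cons j l : Fin (q + 1) → Mode N)) ^ M))
    (hν : 0 ≤ ν) (ht : ν + 3 * ((d : ℝ) + 1) + 1 ≤ t) (hts : t ≤ s) :
    ∃ C : ℝ, 0 ≤ C ∧ ∀ (z : Sob N s) (j : Mode N) (X : ℝ), X ≤ modeAbs j / 4 →
      wt s j * ‖∑' l, b j l * ∏ i, (Sob.low s X z).seq (l i)‖
        ≤ C * (‖z‖ * ‖Sob.incl hts z‖ ^ (q - 1)) * wt (-((d : ℝ) + 1)) j := by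
  obtain ⟨Λ, hΛ0, -, hΛ⟩ := exists_summable_wt N
  set D : ℝ := (d : ℝ) + 1 with hD
  have hD0 : 0 < D := by positivity
  -- `M` is large enough for the decay of the coefficients to absorb the weight `|j|^s`
  obtain ⟨M, hM1, hM2⟩ : ∃ M : ℕ, s + D ≤ M ∧ (M : ℝ) ≤ s + D + 1 := by
    refine ⟨⌈s + D⌉₊, Nat.le_ceil _, (Nat.ceil_lt_add_one (by linarith)).le⟩
  obtain ⟨C0, hC0⟩ := hb M
  set C1 := max C0 0 * (4 / 3) ^ M with hC1
  have hC10 : 0 ≤ C1 := mul_nonneg (le_max_right _ _) (by positivity)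
  refine ⟨C1 * (q * Λ ^ q), by positivity, fun z j X hX => ?_⟩
  -- Two arguments `l i`, `l k` of modulus at least `μ` absorb `μ^{M+ν} ≤ μ^{(s-D)+(t-D)}`: the
  -- first one is measured in `𝒫_s`, all the others in `𝒫_t`.
  let g : Fin q → Fin q → Mode N → ℝ := fun i k x =>
    wt (if k = i then s - D else t - D) x * ‖z.seq x‖
  have hg0 : ∀ i k x, 0 ≤ g i k x := fun i k x => mul_nonneg (wt_nonneg _ _) (norm_nonneg _)
  have hg : ∀ i k, Summable (g i k) ∧ ∑' x, g i k x
      ≤ Λ * (if k = i then ‖z‖ else ‖Sob.incl hts z‖) := by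
    intro i k
    by_cases hki : k = i
    · simp only [g, if_pos hki]
      exact hΛ s (s - D) (by linarith) z
    · simp only [g, if_neg hki]
      have := hΛ t (t - D) (by linarith) (Sob.incl hts z)
      simpa only [Sob.incl_seq] using this
  have hsum : ∀ i, Summable (fun l : Fin q → Mode N => ∏ k, g i k (l k)) ∧
      ∑' l : Fin q → Mode N, ∏ k, g i k (l k) ≤ Λ ^ q * (‖z‖ * ‖Sob.incl hts z‖ ^ (q - 1)) := by
    intro i
    have h := summable_prod_pi (g i) (hg0 i) fun k => (hg i k).1
    refine ⟨h.1, h.2.trans ?_⟩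
    calc _ ≤ ∏ k, Λ * (if k = i then ‖z‖ else ‖Sob.incl hts z‖) :=
          Finset.prod_le_prod (fun k _ => tsum_nonneg fun x => hg0 i k x) fun k _ => (hg i k).2
      _ = _ := by
          rw [Finset.prod_mul_distrib, Finset.prod_const, Finset.card_univ, Fintype.card_fin,
            ← Finset.mul_prod_erase Finset.univ _ (Finset.mem_univ i), if_pos rfl]
          rw [Finset.prod_congr rfl (g := fun _ => ‖Sob.incl hts z‖), Finset.prod_const,
            Finset.card_erase_of_mem (Finset.mem_univ i), Finset.card_univ, Fintype.card_fin]
          intro k hk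
          rw [if_neg (Finset.ne_of_mem_erase hk)]
  have hj0 : 0 < modeAbs j := modeAbs_pos j
  have hterm : ∀ l : Fin q → Mode N, ‖b j l * ∏ i, (Sob.low s X z).seq (l i)‖
      ≤ C1 * wt (-(s + D)) j * ∑ i, ∏ k, g i k (l k) := by
    intro l
    have hrhs : 0 ≤ C1 * wt (-(s + D)) j * ∑ i, ∏ k, g i k (l k) :=
      mul_nonneg (mul_nonneg hC10 (wt_nonneg _ _))
        (Finset.sum_nonneg fun i _ => Finset.prod_nonneg fun k _ => hg0 _ _ _)
    by_cases hl : ∀ i, modeAbs (l i) ≤ X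
    · have hlow : ∀ i, (Sob.low s X z).seq (l i) = z.seq (l i) := fun i => by
        rw [Sob.low_seq, if_pos (hl i)]
      simp only [hlow]
      set μ := mu (Fin.cons j l : Fin (q + 1) → Mode N) with hμ
      have hμ1 : 1 ≤ μ := one_le_mu _
      have hgap := sub_le_gapS j l (by omega) hl
      have hden : 3 / 4 * modeAbs j ≤ μ + gapS (Fin.cons j l : Fin (q + 1) → Mode N) := by
        linarith
      obtain ⟨i, k, hik, hi, hk⟩ := exists_mu_le j l h2
      have hb1 : ‖b j l‖ ≤ C1 * wt (-(s + D)) j * (wt (s - D) (l i) * wt (t - D) (l k)) := by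
        calc ‖b j l‖ ≤ C0 * (μ ^ ((M : ℝ) + ν) /
              (μ + gapS (Fin.cons j l : Fin (q + 1) → Mode N)) ^ M) := hC0 j l
          _ ≤ max C0 0 * (μ ^ ((M : ℝ) + ν) / (3 / 4 * modeAbs j) ^ M) := by
              have h3 : 0 ≤ μ ^ ((M : ℝ) + ν) := Real.rpow_nonneg (by linarith) _
              have h4 : 0 ≤ μ ^ ((M : ℝ) + ν) /
                (μ + gapS (Fin.cons j l : Fin (q + 1) → Mode N)) ^ M :=
                div_nonneg h3 (pow_nonneg (le_trans (by positivity) hden) _)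
              refine (mul_le_mul_of_nonneg_right (le_max_left C0 0) h4).trans ?_
              gcongr
          _ = C1 * (modeAbs j ^ M)⁻¹ * μ ^ ((M : ℝ) + ν) := by
              rw [hC1, mul_pow, div_pow, div_pow]
              field_simp
          _ ≤ C1 * wt (-(s + D)) j * (wt (s - D) (l i) * wt (t - D) (l k)) := by
              gcongr
              · exact mul_nonneg hC10 (wt_nonneg _ _)
              · rw [wt, Real.rpow_neg hj0.le, ← Real.rpow_natCast]
                exact inv_anti₀ (Real.rpow_pos_of_pos hj0 _)
                  (Real.rpow_le_rpow_of_exponent_le (one_le_modeAbs j) hM1)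
              · calc μ ^ ((M : ℝ) + ν) ≤ μ ^ ((s - D) + (t - D)) :=
                      Real.rpow_le_rpow_of_exponent_le hμ1 (by linarith)
                  _ = μ ^ (s - D) * μ ^ (t - D) := Real.rpow_add (by linarith) _ _
                  _ ≤ _ := by
                      refine mul_le_mul ?_ ?_ (Real.rpow_nonneg (by linarith) _) (wt_nonneg _ _)
                      · exact Real.rpow_le_rpow (by linarith) hi (by linarith)
                      · exact Real.rpow_le_rpow (by linarith) hk (by linarith)
      have hprod : wt (s - D) (l i) * wt (t - D) (l k) * ∏ x, ‖z.seq (l x)‖ ≤ ∏ x, g i x (l x) := by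
        simp only [g]
        rw [Finset.prod_mul_distrib]
        refine mul_le_mul_of_nonneg_right ?_ (Finset.prod_nonneg fun _ _ => norm_nonneg _)
        rw [← Finset.mul_prod_erase Finset.univ _ (Finset.mem_univ i), if_pos rfl]
        refine mul_le_mul_of_nonneg_left ?_ (wt_nonneg _ _)
        rw [← Finset.mul_prod_erase _ _ (Finset.mem_erase.2 ⟨hik.symm, Finset.mem_univ k⟩),
          if_neg hik.symm]
        refine le_mul_of_one_le_right (wt_nonneg _ _) (Finset.one_le_prod fun x hx => ?_)
        rw [if_neg (Finset.ne_of_mem_erase (Finset.mem_of_mem_erase hx))]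
        exact one_le_wt (by linarith) _
      calc ‖b j l * ∏ i, z.seq (l i)‖ = ‖b j l‖ * ∏ i, ‖z.seq (l i)‖ := by
            rw [norm_mul, norm_prod]
        _ ≤ C1 * wt (-(s + D)) j * (wt (s - D) (l i) * wt (t - D) (l k)) * ∏ i, ‖z.seq (l i)‖ := by
            gcongr
        _ ≤ C1 * wt (-(s + D)) j * ∏ x, g i x (l x) := by
            rw [mul_assoc]
            refine mul_le_mul_of_nonneg_left hprod (mul_nonneg hC10 (wt_nonneg _ _))
        _ ≤ _ := by
            refine mul_le_mul_of_nonneg_left ?_ (mul_nonneg hC10 (wt_nonneg _ _))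
            exact Finset.single_le_sum (f := fun i => ∏ x, g i x (l x))
              (fun i _ => Finset.prod_nonneg fun x _ => hg0 _ _ _) (Finset.mem_univ i)
    · push Not at hl
      obtain ⟨i, hi⟩ := hl
      rw [Finset.prod_eq_zero (Finset.mem_univ i), mul_zero, norm_zero]
      · exact hrhs
      · rw [Sob.low_seq, if_neg (not_le.2 hi)]
  have htot : Summable fun l : Fin q → Mode N => ∑ i, ∏ k, g i k (l k) :=
    summable_sum fun i _ => (hsum i).1
  have h3 := tsum_of_norm_bounded (htot.hasSum.mul_left (C1 * wt (-(s + D)) j)) hterm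
  have h4 : ∑' l : Fin q → Mode N, ∑ i, ∏ k, g i k (l k)
      ≤ q * (Λ ^ q * (‖z‖ * ‖Sob.incl hts z‖ ^ (q - 1))) := by
    rw [Summable.tsum_finsetSum fun i _ => (hsum i).1]
    refine (Finset.sum_le_sum fun i _ => (hsum i).2).trans_eq ?_
    rw [Finset.sum_const, Finset.card_univ, Fintype.card_fin, nsmul_eq_mul]
  calc _ ≤ wt s j * (C1 * wt (-(s + D)) j * (q * (Λ ^ q *
          (‖z‖ * ‖Sob.incl hts z‖ ^ (q - 1))))) := by
        refine mul_le_mul_of_nonneg_left (h3.trans ?_) (wt_nonneg _ _)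
        exact mul_le_mul_of_nonneg_left h4 (mul_nonneg hC10 (wt_nonneg _ _))
    _ = _ := by
        have e : wt (-D) j = wt s j * wt (-(s + D)) j := by
          rw [← wt_add]
          congr 1
          ring
        rw [e]
        ring

/-- The dyadic sum `∑_{2^k < 4x} 4^{(k+1)σ}` is comparable with its last term. -/
theorem exists_dyadic_bound {σ : ℝ} (hσ : 0 < σ) : ∃ D : ℝ, 0 ≤ D ∧ ∀ x : ℝ, 1 ≤ x → ∀ n : ℕ,
    ∑ k ∈ Finset.range n, (if (2 : ℝ) ^ k / 4 < x then ((2 : ℝ) ^ (k + 1)) ^ (2 * σ) else 0)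
      ≤ D * x ^ (2 * σ) := by
  set r : ℝ := (2 : ℝ) ^ (2 * σ) with hr
  have hr1 : 1 < r := Real.one_lt_rpow (by norm_num) (by positivity)
  have hrk : ∀ k : ℕ, ((2 : ℝ) ^ k) ^ (2 * σ) = r ^ k := by
    intro k
    rw [hr, ← Real.rpow_natCast, ← Real.rpow_natCast, ← Real.rpow_mul (by norm_num),
      ← Real.rpow_mul (by norm_num), mul_comm]
  have hr0 : 0 < r - 1 := by linarith
  refine ⟨r ^ 2 / (r - 1) * 4 ^ (2 * σ), by positivity, fun x hx n => ?_⟩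
  set K := Nat.log 2 ⌊4 * x⌋₊ with hK
  have hfl : ⌊4 * x⌋₊ ≠ 0 := by
    rw [← Nat.pos_iff_ne_zero, Nat.floor_pos]
    linarith
  have hKx : (2 : ℝ) ^ K ≤ 4 * x := by
    have h1 : 2 ^ K ≤ ⌊4 * x⌋₊ := Nat.pow_log_le_self 2 hfl
    calc (2 : ℝ) ^ K ≤ (⌊4 * x⌋₊ : ℝ) := by exact_mod_cast h1
      _ ≤ 4 * x := Nat.floor_le (by linarith)
  rw [← Finset.sum_filter]
  calc _ ≤ ∑ k ∈ Finset.range (K + 1), ((2 : ℝ) ^ (k + 1)) ^ (2 * σ) := by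
        refine Finset.sum_le_sum_of_subset_of_nonneg ?_ fun _ _ _ => by positivity
        intro k hk
        have h2 := (Finset.mem_filter.1 hk).2
        rw [Finset.mem_range, Nat.lt_succ_iff]
        apply Nat.le_log_of_pow_le (by norm_num)
        apply Nat.le_floor
        push_cast
        linarith
    _ = r * ∑ k ∈ Finset.range (K + 1), r ^ k := by
        rw [Finset.mul_sum]
        exact Finset.sum_congr rfl fun k _ => by rw [hrk, pow_succ, mul_comm]
    _ ≤ r * (r ^ (K + 1) / (r - 1)) := by
        rw [geom_sum_eq hr1.ne']
        gcongr
        linarith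
    _ = r ^ 2 / (r - 1) * r ^ K := by
        rw [pow_succ]
        ring
    _ ≤ r ^ 2 / (r - 1) * (4 * x) ^ (2 * σ) := by
        have : r ^ K ≤ (4 * x) ^ (2 * σ) := by
          rw [← hrk]
          exact Real.rpow_le_rpow (by positivity) hKx (by positivity)
        gcongr
    _ = _ := by
        rw [Real.mul_rpow (by norm_num) (by linarith)]
        ring

/-- The tame estimate `‖A(z)‖_s ≤ C ‖z‖_s ‖z‖_t^{q-1}`. In the dyadic block `|j| ∼ 2^k`, the
arguments are cut at `2^k/4`: the low part contributes by `exists_far_bound`, and the rest by the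
continuity on `𝒫_t`. -/
theorem exists_tame_bound (h2 : 2 ≤ q) {b : Mode N → (Fin q → Mode N) → ℂ} {ν : ℝ}
    (hb : ∀ M : ℕ, ∃ C : ℝ, ∀ j l, ‖b j l‖ ≤ C * (mu (Fin.cons j l : Fin (q + 1) → Mode N) ^
      ((M : ℝ) + ν) / (mu (Fin.cons j l : Fin (q + 1) → Mode N)
        + gapS (Fin.cons j l : Fin (q + 1) → Mode N)) ^ M))
    (hν : 0 ≤ ν) (ht : ν + 3 * ((d : ℝ) + 1) + 1 ≤ t) (hts : t ≤ s) (hts' : t < s)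
    {At : MultilinearMap ℂ (fun _ : Fin q => Sob N t) (Sob N t)} {Ct : ℝ} (hCt : 0 ≤ Ct)
    (hAt : ∀ v, ‖At v‖ ≤ Ct * ∏ i, ‖v i‖)
    (hAtd : ∀ z j, (At fun _ => z).seq j = ∑' l, b j l * ∏ i, z.seq (l i)) :
    ∃ C : ℝ, 0 ≤ C ∧ ∀ z y : Sob N s, (∀ j, y.seq j = ∑' l, b j l * ∏ i, z.seq (l i)) →
      ‖y‖ ≤ C * (‖z‖ * ‖Sob.incl hts z‖ ^ (q - 1)) := by
  classical
  obtain ⟨Λ, hΛ0, hΛS, -⟩ := exists_summable_wt N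
  obtain ⟨C1, hC10, hC1⟩ := exists_far_bound h2 hb hν ht hts
  set σ := s - t with hσdef
  have hσ : 0 < σ := by linarith
  obtain ⟨D, hD0, hD⟩ := exists_dyadic_bound hσ
  refine ⟨Real.sqrt (2 * (C1 * Λ) ^ 2 + 2 * ((Ct * q) ^ 2 * D)), Real.sqrt_nonneg _,
    fun z y hy => ?_⟩
  set X := ‖z‖ * ‖Sob.incl hts z‖ ^ (q - 1) with hX
  have hX0 : 0 ≤ X := by positivity
  -- the dyadic block of the mode `j`
  let kk : Mode N → ℕ := fun j => Nat.log 2 ⌊modeAbs j⌋₊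
  have hkk1 : ∀ j, (2 : ℝ) ^ kk j ≤ modeAbs j := by
    intro j
    have h1 : 2 ^ kk j ≤ ⌊modeAbs j⌋₊ := Nat.pow_log_le_self 2
      (Nat.pos_iff_ne_zero.1 (Nat.floor_pos.2 (one_le_modeAbs j)))
    calc (2 : ℝ) ^ kk j ≤ (⌊modeAbs j⌋₊ : ℝ) := by exact_mod_cast h1
      _ ≤ modeAbs j := Nat.floor_le (modeAbs_pos j).le
  have hkk2 : ∀ j, modeAbs j ≤ (2 : ℝ) ^ (kk j + 1) := by
    intro j
    have h1 : ⌊modeAbs j⌋₊ < 2 ^ (kk j + 1) := Nat.lt_pow_succ_log_self (by norm_num) _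
    have h2 := (Nat.floor_lt (modeAbs_pos j).le).1 h1
    push_cast at h2
    exact h2.le
  let zk : ℕ → Sob N s := fun k => Sob.low s (2 ^ k / 4) z
  let H : ℕ → Sob N t := fun k =>
    (At fun _ => Sob.incl hts z) - At fun _ => Sob.incl hts (zk k)
  have hH : ∀ k, ‖H k‖ ≤ Ct * q * ‖Sob.incl hts z‖ ^ (q - 1)
      * ‖Sob.incl hts (Sob.high s (2 ^ k / 4) z)‖ := by
    intro k
    have h3 := MultilinearMap.norm_image_sub_le_of_bound At hCt hAt
      (fun _ => Sob.incl hts z) (fun _ => Sob.incl hts (zk k))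
    have hq : Nonempty (Fin q) := ⟨⟨0, by omega⟩⟩
    have e : ((fun _ : Fin q => Sob.incl hts z) - fun _ => Sob.incl hts (zk k))
        = fun _ => Sob.incl hts (Sob.high s (2 ^ k / 4) z) := by
      funext i
      rw [Pi.sub_apply, ← map_sub]
      congr 1
      rw [sub_eq_iff_eq_add, add_comm]
      exact (Sob.low_add_high _ z).symm
    rw [e, pi_norm_const, pi_norm_const, pi_norm_const, Fintype.card_fin] at h3
    refine h3.trans ?_
    have h4 : ‖Sob.incl hts (zk k)‖ ≤ ‖Sob.incl hts z‖ := by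
      have := Sob.norm_le_of_forall_le (Sob.incl hts (zk k)) (Sob.incl hts z) zero_le_one
        fun j => by
          rw [one_mul, Sob.incl_seq, Sob.incl_seq, Sob.low_seq]
          refine mul_le_mul_of_nonneg_left ?_ (wt_nonneg _ _)
          split_ifs
          · exact le_rfl
          · simp
      rwa [one_mul] at this
    rw [max_eq_left h4]
  have hsplit : ∀ j, (wt s j * ‖y.seq j‖) ^ 2
      ≤ 2 * ((C1 * X) ^ 2 * wt (-((d : ℝ) + 1)) j ^ 2)
        + 2 * (((2 : ℝ) ^ (kk j + 1)) ^ (2 * σ) * (wt t j * ‖(H (kk j)).seq j‖) ^ 2) := by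
    intro j
    have e1 : y.seq j = (∑' l, b j l * ∏ i, (zk (kk j)).seq (l i)) + (H (kk j)).seq j := by
      simp only [H]
      rw [Sob.seq_sub, hAtd, hAtd, Sob.incl_seq', Sob.incl_seq', hy]
      ring
    have h3 := hC1 z j (2 ^ kk j / 4) (by linarith [hkk1 j])
    have h4 : wt s j ≤ ((2 : ℝ) ^ (kk j + 1)) ^ σ * wt t j := by
      have e2 : wt s j = wt σ j * wt t j := by rw [← wt_add, hσdef, sub_add_cancel]
      rw [e2]
      gcongr
      · exact wt_nonneg _ _
      · exact Real.rpow_le_rpow (modeAbs_pos j).le (hkk2 j) hσ.le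
    set f := ∑' l, b j l * ∏ i, (zk (kk j)).seq (l i)
    have h5 : wt s j * ‖y.seq j‖ ≤ C1 * X * wt (-((d : ℝ) + 1)) j
        + ((2 : ℝ) ^ (kk j + 1)) ^ σ * (wt t j * ‖(H (kk j)).seq j‖) := by
      calc _ ≤ wt s j * (‖f‖ + ‖(H (kk j)).seq j‖) := by
            rw [e1]
            exact mul_le_mul_of_nonneg_left (norm_add_le _ _) (wt_nonneg _ _)
        _ = wt s j * ‖f‖ + wt s j * ‖(H (kk j)).seq j‖ := mul_add _ _ _
        _ ≤ _ := by
            refine add_le_add h3 ?_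
            rw [← mul_assoc]
            exact mul_le_mul_of_nonneg_right h4 (norm_nonneg _)
    have h6 : ((2 : ℝ) ^ (kk j + 1)) ^ (2 * σ) = (((2 : ℝ) ^ (kk j + 1)) ^ σ) ^ 2 := by
      rw [mul_comm, Real.rpow_mul (by positivity), Real.rpow_ofNat]
    rw [h6]
    have h7 : (wt s j * ‖y.seq j‖) ^ 2 ≤ (C1 * X * wt (-((d : ℝ) + 1)) j
        + ((2 : ℝ) ^ (kk j + 1)) ^ σ * (wt t j * ‖(H (kk j)).seq j‖)) ^ 2 :=
      pow_le_pow_left₀ (mul_nonneg (wt_nonneg _ _) (norm_nonneg _)) h5 2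
    refine h7.trans ((add_sq_le).trans_eq ?_)
    ring
  have hhigh : ∀ n : ℕ, ∑ k ∈ Finset.range n, ((2 : ℝ) ^ (k + 1)) ^ (2 * σ) *
      ‖Sob.incl hts (Sob.high s (2 ^ k / 4) z)‖ ^ 2 ≤ D * ‖z‖ ^ 2 := by
    intro n
    have h3 : HasSum (fun j => ∑ k ∈ Finset.range n, ((2 : ℝ) ^ (k + 1)) ^ (2 * σ) *
        (wt t j * ‖(Sob.incl hts (Sob.high s (2 ^ k / 4) z)).seq j‖) ^ 2)
        (∑ k ∈ Finset.range n, ((2 : ℝ) ^ (k + 1)) ^ (2 * σ) *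
          ‖Sob.incl hts (Sob.high s (2 ^ k / 4) z)‖ ^ 2) :=
      hasSum_sum fun k _ => (Sob.hasSum_sq _).mul_left _
    refine hasSum_le (fun j => ?_) h3 (z.hasSum_sq.mul_left D)
    have h4 : ∀ k ∈ Finset.range n, ((2 : ℝ) ^ (k + 1)) ^ (2 * σ) *
        (wt t j * ‖(Sob.incl hts (Sob.high s (2 ^ k / 4) z)).seq j‖) ^ 2
        = (if (2 : ℝ) ^ k / 4 < modeAbs j then ((2 : ℝ) ^ (k + 1)) ^ (2 * σ) else 0)
          * (wt t j * ‖z.seq j‖) ^ 2 := by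
      intro k _
      rw [Sob.incl_seq, Sob.high_seq]
      by_cases hk : modeAbs j ≤ 2 ^ k / 4
      · rw [if_pos hk, if_neg (not_lt.2 hk)]
        simp
      · rw [if_neg hk, if_pos (not_le.1 hk)]
    rw [Finset.sum_congr rfl h4, ← Finset.sum_mul]
    calc _ ≤ D * modeAbs j ^ (2 * σ) * (wt t j * ‖z.seq j‖) ^ 2 := by
          gcongr
          exact hD _ (one_le_modeAbs j) n
      _ = _ := by
          have e2 : wt s j = modeAbs j ^ σ * wt t j := by
            have : wt s j = wt σ j * wt t j := by rw [← wt_add, hσdef, sub_add_cancel]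
            exact this
          have e3 : modeAbs j ^ (2 * σ) = (modeAbs j ^ σ) ^ 2 := by
            rw [mul_comm, Real.rpow_mul (modeAbs_pos j).le, Real.rpow_ofNat]
          rw [e2, e3]
          ring
  apply Sob.norm_le_of_sum_le y (by positivity)
  intro S
  rw [mul_pow, Real.sq_sqrt (by positivity)]
  have hS1 : ∑ j ∈ S, wt (-((d : ℝ) + 1)) j ^ 2 ≤ Λ ^ 2 := hΛS S
  have hS2 : ∑ j ∈ S, ((2 : ℝ) ^ (kk j + 1)) ^ (2 * σ) * (wt t j * ‖(H (kk j)).seq j‖) ^ 2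
      ≤ (Ct * q) ^ 2 * D * X ^ 2 := by
    set n := S.sup kk + 1 with hn
    have hmaps : ∀ j ∈ S, kk j ∈ Finset.range n := fun j hj =>
      Finset.mem_range.2 (Nat.lt_succ_of_le (Finset.le_sup (f := kk) hj))
    rw [← Finset.sum_fiberwise_of_maps_to hmaps]
    calc _ ≤ ∑ k ∈ Finset.range n, ((2 : ℝ) ^ (k + 1)) ^ (2 * σ) * ‖H k‖ ^ 2 := by
          refine Finset.sum_le_sum fun k _ => ?_
          calc _ = ∑ j ∈ S with kk j = k, ((2 : ℝ) ^ (k + 1)) ^ (2 * σ) *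
                (wt t j * ‖(H k).seq j‖) ^ 2 := by
                refine Finset.sum_congr rfl fun j hj => ?_
                rw [(Finset.mem_filter.1 hj).2]
            _ ≤ _ := by
                rw [← Finset.mul_sum]
                gcongr
                exact (H k).sum_sq_le _
      _ ≤ ∑ k ∈ Finset.range n, ((Ct * q) * ‖Sob.incl hts z‖ ^ (q - 1)) ^ 2 *
            (((2 : ℝ) ^ (k + 1)) ^ (2 * σ) *
              ‖Sob.incl hts (Sob.high s (2 ^ k / 4) z)‖ ^ 2) := by
          refine Finset.sum_le_sum fun k _ => ?_
          calc _ ≤ ((2 : ℝ) ^ (k + 1)) ^ (2 * σ) * (Ct * q * ‖Sob.incl hts z‖ ^ (q - 1)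
                * ‖Sob.incl hts (Sob.high s (2 ^ k / 4) z)‖) ^ 2 := by
                gcongr
                exact hH k
            _ = _ := by ring
      _ ≤ ((Ct * q) * ‖Sob.incl hts z‖ ^ (q - 1)) ^ 2 * (D * ‖z‖ ^ 2) := by
          rw [← Finset.mul_sum]
          gcongr
          exact hhigh n
      _ = _ := by
          rw [hX]
          ring
  calc _ ≤ ∑ j ∈ S, (2 * ((C1 * X) ^ 2 * wt (-((d : ℝ) + 1)) j ^ 2)
        + 2 * (((2 : ℝ) ^ (kk j + 1)) ^ (2 * σ) * (wt t j * ‖(H (kk j)).seq j‖) ^ 2)) :=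
        Finset.sum_le_sum fun j _ => hsplit j
    _ = 2 * ((C1 * X) ^ 2 * ∑ j ∈ S, wt (-((d : ℝ) + 1)) j ^ 2) + 2 * ∑ j ∈ S,
        ((2 : ℝ) ^ (kk j + 1)) ^ (2 * σ) * (wt t j * ‖(H (kk j)).seq j‖) ^ 2 := by
        rw [Finset.sum_add_distrib, ← Finset.mul_sum, ← Finset.mul_sum, ← Finset.mul_sum]
    _ ≤ 2 * ((C1 * X) ^ 2 * Λ ^ 2) + 2 * ((Ct * q) ^ 2 * D * X ^ 2) := by gcongr
    _ = _ := by ring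

end Tame

/-! ### The Taylor expansion as a sum of multilinear maps -/

section TaylorFields

variable {d : ℕ} {N : Set (Fin d → ℤ)} {s t : ℝ} {q : ℕ}

/-- The homogeneous parts of a reversible field anticommute with `ρ`. -/
theorem homPart_rho {a : Coeffs N}
    (ha : ∀ (m : ℕ) (j : Mode N) (l : Fin m → Mode N),
      a m (conjMode j) (fun i => conjMode (l i)) = -a m j l)
    (m : ℕ) (z : Mode N → ℂ) (j : Mode N) :
    homPart a m (rho z) j = -homPart a m z (conjMode j) := by
  rw [homPart, homPart, ← tsum_neg,
    ← (Equiv.piCongrRight fun _ : Fin m => conjEquiv (N := N)).tsum_eq]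
  refine tsum_congr fun l => ?_
  have h := ha m (conjMode j) l
  rw [conjMode_conjMode] at h
  have e : (Equiv.piCongrRight fun _ : Fin m => conjEquiv (N := N)) l
    = fun i => conjMode (l i) := rfl
  rw [e, h, neg_mul]
  simp only [rho, conjMode_conjMode]

/-- The homogeneous part of degree `q` of the field is the diagonal of a multilinear map which is
bounded both in the norm of `𝒫_s` and, uniformly in `lam`, in the mixed norms. -/
theorem exists_homogeneous_field {a : Coeffs N} {ν : ℝ} (h2 : 2 ≤ q)
    (ha : ∀ (m : ℕ) (j : Mode N) (l : Fin m → Mode N),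
      a m (conjMode j) (fun i => conjMode (l i)) = -a m j l)
    (hν : 0 ≤ ν) (hT : InTInfty a q ν) (ht : ν + 3 * ((d : ℝ) + 1) + 1 ≤ t) (hts : t < s)
    (hbt : ∃ C : ℝ, 0 ≤ C ∧ ∀ z : Sob N t, ∃ w : Sob N t,
      (∀ j, w.seq j = homPart a q z.seq j) ∧ ‖w‖ ≤ C * ‖z‖ ^ q)
    (hbs : ∃ C : ℝ, 0 ≤ C ∧ ∀ z : Sob N s, ∃ w : Sob N s,
      (∀ j, w.seq j = homPart a q z.seq j) ∧ ‖w‖ ≤ C * ‖z‖ ^ q) :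
    ∃ C : ℝ, 0 ≤ C ∧ ∃ A : MultilinearMap ℂ (fun _ : Fin q => Sob N s) (Sob N s),
      (∀ z j, (A fun _ => z).seq j = -Complex.I * homPart a q z.seq j) ∧
      (∀ z, A (fun _ => Sob.rhoL N s z) = -Sob.rhoL N s (A fun _ => z)) ∧
      (∀ v, ‖A v‖ ≤ C * ∏ i, ‖v i‖) ∧
      ∀ (lam : ℝ≥0) (v), mixNorm N hts.le lam (A v) ≤ C * ∏ i, mixNorm N hts.le lam (v i) := by
  obtain ⟨Ct, hCt0, hCt⟩ := hbt
  obtain ⟨Cs, hCs0, hCs⟩ := hbs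
  obtain ⟨C0, -, hC0⟩ := hT.exists_bound hν h2 le_rfl
  have hd0 : (0 : ℝ) ≤ d := Nat.cast_nonneg d
  have norm_of : ∀ {σ C : ℝ} (B : MultilinearMap ℂ (fun _ : Fin q => Sob N σ) (Sob N σ)),
      (∀ z j, (B fun _ => z).seq j = homPart a q z.seq j) →
      (∀ z : Sob N σ, ∃ w : Sob N σ, (∀ j, w.seq j = homPart a q z.seq j) ∧
        ‖w‖ ≤ C * ‖z‖ ^ q) → ∀ z, ‖B fun _ => z‖ ≤ C * ‖z‖ ^ q := by
    intro σ C B hB h z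
    obtain ⟨w, hw, hn⟩ := h z
    have e : (B fun _ => z) = w := Sob.ext fun j => by rw [hB, hw]
    rwa [e]
  obtain ⟨At, hAts, hAtd⟩ := exists_symm_field (N := N) (s := t) (b := fun j l => a q j l) hC0
    (by linarith) fun z => (hCt z).imp fun w h => h.1
  obtain ⟨As, hAss, hAsd⟩ := exists_symm_field (N := N) (s := s) (b := fun j l => a q j l) hC0
    (by linarith) fun z => (hCs z).imp fun w h => h.1
  have hAtb := hAts.bound_of_diag (normSeminorm ℂ _) (normSeminorm ℂ _) hCt0
    (norm_of At hAtd hCt)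
  have hAsb := hAss.bound_of_diag (normSeminorm ℂ _) (normSeminorm ℂ _) hCs0
    (norm_of As hAsd hCs)
  obtain ⟨C3, hC30, hC3⟩ := exists_tame_bound (s := s) (t := t) h2 (b := fun j l => a q j l)
    (fun M => (hT M).imp fun C h j l => h q (Finset.mem_Icc.2 ⟨h2, le_rfl⟩) j l) hν ht hts.le hts
    (by positivity) hAtb hAtd
  have hmix : ∀ (lam : ℝ≥0) (z : Sob N s), mixNorm N hts.le lam (As fun _ => z)
      ≤ (Ct + C3) * mixNorm N hts.le lam z ^ q := by
    intro lam z
    have e : Sob.incl hts.le (As fun _ => z) = At fun _ => Sob.incl hts.le z :=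
      Sob.ext fun j => by rw [Sob.incl_seq, hAsd, hAtd, Sob.incl_seq']
    have h1 := norm_of At hAtd hCt (Sob.incl hts.le z)
    have h3 := hC3 z _ (hAsd z)
    rw [mixNorm_apply, mixNorm_apply, e]
    set x := ‖Sob.incl hts.le z‖
    set y := ‖z‖
    have hx : 0 ≤ x := norm_nonneg _
    have hy : 0 ≤ (lam : ℝ) * y := mul_nonneg lam.2 (norm_nonneg _)
    have h4 : x ^ q ≤ (x + lam * y) ^ q := by gcongr; linarith
    have h5 : (lam : ℝ) * y * x ^ (q - 1) ≤ (x + lam * y) ^ q := by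
      calc _ ≤ (x + lam * y) * (x + lam * y) ^ (q - 1) := by gcongr <;> linarith
        _ = _ := by rw [← pow_succ']; congr 1; omega
    calc _ ≤ Ct * x ^ q + lam * (C3 * (y * x ^ (q - 1))) := by gcongr
      _ = Ct * x ^ q + C3 * (lam * y * x ^ (q - 1)) := by ring
      _ ≤ Ct * (x + lam * y) ^ q + C3 * (x + lam * y) ^ q := by gcongr
      _ = _ := by ring
  have hmixb := fun lam => hAss.bound_of_diag (mixNorm N hts.le lam) (mixNorm N hts.le lam)
    (add_nonneg hCt0 hC30) (hmix lam)
  have hI : ‖-Complex.I‖ = 1 := by simp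
  have hAd : ∀ z j, (((-Complex.I) • As) fun _ => z).seq j = -Complex.I * homPart a q z.seq j := by
    intro z j
    rw [smul_apply, Sob.seq_smul, hAsd]
    rfl
  refine ⟨2 ^ q * q ^ q * (Cs + (Ct + C3)), by positivity, (-Complex.I) • As, hAd, fun z => ?_,
    fun v => ?_, fun lam v => ?_⟩
  · refine Sob.ext fun j => ?_
    rw [Sob.seq_neg, Sob.rhoL_seq, hAd, hAd, Sob.rhoL_seq', homPart_rho ha]
    ring
  · rw [smul_apply, norm_smul, hI, one_mul]
    refine (hAsb v).trans ?_
    refine mul_le_mul_of_nonneg_right ?_ (Finset.prod_nonneg fun i _ => apply_nonneg _ _)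
    exact mul_le_mul_of_nonneg_left (by linarith) (by positivity)
  · rw [smul_apply, map_smul_eq_mul, hI, one_mul]
    refine (hmixb lam v).trans ?_
    refine mul_le_mul_of_nonneg_right ?_ (Finset.prod_nonneg fun i _ => apply_nonneg _ _)
    exact mul_le_mul_of_nonneg_left (by linarith) (by positivity)

/-- The Taylor expansion of degree `R` of the field `-iF` near the origin of `𝒫_s`, for all `s`
beyond a threshold `t` which depends on `R`. -/
theorem exists_taylor_fields {F : (Mode N → ℂ) → (Mode N → ℂ)} (hF : ReversibleClassT F) {R : ℕ}
    (hR : 2 ≤ R) : ∃ t : ℝ, 0 < t ∧ ∀ (s : ℝ) (hts : t < s), RegularRevAt F s ∧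
      ∃ A : ∀ q, MultilinearMap ℂ (fun _ : Fin q => Sob N s) (Sob N s), ∃ CA : ℝ, 0 ≤ CA ∧
        (∀ q z, A q (fun _ => Sob.rhoL N s z) = -Sob.rhoL N s (A q fun _ => z)) ∧
        (∀ q, 2 ≤ q → q ≤ R → ∀ v, ‖A q v‖ ≤ CA * ∏ i, ‖v i‖) ∧
        (∀ lam : ℝ≥0, ∀ q, 2 ≤ q → q ≤ R → ∀ v,
          mixNorm N hts.le lam (A q v) ≤ CA * ∏ i, mixNorm N hts.le lam (v i)) ∧
        ∃ δ : ℝ, 0 < δ ∧ ∃ C : ℝ, 0 ≤ C ∧ ∀ z f : Sob N s, ‖z‖ < δ → f.seq = F z.seq →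
          ‖(-Complex.I) • f - ∑ q ∈ Finset.Icc 2 R, A q fun _ => z‖ ≤ C * ‖z‖ ^ (R + 1) := by
  obtain ⟨s₀, hs₀, hreg, a, ha, hT⟩ := hF
  choose ν hν0 hνT hνs using hT
  let μ : ℕ → ℝ := fun k => if hk : 1 ≤ k then ν k hk else 0
  have hμ0 : ∀ k, 0 ≤ μ k := fun k => by
    simp only [μ]
    split_ifs
    · exact hν0 _ _
    · exact le_rfl
  have hμ : ∀ k (hk : 1 ≤ k), ν k hk = μ k := fun k hk => by simp only [μ, dif_pos hk]
  have hd0 : (0 : ℝ) ≤ d := Nat.cast_nonneg d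
  set t := s₀ + ∑ k ∈ Finset.Icc 1 R, μ k + 3 * ((d : ℝ) + 1) + 1 with ht
  have hμt : ∀ k, 1 ≤ k → k ≤ R → s₀ + μ k + 3 * ((d : ℝ) + 1) + 1 ≤ t := fun k h1 h2 => by
    have := Finset.single_le_sum (f := μ) (fun i _ => hμ0 i) (Finset.mem_Icc.2 ⟨h1, h2⟩)
    rw [ht]
    linarith
  have ht0 : s₀ < t := by have := hμt 1 le_rfl (by omega); have := hμ0 1; linarith
  have hTay : ∀ σ, t ≤ σ → ∀ k, 1 ≤ k → k ≤ R → IsTaylorAt (N := N) F a k σ :=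
    fun σ hσ k h1 h2 => hνs k h1 σ (by linarith) (by
      rw [hμ]
      have := hμt k h1 h2
      linarith)
  refine ⟨t, by linarith, fun s hts => ⟨hreg s (by linarith), ?_⟩⟩
  have hfield : ∀ q, ∃ A : MultilinearMap ℂ (fun _ : Fin q => Sob N s) (Sob N s), ∃ C : ℝ, 0 ≤ C ∧
      (∀ z, A (fun _ => Sob.rhoL N s z) = -Sob.rhoL N s (A fun _ => z)) ∧
      (2 ≤ q → q ≤ R →
        (∀ z j, (A fun _ => z).seq j = -Complex.I * homPart a q z.seq j) ∧
        (∀ v, ‖A v‖ ≤ C * ∏ i, ‖v i‖) ∧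
        ∀ (lam : ℝ≥0) (v), mixNorm N hts.le lam (A v) ≤ C * ∏ i, mixNorm N hts.le lam (v i)) := by
    intro q
    by_cases hq : 2 ≤ q ∧ q ≤ R
    · obtain ⟨h2, hqR⟩ := hq
      obtain ⟨k, rfl⟩ : ∃ k, q = k + 1 := ⟨q - 1, by omega⟩
      have hb : ∀ σ, t ≤ σ → ∃ C : ℝ, 0 ≤ C ∧ ∀ z : Sob N σ, ∃ w : Sob N σ,
          (∀ j, w.seq j = homPart a (k + 1) z.seq j) ∧ ‖w‖ ≤ C * ‖z‖ ^ (k + 1) := fun σ hσ =>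
        exists_homPart_bound (by omega) (hTay σ hσ k (by omega) (by omega))
          (hTay σ hσ (k + 1) (by omega) hqR)
      obtain ⟨C, hC, A, h1, h3, h4, h5⟩ := exists_homogeneous_field h2 (fun m j l => (ha m j l).2)
        (hν0 (k + 1) (by omega)) (hνT (k + 1) (by omega))
        (by rw [hμ]; have := hμt (k + 1) (by omega) hqR; linarith) hts (hb t le_rfl)
        (hb s hts.le)
      exact ⟨A, C, hC, h3, fun _ _ => ⟨h1, h4, h5⟩⟩
    · exact ⟨0, 0, le_rfl, fun z => by simp, fun h1 h2 => absurd ⟨h1, h2⟩ hq⟩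
  choose A C hC hrho hA using hfield
  have hCle : ∀ q, 2 ≤ q → q ≤ R → C q ≤ ∑ k ∈ Finset.Icc 2 R, C k := fun q h1 h2 =>
    Finset.single_le_sum (f := C) (fun i _ => hC i) (Finset.mem_Icc.2 ⟨h1, h2⟩)
  refine ⟨A, ∑ k ∈ Finset.Icc 2 R, C k, Finset.sum_nonneg fun k _ => hC k, hrho,
    fun q h1 h2 v => ((hA q h1 h2).2.1 v).trans ?_,
    fun lam q h1 h2 v => ((hA q h1 h2).2.2 lam v).trans ?_, ?_⟩
  · exact mul_le_mul_of_nonneg_right (hCle q h1 h2)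
      (Finset.prod_nonneg fun i _ => norm_nonneg _)
  · exact mul_le_mul_of_nonneg_right (hCle q h1 h2)
      (Finset.prod_nonneg fun i _ => apply_nonneg _ _)
  · obtain ⟨δ, hδ, C', hC'⟩ := hTay s hts.le R (by omega) le_rfl
    refine ⟨δ, hδ, max C' 0, le_max_right _ _, fun z f hz hf => ?_⟩
    obtain ⟨w, hw, hn⟩ := hC' z (mem_ball_zero_iff.2 hz)
    have e : (-Complex.I) • f - ∑ q ∈ Finset.Icc 2 R, A q (fun _ => z) = (-Complex.I) • w := by
      refine Sob.ext fun j => ?_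
      rw [Sob.seq_sub, Sob.seq_smul, Sob.seq_smul, Sob.seq_sum, hw, hf, Pi.sub_apply, mul_sub,
        polyField, Finset.mul_sum]
      congr 1
      refine Finset.sum_congr rfl fun q hq => ?_
      rw [Finset.mem_Icc] at hq
      rw [(hA q hq.1 hq.2).1, homPart]
    rw [e, norm_smul, norm_neg, Complex.norm_I, one_mul]
    exact hn.trans (by gcongr; exact le_max_left _ _)

end TaylorFields

/-! ### The growth of the modified energy -/

section Growth

open Filter Topology

variable {d : ℕ} {N : Set (Fin d → ℤ)} {s t : ℝ}

/-- The derivative of `Q` along a curve `τ ↦ Φ_τ u(τ)`, for a form `Q` whose derivative along the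
linear flow is `-G`. -/
theorem hasDerivWithinAt_comp_flow {ω : Mode N → ℝ} {Q G : Sob N s → ℂ}
    (hQ : ∀ z, HasStrictFDerivAt Q (fderiv ℂ Q z) z) (hG : Continuous G)
    (hflow : ∀ h z, Q (Sob.flow s ω h z) = Q z - ∫ τ in (0 : ℝ)..h, G (Sob.flow s ω τ z))
    {u : ℝ → Sob N s} {u' : Sob N s} {S : Set ℝ} {τ₀ : ℝ} (hu : HasDerivWithinAt u u' S τ₀) :
    HasDerivWithinAt (fun τ => Q (Sob.flow s ω τ (u τ)))
      (fderiv ℂ Q (Sob.flow s ω τ₀ (u τ₀)) (Sob.flow s ω τ₀ u')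
        - G (Sob.flow s ω τ₀ (u τ₀))) S τ₀ := by
  set z₀ := Sob.flow s ω τ₀ (u τ₀) with hz₀
  set L := fderiv ℂ Q z₀ with hL
  have hcu := (Sob.continuous_flow_uncurry (s := s) ω)
  have hft : ∀ v : Sob N s, Tendsto (fun q : ℝ × Sob N s => Sob.flow s ω q.1 q.2)
      (𝓝 (τ₀, v)) (𝓝 (Sob.flow s ω τ₀ v)) := fun v => hcu.tendsto _
  have hid : Tendsto (fun τ : ℝ => τ) (𝓝[S] τ₀) (𝓝 τ₀) :=
    tendsto_id.mono_right nhdsWithin_le_nhds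
  have hut : Tendsto u (𝓝[S] τ₀) (𝓝 (u τ₀)) := hu.continuousWithinAt
  have ha : Tendsto (fun τ => Sob.flow s ω τ (u τ)) (𝓝[S] τ₀) (𝓝 z₀) := by
    have h := (hft (u τ₀)).comp (hid.prodMk_nhds hut)
    exact h
  have hb : Tendsto (fun τ => Sob.flow s ω τ (u τ₀)) (𝓝[S] τ₀) (𝓝 z₀) :=
    ((Sob.continuous_flow ω (u τ₀)).tendsto τ₀).mono_left nhdsWithin_le_nhds
  have hlin : HasDerivWithinAt (fun τ => Sob.flow s ω τ (u τ - u τ₀))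
      (Sob.flow s ω τ₀ u') S τ₀ := by
    rw [hasDerivWithinAt_iff_tendsto_slope] at hu ⊢
    have h1 : Tendsto (fun τ => Sob.flow s ω τ (slope u τ₀ τ)) (𝓝[S \ {τ₀}] τ₀)
        (𝓝 (Sob.flow s ω τ₀ u')) := by
      have hid' : Tendsto (fun τ : ℝ => τ) (𝓝[S \ {τ₀}] τ₀) (𝓝 τ₀) :=
        tendsto_id.mono_right nhdsWithin_le_nhds
      have h := (hft u').comp (hid'.prodMk_nhds hu)
      exact h
    refine h1.congr fun τ => ?_
    rw [slope_def_module, slope_def_module, sub_self, map_zero, sub_zero, ← Complex.coe_smul,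
      ← Complex.coe_smul, map_smul]
  -- The curve `τ ↦ Φ_τ u(τ₀)` need not be differentiable in `𝒫_s`. The increment of `Q` from it to
  -- `Φ_τ u(τ)` is handled by strict differentiability, and `Q` along it by `hflow`.
  have h1 : HasDerivWithinAt (fun τ => Q (Sob.flow s ω τ (u τ)) - Q (Sob.flow s ω τ (u τ₀)))
      (L (Sob.flow s ω τ₀ u')) S τ₀ := by
    have hLd : HasDerivWithinAt (fun τ => L (Sob.flow s ω τ (u τ - u τ₀)))
        (L (Sob.flow s ω τ₀ u')) S τ₀ :=
      (L.restrictScalars ℝ).hasFDerivAt.comp_hasDerivWithinAt τ₀ hlin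
    have hO : (fun τ => Sob.flow s ω τ (u τ - u τ₀)) =O[𝓝[S] τ₀] fun τ => τ - τ₀ := by
      simpa using hlin.hasFDerivWithinAt.isBigO_sub
    have ho := ((hQ z₀).isLittleO.comp_tendsto (ha.prodMk_nhds hb))
    have ho2 : (fun τ => Q (Sob.flow s ω τ (u τ)) - Q (Sob.flow s ω τ (u τ₀))
        - L (Sob.flow s ω τ (u τ - u τ₀))) =o[𝓝[S] τ₀] fun τ => τ - τ₀ := by
      refine Asymptotics.IsLittleO.trans_isBigO ?_ hO
      refine (ho.congr (fun τ => ?_) fun τ => ?_)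
      · simp only [Function.comp, map_sub]
        rfl
      · simp only [Function.comp, map_sub]
    rw [hasDerivWithinAt_iff_isLittleO] at hLd ⊢
    refine (ho2.add hLd).congr_left fun τ => ?_
    simp only [sub_self, map_zero]
    ring
  have h2 : HasDerivWithinAt (fun τ => Q (Sob.flow s ω τ (u τ₀))) (-G z₀) S τ₀ := by
    have hc : Continuous fun τ => G (Sob.flow s ω τ z₀) :=
      hG.comp (Sob.continuous_flow ω z₀)
    have h3 : HasDerivAt (fun h => ∫ τ in (0 : ℝ)..h, G (Sob.flow s ω τ z₀)) (G z₀) (τ₀ - τ₀) := by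
      have := hc.integral_hasStrictDerivAt 0 (τ₀ - τ₀)
      simp only [sub_self] at this ⊢
      simpa only [Sob.flow_zero] using this.hasDerivAt
    have h4 := (h3.comp_sub_const τ₀ τ₀).const_sub (Q z₀)
    refine (h4.hasDerivWithinAt (s := S)).congr_of_eventuallyEq ?_ ?_
    · refine Eventually.of_forall fun τ => ?_
      have : Sob.flow s ω τ (u τ₀) = Sob.flow s ω (τ - τ₀) z₀ := by
        rw [hz₀, ← Sob.flow_add, sub_add_cancel]
      show Q (Sob.flow s ω τ (u τ₀)) = _
      rw [this, hflow]
    · show Q (Sob.flow s ω τ₀ (u τ₀)) = _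
      simp [hz₀]
  have h3 := h1.add h2
  rw [← sub_eq_add_neg] at h3
  exact h3.congr (fun τ _ => (sub_add_cancel _ _).symm) (sub_add_cancel _ _).symm

theorem norm_sum_le_card_mul {ι : Type*} (S : Finset ι) (f : ι → ℂ) {B n : ℝ} (hB : 0 ≤ B)
    (hn : (S.card : ℝ) ≤ n) (h : ∀ i ∈ S, ‖f i‖ ≤ B) : ‖∑ i ∈ S, f i‖ ≤ n * B := by
  refine (norm_sum_le_of_le S h).trans ?_
  rw [Finset.sum_const, nsmul_eq_mul]
  gcongr

/-- Grouping the terms of a double sum by the total degree. -/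
theorem sum_sum_eq_lieSum {R : ℕ} (f : ℕ → ℕ → ℂ) :
    ∑ m ∈ Finset.Icc 2 R, ∑ q ∈ Finset.Icc 2 R, f m q
      = ∑ n ∈ Finset.Icc 3 R, ∑ k ∈ Finset.Ico 2 n, f k (n + 1 - k)
        + ∑ x ∈ (Finset.Icc 2 R ×ˢ Finset.Icc 2 R).filter (fun x => ¬ x.1 + x.2 ≤ R + 1),
          f x.1 x.2 := by
  rw [← Finset.sum_product', ← Finset.sum_filter_add_sum_filter_not _ (fun x => x.1 + x.2 ≤ R + 1)]
  congr 1
  rw [Finset.sum_sigma']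
  refine Finset.sum_bij' (fun x _ => (⟨x.1 + x.2 - 1, x.1⟩ : (_ : ℕ) × ℕ))
    (fun y _ => (y.2, y.1 + 1 - y.2)) ?_ ?_ ?_ ?_ ?_
  · intro x hx
    simp only [Finset.mem_filter, Finset.mem_product, Finset.mem_Icc, Finset.mem_sigma,
      Finset.mem_Ico] at hx ⊢
    omega
  · intro y hy
    simp only [Finset.mem_filter, Finset.mem_product, Finset.mem_Icc, Finset.mem_sigma,
      Finset.mem_Ico] at hy ⊢
    omega
  · rintro ⟨a, b⟩ hx
    simp only [Finset.mem_filter, Finset.mem_product, Finset.mem_Icc] at hx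
    simp only [Prod.mk.injEq, true_and]
    omega
  · rintro ⟨a, b⟩ hy
    simp only [Finset.mem_sigma, Finset.mem_Icc, Finset.mem_Ico] at hy
    simp only [Sigma.mk.injEq, heq_eq_eq, and_true]
    omega
  · rintro ⟨a, b⟩ hx
    simp only [Finset.mem_filter, Finset.mem_product, Finset.mem_Icc] at hx
    congr 1
    simp only
    omega

/-- The time derivative of the modified energy is small. -/
theorem norm_energy_deriv_le {Q G : ℕ → Sob N s → ℂ}
    {A : ∀ q, MultilinearMap ℂ (fun _ : Fin q => Sob N s) (Sob N s)} {p : Seminorm ℂ (Sob N s)}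
    {lam b D CA C : ℝ} {R : ℕ} (hl : 0 ≤ lam) (hb : 0 ≤ b) (hD : 1 ≤ D) (hCA : 0 ≤ CA)
    (hC : 0 ≤ C)
    (hQ : ∀ m, 2 ≤ m → m ≤ R → IsForm p lam m (b * D ^ m) (Q m))
    (hA : ∀ q, 2 ≤ q → q ≤ R → ∀ v, ‖A q v‖ ≤ CA * ∏ i, ‖v i‖)
    {z X : Sob N s} (hz : ‖z‖ ≤ 1)
    (hG : ∀ m, 3 ≤ m → m ≤ R → ‖lieSum Q A m z - G m z‖ ≤ b * D ^ m * lam * ‖z‖ ^ m)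
    (hX : ‖X - ∑ q ∈ Finset.Icc 2 R, A q fun _ => z‖ ≤ C * ‖z‖ ^ (R + 1)) :
    ‖∑ m ∈ Finset.Icc 2 R, fderiv ℂ (Q m) z X - ∑ m ∈ Finset.Icc 3 R, G m z‖
      ≤ b * (R ^ 3 * CA + R ^ 2 * C + R) * D ^ R * (‖z‖ ^ (R + 1) + lam * ‖z‖ ^ 3) := by
  have hz0 := norm_nonneg z
  have hD0 : 0 ≤ D := by linarith
  have hDm : ∀ m, m ≤ R → D ^ m ≤ D ^ R := fun m hm => pow_le_pow_right₀ hD hm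
  have hcard : ∀ k, 1 ≤ k → ((Finset.Icc k R).card : ℝ) ≤ R := fun k hk => by
    rw [Nat.card_Icc]
    exact_mod_cast (by omega)
  set rem := X - ∑ q ∈ Finset.Icc 2 R, A q fun _ => z with hrem
  have hXe : X = ∑ q ∈ Finset.Icc 2 R, (A q fun _ => z) + rem := by rw [hrem]; abel
  have e : ∑ m ∈ Finset.Icc 2 R, fderiv ℂ (Q m) z X - ∑ m ∈ Finset.Icc 3 R, G m z
      = ∑ m ∈ Finset.Icc 3 R, (lieSum Q A m z - G m z)
        + ∑ x ∈ (Finset.Icc 2 R ×ˢ Finset.Icc 2 R).filter (fun x => ¬ x.1 + x.2 ≤ R + 1),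
          fderiv ℂ (Q x.1) z (A x.2 fun _ => z)
        + ∑ m ∈ Finset.Icc 2 R, fderiv ℂ (Q m) z rem := by
    have h1 := sum_sum_eq_lieSum (R := R) fun m q => fderiv ℂ (Q m) z (A q fun _ => z)
    rw [Finset.sum_sub_distrib]
    conv_lhs => rw [hXe]
    simp only [map_add, map_sum, Finset.sum_add_distrib]
    rw [h1]
    simp only [lieSum]
    ring
  have hQd : ∀ m, 2 ≤ m → m ≤ R → ∀ w, ‖fderiv ℂ (Q m) z w‖
      ≤ R * (b * D ^ R) * ‖z‖ ^ (m - 1) * ‖w‖ := fun m h2 hm w => by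
    refine ((hQ m h2 hm).norm_fderiv_le z w).trans ?_
    have := hDm m hm
    gcongr
  have hA1 : ∀ q, 2 ≤ q → q ≤ R → ‖A q fun _ => z‖ ≤ CA * ‖z‖ ^ q := fun q h2 hq => by
    have h := hA q h2 hq fun _ => z
    rwa [Finset.prod_const, Finset.card_univ, Fintype.card_fin] at h
  have t1 : ‖∑ m ∈ Finset.Icc 3 R, (lieSum Q A m z - G m z)‖
      ≤ R * (b * D ^ R * lam * ‖z‖ ^ 3) := by
    refine norm_sum_le_card_mul _ _ (by positivity) (hcard 3 (by omega)) fun m hm => ?_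
    rw [Finset.mem_Icc] at hm
    refine (hG m hm.1 hm.2).trans ?_
    have h1 := hDm m hm.2
    have h2 : ‖z‖ ^ m ≤ ‖z‖ ^ 3 := pow_le_pow_of_le_one hz0 hz hm.1
    gcongr
  have t2 : ‖∑ x ∈ (Finset.Icc 2 R ×ˢ Finset.Icc 2 R).filter (fun x => ¬ x.1 + x.2 ≤ R + 1),
      fderiv ℂ (Q x.1) z (A x.2 fun _ => z)‖
      ≤ R ^ 2 * (R * (b * D ^ R) * CA * ‖z‖ ^ (R + 1)) := by
    refine norm_sum_le_card_mul _ _ (by positivity) ?_ fun x hx => ?_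
    · calc (_ : ℝ) ≤ ((Finset.Icc 2 R ×ˢ Finset.Icc 2 R).card : ℝ) := by
            exact_mod_cast Finset.card_filter_le _ _
        _ ≤ R * R := by
            rw [Finset.card_product, Nat.cast_mul]
            exact mul_le_mul (hcard 2 (by omega)) (hcard 2 (by omega)) (Nat.cast_nonneg _)
              (Nat.cast_nonneg _)
        _ = _ := by ring
    · simp only [Finset.mem_filter, Finset.mem_product, Finset.mem_Icc] at hx
      obtain ⟨⟨⟨h2, hm⟩, h2', hq⟩, hlt⟩ := hx
      calc _ ≤ R * (b * D ^ R) * ‖z‖ ^ (x.1 - 1) * (CA * ‖z‖ ^ x.2) :=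
            (hQd _ h2 hm _).trans (by gcongr; exact hA1 _ h2' hq)
        _ = R * (b * D ^ R) * CA * ‖z‖ ^ (x.1 - 1 + x.2) := by rw [pow_add]; ring
        _ ≤ _ := by
            have : ‖z‖ ^ (x.1 - 1 + x.2) ≤ ‖z‖ ^ (R + 1) :=
              pow_le_pow_of_le_one hz0 hz (by omega)
            gcongr
  have t3 : ‖∑ m ∈ Finset.Icc 2 R, fderiv ℂ (Q m) z rem‖
      ≤ R * (R * (b * D ^ R) * C * ‖z‖ ^ (R + 1)) := by
    refine norm_sum_le_card_mul _ _ (by positivity) (hcard 2 (by omega)) fun m hm => ?_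
    rw [Finset.mem_Icc] at hm
    calc _ ≤ R * (b * D ^ R) * 1 * (C * ‖z‖ ^ (R + 1)) := by
          refine (hQd _ hm.1 hm.2 _).trans ?_
          gcongr
          exact pow_le_one₀ hz0 hz
      _ = _ := by ring
  rw [e]
  refine (norm_add₃_le.trans (add_le_add (add_le_add t1 t2) t3)).trans ?_
  have h1 : 0 ≤ ‖z‖ ^ (R + 1) := by positivity
  have h2 : 0 ≤ lam * ‖z‖ ^ 3 := by positivity
  have h3 : 0 ≤ b * D ^ R := by positivity
  have h4 : 0 ≤ b * D ^ R * ((R ^ 3 * CA + R ^ 2 * C) * (lam * ‖z‖ ^ 3) + R * ‖z‖ ^ (R + 1)) := by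
    positivity
  linarith

end Growth

/-! ### Long-time stability -/

section Stability

variable {d : ℕ} {N : Set (Fin d → ℤ)} {s t : ℝ}

/-- The choice of the frequency cutoff `K` and of the lower bound `c` for the divisors, in terms of
the size `ε` of the solution: the loss `c^{-R}` amounts to `ε^{-1/2}`, and the truncation error
`K^{t-s}` is at most `ε^r`. -/
theorem exists_cutoff {γ α ε δ : ℝ} {R r : ℕ} (hγ : 0 < γ) (hα : 0 < α) (hR : 1 ≤ R) (hε : 0 < ε)
    (hε1 : ε ≤ 1) (hδ : 2 * R * α * r ≤ δ) :
    ∃ K : ℝ, 1 ≤ K ∧ ∃ c : ℝ, 0 < c ∧ c ≤ 1 ∧ c ≤ γ / K ^ α ∧ K ^ (-δ) ≤ ε ^ r ∧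
      (1 / c) ^ R * ε ≤ (1 / min 1 γ) ^ R * Real.sqrt ε := by
  have hR0 : (0 : ℝ) < R := by exact_mod_cast hR
  have hc0 : 0 < min 1 γ := lt_min one_pos hγ
  refine ⟨ε ^ (-(1 / (2 * R * α))), Real.one_le_rpow_of_pos_of_le_one_of_nonpos hε hε1
    (neg_nonpos.2 (by positivity)), min 1 γ * ε ^ (1 / (2 * R) : ℝ), by positivity, ?_, ?_, ?_, ?_⟩
  · exact mul_le_one₀ (min_le_left _ _) (by positivity) (Real.rpow_le_one hε.le hε1 (by positivity))
  · rw [← Real.rpow_mul hε.le]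
    have e : -(1 / (2 * R * α)) * α = -(1 / (2 * R)) := by field_simp
    rw [e, Real.rpow_neg hε.le, div_inv_eq_mul]
    gcongr
    exact min_le_right _ _
  · rw [← Real.rpow_mul hε.le, ← Real.rpow_natCast]
    apply Real.rpow_le_rpow_of_exponent_ge hε hε1
    rw [neg_mul_neg, one_div, inv_mul_eq_div, le_div_iff₀ (by positivity)]
    linarith
  · have e : (ε ^ (1 / (2 * R) : ℝ)) ^ R = Real.sqrt ε := by
      rw [← Real.rpow_natCast, ← Real.rpow_mul hε.le, Real.sqrt_eq_rpow]
      congr 1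
      field_simp
    rw [div_pow, div_pow, mul_pow, e, one_pow, div_mul_eq_mul_div, one_mul, one_div_mul_eq_div,
      div_le_div_iff₀ (by positivity) (by positivity), mul_left_comm,
      Real.mul_self_sqrt hε.le, mul_comm]

set_option maxHeartbeats 1000000 in
/-- As long as a real solution, written as `z(τ) = Φ_τ u(τ)` along the linear flow `Φ`, stays in the
ball of radius `2ε`, where `ε` is the norm of its initial datum, and the time is at most `ε^{-r}`,
it stays in the ball of radius `3ε/2`. -/
theorem exists_growth_bound {ω : Mode N → ℝ} (hodd : ∀ j, ω (conjMode j) = -ω j)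
    (hω : NonResonant ω) {F : (Mode N → ℂ) → (Mode N → ℂ)} (hF : ReversibleClassT F) {r : ℕ}
    (hr : 3 ≤ r) :
    ∃ s₀ : ℝ, 0 < s₀ ∧ ∀ s : ℝ, s₀ < s → RegularRevAt F s ∧ ∃ ε₁ : ℝ, 0 < ε₁ ∧
      ∀ (u : ℝ → Sob N s) (g : ℝ → Sob N s) (T : ℝ), 0 < ‖u 0‖ → ‖u 0‖ < ε₁ →
        |T| * ‖u 0‖ ^ r ≤ 1 →
        (∀ τ ∈ Set.uIcc 0 T, ‖u τ‖ ≤ 2 * ‖u 0‖ ∧ IsReal (Sob.flow s ω τ (u τ)).seq ∧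
          (g τ).seq = F (Sob.flow s ω τ (u τ)).seq ∧
          HasDerivWithinAt u (Sob.flow s ω (-τ) ((-Complex.I) • g τ)) (Set.uIcc 0 T) τ) →
        ‖u T‖ ≤ 3 / 2 * ‖u 0‖ := by
  set R := r + 2 with hRdef
  have hR2 : 2 ≤ R := by omega
  obtain ⟨t, ht0, htay⟩ := exists_taylor_fields hF hR2
  obtain ⟨γ, hγ, α, hα, hres⟩ := hω R (by omega)
  obtain ⟨κ, hκ, hκ0, hκ1, hint, hband⟩ := exists_bandlimited_kernel
  refine ⟨t + 2 * R * α * r, by positivity, fun s hs => ?_⟩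
  have hts : t < s := lt_of_le_of_lt (le_add_of_nonneg_right (by positivity)) hs
  obtain ⟨hreg, A, CA, hCA, hArho, hA1, hA2, δ, hδ, C, hC, hrem⟩ := htay s hts
  refine ⟨hreg, ?_⟩
  obtain ⟨b, hb, henergy⟩ := exists_modified_energy hκ hκ0 hκ1 hint hband hodd hts.le A hArho hCA
    R hR2 hA1 hA2
  -- Up to the factor `E = c^{-R}`, `B` bounds the time derivative of the energy and `W` the
  -- variation of `‖u‖²`; the choice of `c` gives `W E ε ≤ V √ε`.
  set B := b * (R ^ 3 * CA + R ^ 2 * C + R) with hB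
  have hB0 : 0 ≤ B := by positivity
  set W := 9 * (R * b) + B * (2 ^ (R + 1) + 8) with hW
  have hW0 : 0 ≤ W := by positivity
  set V := W * (1 / min 1 γ) ^ R with hV
  have hV0 : 0 ≤ V := mul_nonneg hW0 (pow_nonneg (by have := lt_min one_pos hγ; positivity) _)
  refine ⟨min (min (1 / 2) (δ / 2)) ((1 / (V + 1)) ^ 2), by positivity,
    fun u g T hε hε1 hT hu => ?_⟩
  set ε := ‖u 0‖ with hεdef
  have hε2 : ε < 1 / 2 := hε1.trans_le ((min_le_left _ _).trans (min_le_left _ _))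
  have hε3 : ε < δ / 2 := hε1.trans_le ((min_le_left _ _).trans (min_le_right _ _))
  have hε4 : V * Real.sqrt ε ≤ 1 := by
    have h1 : Real.sqrt ε ≤ 1 / (V + 1) :=
      Real.sqrt_le_iff.2 ⟨by positivity, (hε1.trans_le (min_le_right _ _)).le⟩
    calc V * Real.sqrt ε ≤ V * (1 / (V + 1)) := by gcongr
      _ ≤ 1 := by rw [mul_one_div, div_le_one (by positivity)]; linarith
  obtain ⟨K, hK, c, hc, hc1, hcK, hKl, hcR⟩ := exists_cutoff (R := R) (r := r) (δ := s - t) hγ hα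
    (by omega) hε (by linarith) (by linarith)
  rw [neg_sub] at hKl
  have hK0 : 0 < K := by linarith
  set lam : ℝ≥0 := ⟨K ^ (t - s), (Real.rpow_pos_of_pos hK0 _).le⟩ with hlam
  have hlamR : (lam : ℝ) = K ^ (t - s) := rfl
  have hlam0 : 0 < lam := Real.rpow_pos_of_pos hK0 _
  have hlam1 : lam ≤ 1 := Real.rpow_le_one_of_one_le_of_nonpos hK (by linarith)
  -- `ω` is odd, so that `Ω(v) = ∑ ω (v i)`; with at most two high modes, `μ(v) ≤ K`
  obtain ⟨Q, G, hQ2, hQ, hG⟩ := henergy lam hlam0 hlam1 K hK hlamR.ge c hc hc1 (by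
    intro m h1 hm v hv hcard
    have h3 : bigOmega ω v = ∑ i, ω (v i) := by
      refine Finset.sum_congr rfl fun i _ => ?_
      rcases Int.units_eq_one_or (v i).2 with h | h
      · have e : v i = ((v i).1, 1) := Prod.ext rfl h
        rw [h, ← e]
        simp
      · have e : v i = conjMode ((v i).1, 1) := Prod.ext rfl h
        rw [h]
        conv_rhs => rw [e, hodd]
        simp
    rw [← h3]
    refine hcK.trans (le_trans ?_ (hres m h1 hm v hv))
    have h4 := one_le_mu v
    have h5 := mu_le_of_card_le v hK hcard
    gcongr)
  set E := (1 / c) ^ R with hE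
  have hD1 : 1 ≤ 1 / c := by rw [le_div_iff₀ hc]; linarith
  have hE0 : 0 ≤ E := by positivity
  let z : ℝ → Sob N s := fun τ => Sob.flow s ω τ (u τ)
  have hzn : ∀ τ, ‖z τ‖ = ‖u τ‖ := fun τ => Sob.norm_flow ω τ _
  have hz0 : z 0 = u 0 := Sob.flow_zero ω _
  -- the modified energy along the solution, and its derivative
  let e : ℝ → ℂ := fun τ => ∑ m ∈ Finset.Icc 2 R, Q m (z τ)
  let e' : ℝ → ℂ := fun τ => ∑ m ∈ Finset.Icc 2 R, fderiv ℂ (Q m) (z τ) ((-Complex.I) • g τ)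
    - ∑ m ∈ Finset.Icc 3 R, G m (z τ)
  have hIcc : Finset.Icc 2 R = insert 2 (Finset.Icc 3 R) := by
    ext k
    simp only [Finset.mem_Icc, Finset.mem_insert]
    omega
  have h2n : (2 : ℕ) ∉ Finset.Icc 3 R := by simp
  have hderiv : ∀ τ ∈ Set.uIcc 0 T, HasDerivWithinAt e (e' τ) (Set.uIcc 0 T) τ := by
    intro τ hτ
    obtain ⟨-, -, -, hd⟩ := hu τ hτ
    have h1 : ∀ m, 2 ≤ m → m ≤ R → ∀ G₁ : Sob N s → ℂ, Continuous G₁ →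
        (∀ h z, Q m (Sob.flow s ω h z) = Q m z - ∫ τ in (0 : ℝ)..h, G₁ (Sob.flow s ω τ z)) →
        HasDerivWithinAt (fun τ => Q m (z τ)) (fderiv ℂ (Q m) (z τ) ((-Complex.I) • g τ)
          - G₁ (z τ)) (Set.uIcc 0 T) τ := by
      intro m hm2 hm G₁ hG₁ hfl
      have := hasDerivWithinAt_comp_flow (hQ m hm2 hm).1.hasStrictFDerivAt hG₁ hfl hd
      rwa [Sob.flow_flow_neg] at this
    have h3 := h1 2 le_rfl hR2 (fun _ => 0) continuous_const (fun h z => by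
      rw [hQ2, normForm_flow hodd]
      simp)
    have h4 := HasDerivWithinAt.fun_sum fun m (hm : m ∈ Finset.Icc 3 R) =>
      h1 m (by have := (Finset.mem_Icc.1 hm).1; omega) (Finset.mem_Icc.1 hm).2 (G m)
        (hG m (Finset.mem_Icc.1 hm).1 (Finset.mem_Icc.1 hm).2).1
        (hG m (Finset.mem_Icc.1 hm).1 (Finset.mem_Icc.1 hm).2).2.2
    have h5 := h3.add h4
    have e1 : e = (fun τ => Q 2 (z τ)) + fun τ => ∑ m ∈ Finset.Icc 3 R, Q m (z τ) := by
      funext τ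
      simp only [e, hIcc, Finset.sum_insert h2n, Pi.add_apply]
    have e2 : e' τ = fderiv ℂ (Q 2) (z τ) ((-Complex.I) • g τ) - 0
        + ∑ m ∈ Finset.Icc 3 R, (fderiv ℂ (Q m) (z τ) ((-Complex.I) • g τ) - G m (z τ)) := by
      simp only [e', hIcc, Finset.sum_insert h2n, Finset.sum_sub_distrib]
      ring
    rw [e1, e2]
    exact h5
  have hbound : ∀ τ ∈ Set.uIcc 0 T, ‖e' τ‖ ≤ B * E * ((2 * ε) ^ (R + 1) + ε ^ r * (2 * ε) ^ 3) := by
    intro τ hτ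
    obtain ⟨hn, -, hg, -⟩ := hu τ hτ
    have hn' : ‖z τ‖ ≤ 2 * ε := (hzn τ).trans_le hn
    refine (norm_energy_deriv_le (lam := lam) (G := G) (A := A) lam.2 hb hD1 hCA hC
      (fun m h2 hm => (hQ m h2 hm).1) hA1 (z := z τ) (by linarith)
      (fun m h2 hm => (hG m h2 hm).2.1 _) (hrem (z τ) (g τ) (by linarith) hg)).trans ?_
    rw [hlamR]
    gcongr
  have hdiff : ‖e T - e 0‖ ≤ B * E * ((2 * ε) ^ (R + 1) + ε ^ r * (2 * ε) ^ 3) * |T| := by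
    have := (convex_uIcc 0 T).norm_image_sub_le_of_norm_hasDerivWithin_le hderiv hbound
      Set.left_mem_uIcc Set.right_mem_uIcc
    rwa [sub_zero, Real.norm_eq_abs] at this
  have hcmp : ∀ τ ∈ Set.uIcc 0 T, ‖e τ - ((‖u τ‖ ^ 2 : ℝ) : ℂ)‖ ≤ R * (b * E * ‖u τ‖ ^ 3) := by
    intro τ hτ
    obtain ⟨hn, hreal, -, -⟩ := hu τ hτ
    have hn1 : ‖u τ‖ ≤ 1 := by linarith
    have e1 : e τ - ((‖u τ‖ ^ 2 : ℝ) : ℂ) = ∑ m ∈ Finset.Icc 3 R, Q m (z τ) := by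
      simp only [e, hIcc, Finset.sum_insert h2n]
      rw [hQ2, normForm_of_isReal hreal, Sob.norm_flow]
      ring
    rw [e1]
    refine norm_sum_le_card_mul _ _ (by positivity) ?_ fun m hm => ?_
    · rw [Nat.card_Icc]
      exact_mod_cast (by omega)
    · rw [Finset.mem_Icc] at hm
      refine ((hQ m (by omega) hm.2).1.norm_le _).trans ?_
      rw [hzn]
      have h1 : (1 / c) ^ m ≤ E := pow_le_pow_right₀ hD1 hm.2
      have h2 : ‖u τ‖ ^ m ≤ ‖u τ‖ ^ 3 := pow_le_pow_of_le_one (norm_nonneg _) hn1 hm.1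
      gcongr
  have hfin : ‖u T‖ ^ 2 ≤ ε ^ 2 + W * E * ε ^ 3 := by
    have h1 := hcmp T Set.right_mem_uIcc
    have h2 := hcmp 0 Set.left_mem_uIcc
    have hn := (hu T Set.right_mem_uIcc).1
    have h3 : ‖((‖u T‖ ^ 2 : ℝ) : ℂ) - ((‖u 0‖ ^ 2 : ℝ) : ℂ)‖ ≤ R * (b * E * ‖u T‖ ^ 3)
        + B * E * ((2 * ε) ^ (R + 1) + ε ^ r * (2 * ε) ^ 3) * |T| + R * (b * E * ε ^ 3) := by
      have : ((‖u T‖ ^ 2 : ℝ) : ℂ) - ((‖u 0‖ ^ 2 : ℝ) : ℂ) = -(e T - ((‖u T‖ ^ 2 : ℝ) : ℂ))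
        + (e T - e 0) + (e 0 - ((‖u 0‖ ^ 2 : ℝ) : ℂ)) := by ring
      rw [this]
      refine norm_add₃_le.trans (add_le_add (add_le_add ?_ hdiff) h2)
      rwa [norm_neg]
    rw [← Complex.ofReal_sub, Complex.norm_real] at h3
    have h4 := (le_abs_self _).trans h3
    have h5 : R * (b * E * ‖u T‖ ^ 3) ≤ R * (b * E * (2 * ε) ^ 3) := by gcongr
    have h6 : B * E * ((2 * ε) ^ (R + 1) + ε ^ r * (2 * ε) ^ 3) * |T|
        = B * E * (2 ^ (R + 1) + 8) * ε ^ 3 * (|T| * ε ^ r) := by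
      rw [hRdef]
      ring
    have h7 : B * E * (2 ^ (R + 1) + 8) * ε ^ 3 * (|T| * ε ^ r)
        ≤ B * E * (2 ^ (R + 1) + 8) * ε ^ 3 * 1 := by gcongr
    rw [h6] at h4
    rw [hW]
    linarith
  -- with `‖u T‖² ≤ 2ε²` the claim follows, as `√2 ≤ 3/2`
  have hfin2 : W * E * ε ^ 3 ≤ ε ^ 2 := by
    calc W * E * ε ^ 3 = W * (E * ε) * ε ^ 2 := by ring
      _ ≤ W * ((1 / min 1 γ) ^ R * Real.sqrt ε) * ε ^ 2 := by gcongr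
      _ = V * Real.sqrt ε * ε ^ 2 := by rw [hV]; ring
      _ ≤ 1 * ε ^ 2 := by gcongr
      _ = _ := one_mul _
  apply abs_le_of_sq_le_sq' _ (by positivity) |>.2
  nlinarith

end Stability

/-! ### Curves in normed spaces -/

section Curves

open Filter Topology Set

variable {d : ℕ} {N : Set (Fin d → ℤ)} {s t : ℝ}

theorem norm_le_exp_of_norm_deriv_le_right {E : Type*} [NormedAddCommGroup E] [NormedSpace ℝ E]
    {f f' : ℝ → E} {K T : ℝ} (hT : 0 ≤ T)
    (hf : ∀ τ ∈ Icc 0 T, HasDerivWithinAt f (f' τ) (Icc 0 T) τ)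
    (hb : ∀ τ ∈ Icc 0 T, ‖f' τ‖ ≤ K * ‖f τ‖) : ‖f T‖ ≤ ‖f 0‖ * Real.exp (K * T) := by
  have h := norm_le_gronwallBound_of_norm_deriv_right_le (f := f) (f' := f') (δ := ‖f 0‖) (K := K)
    (ε := 0) (a := 0) (b := T) (fun τ hτ => (hf τ hτ).continuousWithinAt)
    (fun τ hτ => (hf τ (Ico_subset_Icc_self hτ)).mono_of_mem_nhdsWithin
      (Icc_mem_nhdsGE_of_mem hτ)) le_rfl
    (fun τ hτ => by simpa using hb τ (Ico_subset_Icc_self hτ)) T (right_mem_Icc.2 hT)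
  rwa [gronwallBound_ε0, sub_zero] at h

/-- Grönwall's inequality, forward and backward in time. -/
theorem norm_le_exp_of_norm_deriv_le {E : Type*} [NormedAddCommGroup E] [NormedSpace ℝ E]
    {f f' : ℝ → E} {K T : ℝ}
    (hf : ∀ τ ∈ uIcc 0 T, HasDerivWithinAt f (f' τ) (uIcc 0 T) τ)
    (hb : ∀ τ ∈ uIcc 0 T, ‖f' τ‖ ≤ K * ‖f τ‖) : ‖f T‖ ≤ ‖f 0‖ * Real.exp (K * |T|) := by
  rcases le_total 0 T with hT | hT
  · rw [uIcc_of_le hT] at hf hb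
    rw [abs_of_nonneg hT]
    exact norm_le_exp_of_norm_deriv_le_right hT hf hb
  · rw [uIcc_of_ge hT] at hf hb
    have hmem : ∀ τ ∈ Icc 0 (-T), -τ ∈ Icc T 0 := fun τ hτ =>
      ⟨by linarith [hτ.2], by linarith [hτ.1]⟩
    have h := norm_le_exp_of_norm_deriv_le_right (f := fun τ => f (-τ)) (f' := fun τ => -f' (-τ))
      (K := K) (neg_nonneg.2 hT) (fun τ hτ => by
        have := (hf (-τ) (hmem τ hτ)).scomp τ ((hasDerivWithinAt_id τ (Icc 0 (-T))).neg) hmem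
        rw [neg_one_smul] at this
        exact this)
      (fun τ hτ => by simpa using hb (-τ) (hmem τ hτ))
    rw [abs_of_nonpos hT]
    simpa using h

theorem bootstrap_right {φ : ℝ → ℝ} {a b T : ℝ} (hab : a < b)
    (hc : ContinuousOn φ (Icc 0 T)) (h0 : φ 0 ≤ a)
    (h : ∀ t ∈ Icc 0 T, (∀ τ ∈ Icc 0 t, φ τ ≤ b) → φ t ≤ a) : ∀ t ∈ Icc 0 T, φ t ≤ a := by
  intro t ht
  apply h t ht
  by_contra! hcon
  obtain ⟨τ, hτ, hφ⟩ := hcon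
  have hsub : Icc 0 t ⊆ Icc 0 T := Icc_subset_Icc_right ht.2
  have hclosed : IsCompact (Icc 0 t ∩ φ ⁻¹' Ici b) :=
    isCompact_Icc.of_isClosed_subset ((hc.mono hsub).preimage_isClosed_of_isClosed isClosed_Icc
      isClosed_Ici) inter_subset_left
  obtain ⟨σ, ⟨hσ, hσb⟩, hmin⟩ := hclosed.exists_isMinOn ⟨τ, hτ, hφ.le⟩ continuousOn_id
  have hlt : ∀ x ∈ Icc 0 t, φ x < b ∨ σ ≤ x := fun x hx => by
    by_cases hx2 : b ≤ φ x
    · exact Or.inr (hmin ⟨hx, hx2⟩)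
    · exact Or.inl (not_le.1 hx2)
  have hσb' : φ σ ≤ b := by
    by_contra! hgt
    obtain ⟨x, hx, hxb⟩ := intermediate_value_Icc hσ.1
      (hc.mono ((Icc_subset_Icc_right hσ.2).trans hsub)) ⟨(h0.trans hab.le), hgt.le⟩
    have h1 : σ ≤ x := hmin ⟨⟨hx.1, hx.2.trans hσ.2⟩, hxb.ge⟩
    have h2 : x = σ := le_antisymm hx.2 h1
    rw [h2] at hxb
    linarith
  have h3 := h σ (hsub hσ) fun x hx => by
    rcases hlt x ⟨hx.1, hx.2.trans hσ.2⟩ with h4 | h4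
    · exact h4.le
    · rwa [le_antisymm hx.2 h4]
  have : b ≤ φ σ := hσb
  linarith

/-- A continuity argument: if the bound `φ ≤ b` on the way to `t` implies the better bound
`φ t ≤ a`, the better bound holds throughout. -/
theorem bootstrap {φ : ℝ → ℝ} {a b T : ℝ} (hab : a < b)
    (hc : ContinuousOn φ (Icc (-T) T)) (h0 : φ 0 ≤ a)
    (h : ∀ t ∈ Icc (-T) T, (∀ τ ∈ uIcc 0 t, φ τ ≤ b) → φ t ≤ a) : ∀ t ∈ Icc (-T) T, φ t ≤ a := by
  intro t ht
  rcases le_total 0 t with h1 | h1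
  · have hsub : Icc 0 T ⊆ Icc (-T) T := Icc_subset_Icc_left (by linarith [ht.2])
    refine bootstrap_right hab (hc.mono hsub) h0 (fun x hx hb => h x (hsub hx) ?_) t ⟨h1, ht.2⟩
    rwa [uIcc_of_le hx.1]
  · have hmem : ∀ x ∈ Icc 0 T, -x ∈ Icc (-T) T := fun x hx =>
      ⟨by linarith [hx.2], by linarith [hx.1, hx.2]⟩
    have h2 := bootstrap_right (φ := fun x => φ (-x)) hab
      (hc.comp continuousOn_neg hmem) (by simpa using h0) (T := T)
      (fun x hx hb => h (-x) (hmem x hx) fun τ hτ => by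
        rw [uIcc_of_ge (by linarith [hx.1])] at hτ
        have := hb (-τ) ⟨by linarith [hτ.2], by linarith [hτ.1]⟩
        simpa using this) (-t) ⟨by linarith, by linarith [ht.1]⟩
    simpa using h2

/-- A curve whose coordinates have derivatives that form a continuous curve of `𝒫_s` is
differentiable in `𝒫_s`. -/
theorem hasDerivWithinAt_of_coord {a b : ℝ} {y g : ℝ → Sob N s} (hg : ContinuousOn g (Icc a b))
    (hy : ∀ x ∈ Icc a b, ∀ j,
      HasDerivWithinAt (fun τ => (y τ).seq j) ((g x).seq j) (Icc a b) x) :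
    ∀ x ∈ Icc a b, HasDerivWithinAt y (g x) (Icc a b) x := by
  intro x hx
  have hab : a ≤ b := hx.1.trans hx.2
  let G : ℝ → Sob N s := IccExtend hab ((Icc a b).domRestrict g)
  have hG : Continuous G := (continuousOn_iff_continuous_domRestrict.1 hg).Icc_extend'
  have hGg : ∀ τ ∈ Icc a b, G τ = g τ := fun τ hτ => IccExtend_of_mem hab _ hτ
  let Y : ℝ → Sob N s := fun τ => y a + ∫ σ in a..τ, G σ
  have hY : ∀ τ, HasDerivAt Y (G τ) τ := fun τ =>
    (hG.integral_hasStrictDerivAt a τ).hasDerivAt.const_add (y a)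
  have heq : ∀ τ ∈ Icc a b, y τ = Y τ := by
    intro τ hτ
    refine Sob.ext fun j => ?_
    have h1 : ∀ ξ ∈ Icc a b,
        HasDerivWithinAt (fun τ => (y τ).seq j - (Y τ).seq j) 0 (Icc a b) ξ := by
      intro ξ hξ
      have h2 : HasDerivWithinAt (fun τ => (Y τ).seq j) ((g ξ).seq j) (Icc a b) ξ := by
        rw [← hGg ξ hξ]
        exact (((Sob.coord j).restrictScalars ℝ).hasFDerivAt.comp_hasDerivAt ξ
          (hY ξ)).hasDerivWithinAt
      have h3 := (hy ξ hξ j).sub h2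
      rw [sub_self] at h3
      exact h3
    have h3 := (convex_Icc a b).norm_image_sub_le_of_norm_hasDerivWithin_le h1
      (C := 0) (fun _ _ => by simp) (left_mem_Icc.2 hab) hτ
    have h4 : (Y a).seq j = (y a).seq j := by simp [Y]
    rw [zero_mul, norm_le_zero_iff, h4, sub_self, sub_zero] at h3
    exact sub_eq_zero.1 h3
  rw [← hGg x hx]
  exact (hY x).hasDerivWithinAt.congr heq (heq x hx)

theorem contDiffOn_one_of_hasDerivWithinAt {E : Type*} [NormedAddCommGroup E] [NormedSpace ℝ E]
    {y g : ℝ → E} {a b : ℝ} (hab : a < b) (hg : ContinuousOn g (Icc a b))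
    (hy : ∀ x ∈ Icc a b, HasDerivWithinAt y (g x) (Icc a b) x) : ContDiffOn ℝ 1 y (Icc a b) := by
  have hu := uniqueDiffOn_Icc hab
  rw [contDiffOn_one_iff_derivWithin hu]
  exact ⟨fun x hx => (hy x hx).differentiableWithinAt,
    hg.congr fun x hx => (hy x hx).derivWithin (hu x hx)⟩

/-- Bounded sets of `𝒫_s` are closed under convergence of the coordinates. -/
theorem Sob.exists_of_tendsto {ι : Type*} {l : Filter ι} [l.NeBot] {w : ι → Sob N s} {C : ℝ}
    (hC : 0 ≤ C) (hw : ∀ᶠ i in l, ‖w i‖ ≤ C) {f : Mode N → ℂ}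
    (hf : ∀ j, Tendsto (fun i => (w i).seq j) l (𝓝 (f j))) :
    ∃ z : Sob N s, z.seq = f ∧ ‖z‖ ≤ C := by
  apply Sob.exists_of_sum_le f hC
  intro S
  have h1 : Tendsto (fun i => ∑ j ∈ S, (wt s j * ‖(w i).seq j‖) ^ 2) l
      (𝓝 (∑ j ∈ S, (wt s j * ‖f j‖) ^ 2)) :=
    tendsto_finsetSum S fun j _ => (((hf j).norm).const_mul _).pow 2
  refine le_of_tendsto h1 (hw.mono fun i hi => ((w i).sum_sq_le S).trans ?_)
  gcongr

end Curves

/-! ### The Cauchy problem in the interaction picture -/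

section Cauchy

open Filter Topology Set

variable {d : ℕ} {N : Set (Fin d → ℤ)} {s : ℝ} {ω : Mode N → ℝ}

theorem Sob.exists_conjRho (z : Sob N s) :
    ∃ w : Sob N s, (w.seq = fun j => (starRingEnd ℂ) (z.seq (conjMode j))) ∧ ‖w‖ ≤ ‖z‖ := by
  obtain ⟨w, hw, hn⟩ := Sob.exists_of_forall_le (s := s)
    (fun j => (starRingEnd ℂ) (z.seq (conjMode j))) (Sob.rhoL N s z) zero_le_one fun j => by
      rw [Sob.rhoL_seq, Complex.norm_conj, one_mul]
  exact ⟨w, hw, hn.trans (by rw [one_mul]; exact Sob.norm_rhoL_le z)⟩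

/-- The antilinear involution `z ↦ conj (ρ(z))`, whose fixed points are the real sequences. -/
def Sob.conjRho (z : Sob N s) : Sob N s := z.exists_conjRho.choose

theorem Sob.conjRho_seq (z : Sob N s) (j : Mode N) :
    z.conjRho.seq j = (starRingEnd ℂ) (z.seq (conjMode j)) :=
  congrFun z.exists_conjRho.choose_spec.1 j

theorem Sob.norm_conjRho_le (z : Sob N s) : ‖z.conjRho‖ ≤ ‖z‖ := z.exists_conjRho.choose_spec.2

theorem Sob.conjRho_sub (z w : Sob N s) : (z - w).conjRho = z.conjRho - w.conjRho :=
  Sob.ext fun j => by simp only [Sob.conjRho_seq, Sob.seq_sub, map_sub]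

/-- The projection onto the real sequences. -/
def Sob.realPart (z : Sob N s) : Sob N s := (1 / 2 : ℂ) • (z + z.conjRho)

theorem Sob.isReal_realPart (z : Sob N s) : IsReal z.realPart.seq := by
  intro j
  simp only [rho, Sob.realPart, Sob.seq_smul, Sob.seq_add, Sob.conjRho_seq, conjMode_conjMode,
    map_mul, map_add, Complex.conj_conj, map_div₀, map_one, map_ofNat]
  ring

theorem Sob.realPart_of_isReal {z : Sob N s} (hz : IsReal z.seq) : z.realPart = z :=
  Sob.ext fun j => by
    have h : z.seq (conjMode j) = (starRingEnd ℂ) (z.seq j) := hz j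
    simp only [Sob.realPart, Sob.seq_smul, Sob.seq_add, Sob.conjRho_seq, h, Complex.conj_conj]
    ring

theorem Sob.norm_realPart_sub_le (z w : Sob N s) : ‖z.realPart - w.realPart‖ ≤ ‖z - w‖ := by
  have e : z.realPart - w.realPart = (1 / 2 : ℂ) • ((z - w) + (z - w).conjRho) := by
    rw [Sob.conjRho_sub, Sob.realPart, Sob.realPart, ← smul_sub]
    congr 1
    abel
  rw [e, norm_smul]
  have h1 := norm_add_le (z - w) (z - w).conjRho
  have h2 := (z - w).norm_conjRho_le
  have h3 : ‖(1 / 2 : ℂ)‖ = 1 / 2 := by norm_num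
  rw [h3]
  linarith

/-- The radial retraction onto the ball of radius `η`. -/
def radial (η : ℝ) (z : Sob N s) : Sob N s := ((η / max η ‖z‖ : ℝ) : ℂ) • z

theorem norm_radial_le {η : ℝ} (hη : 0 < η) (z : Sob N s) : ‖radial η z‖ ≤ η := by
  have h : 0 < max η ‖z‖ := lt_max_of_lt_left hη
  rw [radial, norm_smul, Complex.norm_real, Real.norm_of_nonneg (by positivity),
    div_mul_eq_mul_div, div_le_iff₀ h]
  gcongr
  exact le_max_right _ _

theorem radial_of_norm_le {η : ℝ} (hη : 0 < η) {z : Sob N s} (hz : ‖z‖ ≤ η) : radial η z = z := by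
  rw [radial, max_eq_left hz, div_self hη.ne', Complex.ofReal_one, one_smul]

theorem isReal_radial (η : ℝ) {z : Sob N s} (hz : IsReal z.seq) : IsReal (radial η z).seq := by
  intro j
  have h : z.seq (conjMode j) = (starRingEnd ℂ) (z.seq j) := hz j
  simp only [rho, radial, Sob.seq_smul, h, map_mul, Complex.conj_ofReal]

theorem norm_radial_sub_le {η : ℝ} (hη : 0 < η) (z w : Sob N s) :
    ‖radial η z - radial η w‖ ≤ 2 * ‖z - w‖ := by
  set a := max η ‖z‖ with ha
  set b := max η ‖w‖ with hb
  have ha0 : 0 < a := lt_max_of_lt_left hη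
  have hb0 : 0 < b := lt_max_of_lt_left hη
  have e : radial η z - radial η w
      = ((η / a : ℝ) : ℂ) • (z - w) + ((η / a - η / b : ℝ) : ℂ) • w := by
    rw [radial, radial, ← ha, ← hb, smul_sub, Complex.ofReal_sub, sub_smul]
    abel
  have h1 : ‖((η / a : ℝ) : ℂ) • (z - w)‖ ≤ ‖z - w‖ := by
    rw [norm_smul, Complex.norm_real, Real.norm_of_nonneg (by positivity)]
    exact mul_le_of_le_one_left (norm_nonneg _) ((div_le_one ha0).2 (le_max_left _ _))
  have h2 : ‖((η / a - η / b : ℝ) : ℂ) • w‖ ≤ ‖z - w‖ := by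
    have h3 : η / a - η / b = (η / a) * ((b - a) / b) := by field_simp
    have h4 : |b - a| ≤ ‖z - w‖ := by
      rw [abs_sub_comm]
      refine (abs_max_sub_max_le_max _ _ _ _).trans ?_
      rw [sub_self, abs_zero, max_eq_right (abs_nonneg _)]
      exact abs_norm_sub_norm_le _ _
    rw [norm_smul, Complex.norm_real, h3, Real.norm_eq_abs, abs_mul, abs_div (b - a),
      abs_of_pos hb0, abs_of_pos (show 0 < η / a by positivity)]
    calc η / a * (|b - a| / b) * ‖w‖ = (η / a) * (‖w‖ / b) * |b - a| := by ring
      _ ≤ 1 * 1 * ‖z - w‖ := by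
          gcongr
          · exact (div_le_one ha0).2 (le_max_left _ _)
          · exact (div_le_one hb0).2 (le_max_right _ _)
      _ = _ := by ring
  rw [e]
  refine (norm_add_le _ _).trans ?_
  linarith

/-- The field `-iF` on a ball of the space of real sequences extends to a bounded and globally
Lipschitz field on `𝒫_s`, with real values. -/
theorem exists_global_field {F : (Mode N → ℂ) → (Mode N → ℂ)} (h : RegularRevAt F s) :
    ∃ η : ℝ, 0 < η ∧ ∃ (f X : Sob N s → Sob N s) (K M : ℝ≥0),
      (∀ z, ‖z‖ ≤ η → (f z).seq = F z.seq) ∧ LipschitzOnWith K f (Metric.closedBall 0 η) ∧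
      LipschitzWith K X ∧ (∀ z, ‖X z‖ ≤ M) ∧ (∀ z, IsReal (X z).seq) ∧ X 0 = 0 ∧
      ∀ z, IsReal z.seq → ‖z‖ ≤ η → X z = (-Complex.I) • f z := by
  obtain ⟨δ, hδ, ⟨f, hf, ⟨K, hK⟩, C, hC⟩, hrev⟩ := h
  have hη : 0 < δ / 2 := by positivity
  have hsub : ∀ z : Sob N s, ‖z‖ ≤ δ / 2 → z ∈ Metric.ball (0 : Sob N s) δ := fun z hz => by
    rw [mem_ball_zero_iff]
    linarith
  let P : Sob N s → Sob N s := fun z => radial (δ / 2) z.realPart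
  have hPη : ∀ z, ‖P z‖ ≤ δ / 2 := fun z => norm_radial_le hη _
  have hPr : ∀ z, IsReal (P z).seq := fun z => isReal_radial _ z.isReal_realPart
  have hP : ∀ z : Sob N s, IsReal z.seq → ‖z‖ ≤ δ / 2 → P z = z := fun z hz hn => by
    simp only [P]
    rw [Sob.realPart_of_isReal hz, radial_of_norm_le hη hn]
  have hf0 : f 0 = 0 := by
    have := hC 0 (hsub 0 (by rw [norm_zero]; exact hη.le))
    rw [norm_zero, zero_pow two_ne_zero, mul_zero] at this
    exact norm_le_zero_iff.1 this
  have h0r : IsReal (0 : Sob N s).seq := fun j => by simp [rho]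
  have hI : ‖-Complex.I‖ = 1 := by simp
  refine ⟨δ / 2, hη, f, fun z => (-Complex.I) • f (P z), 2 * K, K * (δ / 2).toNNReal,
    fun z hz => hf z (hsub z hz), ?_, ?_, fun z => ?_, fun z j => ?_, ?_, fun z hz hn => ?_⟩
  · refine (hK.mono fun z hz => hsub z (mem_closedBall_zero_iff.1 hz)).weaken ?_
    exact le_mul_of_one_le_left K.2 one_le_two
  · refine LipschitzWith.of_dist_le_mul fun z w => ?_
    rw [dist_eq_norm, dist_eq_norm, ← smul_sub, norm_smul, hI, one_mul]
    have h1 := hK.dist_le_mul _ (hsub _ (hPη z)) _ (hsub _ (hPη w))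
    rw [dist_eq_norm, dist_eq_norm] at h1
    have h2 : ‖P z - P w‖ ≤ 2 * ‖z - w‖ :=
      (norm_radial_sub_le hη _ _).trans (by gcongr; exact Sob.norm_realPart_sub_le z w)
    calc _ ≤ K * ‖P z - P w‖ := h1
      _ ≤ K * (2 * ‖z - w‖) := by gcongr
      _ = _ := by push_cast; ring
  · rw [norm_smul, hI, one_mul]
    have h1 := hK.dist_le_mul _ (hsub _ (hPη z)) 0 (hsub 0 (by rw [norm_zero]; exact hη.le))
    rw [hf0, dist_zero_right, dist_zero_right] at h1
    refine h1.trans ?_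
    rw [NNReal.coe_mul, Real.coe_toNNReal _ hη.le]
    exact mul_le_mul_of_nonneg_left (hPη z) K.2
  · have h1 := (hrev (P z) (hsub _ (hPη z)) (hPr z)).1 j
    simp only [rho, Sob.seq_smul, hf _ (hsub _ (hPη z)), h1, map_mul, map_neg, Complex.conj_I]
    ring
  · have : P 0 = 0 := hP 0 h0r (by rw [norm_zero]; exact hη.le)
    simp only [this, hf0, smul_zero]
  · simp only [hP z hz hn]

theorem isReal_flow (hodd : ∀ j, ω (conjMode j) = -ω j) {z : Sob N s} (hz : IsReal z.seq) (τ : ℝ) :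
    IsReal (Sob.flow s ω τ z).seq := by
  intro j
  have h : z.seq (conjMode j) = (starRingEnd ℂ) (z.seq j) := hz j
  simp only [rho, Sob.flow_seq, hodd, h, map_mul, ← Complex.exp_conj, map_neg, Complex.conj_ofReal,
    Complex.conj_I]
  congr 2
  push_cast
  ring

/-- The Cauchy problem in the interaction picture, for a bounded and globally Lipschitz field. -/
theorem exists_solution {X : Sob N s → Sob N s} {K M : ℝ≥0} (hX : LipschitzWith K X)
    (hM : ∀ z, ‖X z‖ ≤ M) (ω : Mode N → ℝ) (u₀ : Sob N s) {T : ℝ} (hT : 0 ≤ T) :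
    ∃ u : ℝ → Sob N s, u 0 = u₀ ∧ ∀ τ ∈ Icc (-T) T,
      HasDerivWithinAt u (Sob.flow s ω (-τ) (X (Sob.flow s ω τ (u τ)))) (Icc (-T) T) τ := by
  have hpl : IsPicardLindelof (fun τ u => Sob.flow s ω (-τ) (X (Sob.flow s ω τ u)))
      (⟨0, by simpa using hT, hT⟩ : Icc (-T) T) u₀ (M * T.toNNReal) 0 M K := by
    refine ⟨fun τ _ => ?_, fun x _ => ?_, fun τ _ x _ => ?_, ?_⟩
    · refine LipschitzOnWith.of_dist_le_mul fun x _ y _ => ?_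
      rw [dist_eq_norm, dist_eq_norm, ← map_sub, Sob.norm_flow]
      have := hX.dist_le_mul (Sob.flow s ω τ x) (Sob.flow s ω τ y)
      rwa [dist_eq_norm, dist_eq_norm, ← map_sub, Sob.norm_flow] at this
    · have h := (Sob.continuous_flow_uncurry (s := s) ω).comp
        (continuous_neg.prodMk (hX.continuous.comp (Sob.continuous_flow ω x)))
      exact h.continuousOn
    · rw [Sob.norm_flow]
      exact hM _
    · simp [hT]
  exact hpl.exists_eq_forall_mem_Icc_hasDerivWithinAt₀

/-- A curve with real initial value and real velocity is real. -/
theorem isReal_of_hasDerivWithinAt {u v : ℝ → Sob N s} {T : ℝ} (hT : 0 ≤ T)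
    (h0 : IsReal (u 0).seq) (hu : ∀ τ ∈ Icc (-T) T, HasDerivWithinAt u (v τ) (Icc (-T) T) τ)
    (hv : ∀ τ, IsReal (v τ).seq) : ∀ τ ∈ Icc (-T) T, IsReal (u τ).seq := by
  intro τ hτ j
  have h1 : ∀ (k : Mode N), ∀ ξ ∈ Icc (-T) T,
      HasDerivWithinAt (fun τ => (u τ).seq k) ((v ξ).seq k) (Icc (-T) T) ξ := fun k ξ hξ =>
    ((Sob.coord k).restrictScalars ℝ).hasFDerivAt.comp_hasDerivWithinAt ξ (hu ξ hξ)
  have h2 : ∀ ξ ∈ Icc (-T) T, HasDerivWithinAt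
      (fun τ => (u τ).seq (conjMode j) - (starRingEnd ℂ) ((u τ).seq j)) 0 (Icc (-T) T) ξ := by
    intro ξ hξ
    have h3 : HasDerivWithinAt (fun τ => (starRingEnd ℂ) ((u τ).seq j))
        ((starRingEnd ℂ) ((v ξ).seq j)) (Icc (-T) T) ξ :=
      Complex.conjCLE.toContinuousLinearMap.hasFDerivAt.comp_hasDerivWithinAt ξ (h1 j ξ hξ)
    have h4 := (h1 (conjMode j) ξ hξ).sub h3
    have h5 : (v ξ).seq (conjMode j) = (starRingEnd ℂ) ((v ξ).seq j) := hv ξ j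
    rw [h5, sub_self] at h4
    exact h4
  have h3 := (convex_Icc (-T) T).norm_image_sub_le_of_norm_hasDerivWithin_le h2
    (C := 0) (fun _ _ => by simp) (x := 0) ⟨by linarith, hT⟩ hτ
  have h4 : (u 0).seq (conjMode j) = (starRingEnd ℂ) ((u 0).seq j) := h0 j
  rw [zero_mul, norm_le_zero_iff, h4, sub_self, sub_zero] at h3
  exact sub_eq_zero.1 h3

theorem hasDerivAt_exp_neg (x τ : ℝ) :
    HasDerivAt (fun τ : ℝ => Complex.exp (-(x * τ : ℝ) * Complex.I))
      (-Complex.I * x * Complex.exp (-(x * τ : ℝ) * Complex.I)) τ := by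
  have h1 : HasDerivAt (fun τ : ℝ => -((x * τ : ℝ) : ℂ) * Complex.I) (-(x : ℂ) * Complex.I) τ := by
    have h2 : HasDerivAt (fun τ : ℝ => x * τ) x τ := by
      simpa using (hasDerivAt_id τ).const_mul x
    exact (h2.ofReal_comp.neg).mul_const _
  convert h1.cexp using 1
  ring

/-- The coordinates of `τ ↦ Φ_τ u(τ)` solve the original system. -/
theorem hasDerivWithinAt_flow_seq {u : ℝ → Sob N s} {g : Sob N s} {S : Set ℝ} {τ : ℝ}
    (hu : HasDerivWithinAt u (Sob.flow s ω (-τ) g) S τ) (j : Mode N) :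
    HasDerivWithinAt (fun σ => (Sob.flow s ω σ (u σ)).seq j)
      (-Complex.I * ω j * (Sob.flow s ω τ (u τ)).seq j + g.seq j) S τ := by
  have h1 : HasDerivWithinAt (fun τ => (u τ).seq j) ((Sob.flow s ω (-τ) g).seq j) S τ :=
    ((Sob.coord j).restrictScalars ℝ).hasFDerivAt.comp_hasDerivWithinAt τ hu
  have h2 := (hasDerivAt_exp_neg (ω j) τ).hasDerivWithinAt (s := S) |>.mul h1
  have h3 : g.seq j = Complex.exp (-(ω j * τ : ℝ) * Complex.I) * (Sob.flow s ω (-τ) g).seq j := by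
    rw [← Sob.flow_seq, Sob.flow_flow_neg]
  rw [Sob.flow_seq, h3]
  refine (h2.congr_deriv (by ring)).congr (fun σ _ => ?_) ?_
  · exact Sob.flow_seq _ _ _ _
  · exact Sob.flow_seq _ _ _ _

/-- A solution of the original system on an interval where it stays in the domain of the field is
a solution in the interaction picture. -/
theorem hasDerivWithinAt_flow_neg {F : (Mode N → ℂ) → (Mode N → ℂ)} {f : Sob N s → Sob N s}
    {w : ℝ → Sob N s} {a b : ℝ}
    (hfw : ContinuousOn (fun τ => f (w τ)) (Icc a b))
    (hf : ∀ τ ∈ Icc a b, (f (w τ)).seq = F (w τ).seq)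
    (hsol : ∀ τ ∈ Icc a b, ∀ j : Mode N, ∃ v : ℂ,
      HasDerivWithinAt (fun τ => (w τ).seq j) v (Icc a b) τ ∧
      Complex.I * v = (ω j : ℂ) * (w τ).seq j + F (w τ).seq j) :
    ∀ τ ∈ Icc a b, HasDerivWithinAt (fun τ => Sob.flow s ω (-τ) (w τ))
      (Sob.flow s ω (-τ) ((-Complex.I) • f (w τ))) (Icc a b) τ := by
  apply hasDerivWithinAt_of_coord
  · have h1 : ContinuousOn (fun τ => (-τ, (-Complex.I) • f (w τ))) (Icc a b) :=
      continuousOn_neg.prodMk (hfw.const_smul (-Complex.I))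
    have h2 := (Sob.continuous_flow_uncurry (s := s) ω).comp_continuousOn h1
    exact h2
  · intro τ hτ j
    obtain ⟨v, hv, hve⟩ := hsol τ hτ j
    have h1 := ((hasDerivAt_exp_neg (-ω j) τ).hasDerivWithinAt (s := Icc a b)).mul hv
    have e : ∀ σ (z : Sob N s), (Sob.flow s ω (-σ) z).seq j
        = Complex.exp (-(-ω j * σ : ℝ) * Complex.I) * z.seq j := fun σ z => by
      rw [Sob.flow_seq, mul_neg, ← neg_mul (ω j)]
    have e2 : v = -Complex.I * ((ω j : ℂ) * (w τ).seq j + (f (w τ)).seq j) := by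
      rw [hf τ hτ, ← hve]
      linear_combination v * Complex.I_mul_I
    refine (h1.congr_deriv ?_).congr (fun σ _ => e σ _) (e τ _)
    rw [e, Sob.seq_smul, e2]
    push_cast
    ring

end Cauchy

/-! ### Regularity in time -/

section Regularity

open Filter Topology Set

variable {d : ℕ} {N : Set (Fin d → ℤ)} {s : ℝ} {ω : Mode N → ℝ}

/-- The free flow is Lipschitz in time on the sequences `z` with `(ω_j z_j)_j ∈ 𝒫_s`. -/
theorem norm_flow_sub_le {z y : Sob N s} (hy : ∀ j, y.seq j = (ω j : ℂ) * z.seq j) {h : ℝ}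
    (hh : 0 ≤ h) : ‖Sob.flow s ω h z - z‖ ≤ h * ‖y‖ := by
  refine Sob.norm_le_of_forall_le _ y hh fun j => ?_
  have e : (Sob.flow s ω h z - z).seq j
      = (Complex.exp (Complex.I * ((-(ω j * h) : ℝ) : ℂ)) - 1) * z.seq j := by
    rw [Sob.seq_sub, Sob.flow_seq, sub_mul, one_mul]
    congr 3
    push_cast
    ring
  have h1 := Real.norm_exp_I_mul_ofReal_sub_one_le (x := -(ω j * h))
  rw [e, hy, norm_mul, norm_mul, Complex.norm_real]
  rw [norm_neg, norm_mul, Real.norm_of_nonneg hh] at h1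
  calc _ ≤ wt s j * (‖ω j‖ * h * ‖z.seq j‖) := by
        have := wt_nonneg s j
        gcongr
    _ = _ := by ring

/-- Regularity of the solution when `(ω_j z_j(0))_j` belongs to `𝒫_s`: the field being Lipschitz,
the solution is Lipschitz in time; hence the increments of the difference quotients of
`u(t) = Φ_{-t} z(t)`, transported along the linear flow, are Lipschitz in time, uniformly in the
step, and so is the limit `Φ_{-t} ż(t)`. -/
theorem contDiffOn_one_of_domain {X : Sob N s → Sob N s} {K M : ℝ≥0} (hX : LipschitzWith K X)
    (hM : ∀ z, ‖X z‖ ≤ M) {T : ℝ} (hT : 0 < T) {u : ℝ → Sob N s}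
    (hu : ∀ τ ∈ Icc (-(T + 1)) (T + 1), HasDerivWithinAt u
      (Sob.flow s ω (-τ) (X (Sob.flow s ω τ (u τ)))) (Icc (-(T + 1)) (T + 1)) τ)
    {y₀ : Sob N s} (hy₀ : ∀ j, y₀.seq j = (ω j : ℂ) * (u 0).seq j) :
    ContDiffOn ℝ 1 (fun τ => Sob.flow s ω τ (u τ)) (Icc (-T) T) := by
  let z : ℝ → Sob N s := fun τ => Sob.flow s ω τ (u τ)
  let v : ℝ → Sob N s := fun τ => Sob.flow s ω (-τ) (X (z τ))
  have hshift : ∀ h : ℝ, 0 ≤ h → h ≤ 1 → ∀ t ∈ Icc (-T) T, t + h ∈ Icc (-(T + 1)) (T + 1) :=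
    fun h h0 h1 t ht => ⟨by linarith [ht.1], by linarith [ht.2]⟩
  have hsub : Icc (-T) T ⊆ Icc (-(T + 1)) (T + 1) := fun t ht => by
    simpa using hshift 0 le_rfl zero_le_one t ht
  have hus : ∀ h : ℝ, 0 ≤ h → h ≤ 1 → ∀ t ∈ Icc (-T) T,
      HasDerivWithinAt (fun τ => u (τ + h)) (v (t + h)) (Icc (-T) T) t := by
    intro h h0 h1 t ht
    have := (hu (t + h) (hshift h h0 h1 t ht)).scomp t
      ((hasDerivWithinAt_id t (Icc (-T) T)).add_const h) (hshift h h0 h1)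
    rw [one_smul] at this
    exact this
  -- the increment `z(t + h) - z(t)`, transported back along the linear flow
  let D : ℝ → ℝ → Sob N s := fun h t => Sob.flow s ω h (u (t + h)) - u t
  have hDz : ∀ h t, ‖D h t‖ = ‖z (t + h) - z t‖ := by
    intro h t
    rw [← Sob.norm_flow ω t (D h t)]
    simp only [D, z]
    rw [map_sub, ← Sob.flow_add]
  have hD : ∀ h : ℝ, 0 ≤ h → h ≤ 1 → ∀ t ∈ Icc (-T) T,
      HasDerivWithinAt (D h) (Sob.flow s ω (-t) (X (z (t + h)) - X (z t))) (Icc (-T) T) t := by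
    intro h h0 h1 t ht
    have h2 : HasDerivWithinAt (fun τ => Sob.flow s ω h (u (τ + h))) (Sob.flow s ω h (v (t + h)))
        (Icc (-T) T) t :=
      ((Sob.flow s ω h).restrictScalars ℝ).hasFDerivAt.comp_hasDerivWithinAt t (hus h h0 h1 t ht)
    have h3 := h2.sub ((hu t (hsub ht)).mono hsub)
    have e : Sob.flow s ω (-t) (X (z (t + h)) - X (z t))
        = Sob.flow s ω h (v (t + h)) - Sob.flow s ω (-t) (X (Sob.flow s ω t (u t))) := by
      simp only [v]
      rw [map_sub, ← Sob.flow_add]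
      congr 3
      ring
    rw [e]
    exact h3
  have hDle : ∀ h t, ‖Sob.flow s ω (-t) (X (z (t + h)) - X (z t))‖ ≤ K * ‖D h t‖ := by
    intro h t
    rw [Sob.norm_flow, hDz]
    have := hX.dist_le_mul (z (t + h)) (z t)
    rwa [dist_eq_norm, dist_eq_norm] at this
  have h0mem : (0 : ℝ) ∈ Icc (-T) T := ⟨by linarith, hT.le⟩
  have hD0 : ∀ h : ℝ, 0 ≤ h → h ≤ 1 → ‖D h 0‖ ≤ h * (‖y₀‖ + M) := by
    intro h h0 h1
    have h2 : ‖u h - u 0‖ ≤ M * h := by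
      have := (convex_Icc (-(T + 1)) (T + 1)).norm_image_sub_le_of_norm_hasDerivWithin_le hu
        (C := M) (fun τ _ => by rw [Sob.norm_flow]; exact hM _) (hsub h0mem)
        (by simpa using hshift h h0 h1 0 h0mem)
      rwa [sub_zero, Real.norm_of_nonneg h0] at this
    have e : D h 0 = Sob.flow s ω h (u h - u 0) + (Sob.flow s ω h (u 0) - u 0) := by
      simp only [D]
      rw [zero_add, map_sub]
      abel
    rw [e]
    refine (norm_add_le _ _).trans ?_
    rw [Sob.norm_flow]
    have h3 := norm_flow_sub_le hy₀ h0
    linarith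
  set L := (‖y₀‖ + M) * Real.exp (K * T) with hL
  have hL0 : 0 ≤ L := by positivity
  have hDt : ∀ h : ℝ, 0 ≤ h → h ≤ 1 → ∀ t ∈ Icc (-T) T, ‖D h t‖ ≤ h * L := by
    intro h h0 h1 t ht
    have hsub' : uIcc 0 t ⊆ Icc (-T) T := uIcc_subset_Icc h0mem ht
    have h2 := norm_le_exp_of_norm_deriv_le (T := t)
      (fun τ hτ => (hD h h0 h1 τ (hsub' hτ)).mono hsub') (fun τ _ => hDle h τ)
    have h3 : |t| ≤ T := abs_le.2 ht
    calc ‖D h t‖ ≤ ‖D h 0‖ * Real.exp (K * |t|) := h2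
      _ ≤ (h * (‖y₀‖ + M)) * Real.exp (K * T) := by
          gcongr
          exact hD0 h h0 h1
      _ = h * L := by rw [hL]; ring
  have hDab : ∀ h : ℝ, 0 ≤ h → h ≤ 1 → ∀ a ∈ Icc (-T) T, ∀ b ∈ Icc (-T) T,
      ‖D h b - D h a‖ ≤ h * (K * L * |b - a|) := by
    intro h h0 h1 a ha b hb
    have := (convex_Icc (-T) T).norm_image_sub_le_of_norm_hasDerivWithin_le (hD h h0 h1)
      (C := K * (h * L)) (fun τ hτ => (hDle h τ).trans (by gcongr; exact hDt h h0 h1 τ hτ)) ha hb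
    refine this.trans_eq ?_
    rw [Real.norm_eq_abs]
    ring
  -- the coordinates of the limit `Φ_{-t} ż(t)` of `D h t / h`
  let q : ℝ → Mode N → ℂ := fun t j => -Complex.I * ω j * (u t).seq j + (v t).seq j
  have hlim : ∀ t ∈ Icc (-T) T, ∀ j,
      Tendsto (fun h : ℝ => (h : ℂ)⁻¹ * (D h t).seq j) (𝓝[>] 0) (𝓝 (q t j)) := by
    intro t ht j
    have h1 : HasDerivAt u (v t) t := (hu t (hsub ht)).hasDerivAt
      (Icc_mem_nhds (by linarith [ht.1]) (by linarith [ht.2]))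
    have h2 : HasDerivAt (fun h => u (t + h)) (v t) 0 := by
      have := HasDerivAt.comp_const_add t (0 : ℝ) (f := u) (f' := v t) (by rwa [add_zero])
      exact this
    have h3 := hasDerivWithinAt_flow_seq (ω := ω) (g := v t) (S := univ) (τ := 0) (by
      rw [neg_zero, Sob.flow_zero]
      exact h2.hasDerivWithinAt) j
    rw [hasDerivWithinAt_univ, hasDerivAt_iff_tendsto_slope] at h3
    simp only [Sob.flow_zero, add_zero] at h3
    have h4 := h3.mono_left (nhdsWithin_mono (0 : ℝ) (fun x (hx : 0 < x) => hx.ne'))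
    refine h4.congr fun h => ?_
    rw [slope_def_module, sub_zero, ← Complex.coe_smul, smul_eq_mul, Complex.ofReal_inv]
    simp only [D]
    rw [Sob.seq_sub, Sob.flow_zero, add_zero]
  have hinc : ∀ a ∈ Icc (-T) T, ∀ b ∈ Icc (-T) T, ∃ w : Sob N s, (w.seq = fun j => q b j - q a j) ∧
      ‖w‖ ≤ K * L * |b - a| := by
    intro a ha b hb
    refine Sob.exists_of_tendsto (l := 𝓝[>] (0 : ℝ))
      (w := fun h : ℝ => ((h : ℂ)⁻¹) • (D h b - D h a)) (by positivity) ?_ fun j => ?_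
    · filter_upwards [Ioc_mem_nhdsGT (zero_lt_one' ℝ)] with h hh
      rw [norm_smul, norm_inv, Complex.norm_real, Real.norm_of_nonneg hh.1.le,
        inv_mul_le_iff₀ hh.1]
      exact hDab h hh.1.le hh.2 a ha b hb
    · simp only [Sob.seq_smul, Sob.seq_sub, mul_sub]
      exact (hlim b hb j).sub (hlim a ha j)
  have hY : ∀ t, ∃ Y : Sob N s, t ∈ Icc (-T) T → ∀ j, Y.seq j = q t j := by
    intro t
    by_cases ht : t ∈ Icc (-T) T
    · obtain ⟨w, hw, -⟩ := hinc 0 h0mem t ht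
      refine ⟨(-Complex.I) • y₀ + v 0 + w, fun _ j => ?_⟩
      rw [Sob.seq_add, Sob.seq_add, Sob.seq_smul, hy₀, hw]
      simp only [q]
      ring
    · exact ⟨0, fun h => absurd h ht⟩
  choose Y hYq using hY
  have hYc : ContinuousOn Y (Icc (-T) T) := by
    refine (LipschitzOnWith.of_dist_le_mul (K := K * L.toNNReal) fun b hb a ha => ?_).continuousOn
    obtain ⟨w, hw, hn⟩ := hinc a ha b hb
    have e : Y b - Y a = w := Sob.ext fun j => by
      rw [Sob.seq_sub, hYq b hb, hYq a ha, hw]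
    rw [dist_eq_norm, dist_eq_norm, e, NNReal.coe_mul, Real.coe_toNNReal _ hL0, Real.norm_eq_abs]
    exact hn
  have hg : ContinuousOn (fun τ => Sob.flow s ω τ (Y τ)) (Icc (-T) T) := by
    have h1 : ContinuousOn (fun τ => (τ, Y τ)) (Icc (-T) T) := continuousOn_id.prodMk hYc
    have h2 := (Sob.continuous_flow_uncurry (s := s) ω).comp_continuousOn h1
    exact h2
  refine contDiffOn_one_of_hasDerivWithinAt (by linarith) hg (hasDerivWithinAt_of_coord hg ?_)
  intro t ht j
  refine (hasDerivWithinAt_flow_seq ((hu t (hsub ht)).mono hsub) j).congr_deriv ?_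
  rw [Sob.flow_seq, Sob.flow_seq, hYq t ht]
  simp only [q, v]
  have h5 : (X (z t)).seq j = Complex.exp (-(ω j * t : ℝ) * Complex.I)
      * (Sob.flow s ω (-t) (X (z t))).seq j := by
    rw [← Sob.flow_seq, Sob.flow_flow_neg]
  rw [mul_add, ← h5]
  simp only [z]
  ring

/-- The frequencies growing at most like `|j|^p`, the multiplication by `ω` maps `𝒫_s` to
`𝒫_{s-p}`. -/
theorem exists_omega_map {p C : ℝ} (hC : 0 ≤ C) (hω : ∀ j, |ω j| ≤ C * wt p j) (s : ℝ) :
    ∃ Ω : Sob N s → Sob N (s - p), (∀ z j, (Ω z).seq j = (ω j : ℂ) * z.seq j) ∧ Continuous Ω := by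
  have h : ∀ z : Sob N s, ∃ w : Sob N (s - p), (w.seq = fun j => (ω j : ℂ) * z.seq j) ∧
      ‖w‖ ≤ C * ‖z‖ := fun z => Sob.exists_of_forall_le _ z hC fun j => by
    have e : wt s j = wt (s - p) j * wt p j := by rw [← wt_add, sub_add_cancel]
    rw [norm_mul, Complex.norm_real, Real.norm_eq_abs, e]
    calc _ ≤ wt (s - p) j * (C * wt p j * ‖z.seq j‖) := by
          have := wt_nonneg (s - p) j
          gcongr
          exact hω j
      _ = _ := by ring
  choose Ω hΩ hn using h
  have hseq : ∀ z j, (Ω z).seq j = (ω j : ℂ) * z.seq j := fun z j => congrFun (hΩ z) j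
  refine ⟨Ω, hseq, (LipschitzWith.of_dist_le_mul (K := C.toNNReal) fun z w => ?_).continuous⟩
  have e : Ω z - Ω w = Ω (z - w) := Sob.ext fun j => by
    rw [Sob.seq_sub, hseq, hseq, hseq, Sob.seq_sub, mul_sub]
  rw [dist_eq_norm, dist_eq_norm, e, Real.coe_toNNReal _ hC]
  exact hn _

end Regularity

/-! ### Local theory of the system -/

section System

open Filter Topology Set

variable {d : ℕ} {N : Set (Fin d → ℤ)} {s : ℝ} {ω : Mode N → ℝ}

/-- Two solutions with the same initial datum coincide, as long as the first one stays in a ball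
on which the field is Lipschitz and the second one in a smaller ball. -/
theorem eqOn_of_isSolution {F : (Mode N → ℂ) → (Mode N → ℂ)} {f : Sob N s → Sob N s} {K : ℝ≥0}
    {η ε T : ℝ} (hf : ∀ z, ‖z‖ ≤ η → (f z).seq = F z.seq)
    (hK : LipschitzOnWith K f (Metric.closedBall 0 η)) (hεη : ε < η) (hT : 0 ≤ T)
    {u w : ℝ → Sob N s} (hw0 : w 0 = u 0) (hw : IsSolution ω F T w)
    (hu : ∀ τ ∈ Icc (-T) T, ‖u τ‖ ≤ ε ∧ HasDerivWithinAt u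
      (Sob.flow s ω (-τ) ((-Complex.I) • f (Sob.flow s ω τ (u τ)))) (Icc (-T) T) τ) :
    EqOn w (fun τ => Sob.flow s ω τ (u τ)) (Icc (-T) T) := by
  obtain ⟨hwc, hwd⟩ := hw
  have h0mem : (0 : ℝ) ∈ Icc (-T) T := ⟨by linarith, hT⟩
  -- as long as `w` stays in the larger ball, Grönwall applies; then it stays in the smaller one
  have key : ∀ t ∈ Icc (-T) T, (∀ τ ∈ uIcc 0 t, ‖w τ‖ ≤ η) → w t = Sob.flow s ω t (u t) := by
    intro t ht hwη
    have hsub : uIcc 0 t ⊆ Icc (-T) T := uIcc_subset_Icc h0mem ht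
    have hmem : ∀ τ ∈ uIcc 0 t, w τ ∈ Metric.closedBall (0 : Sob N s) η := fun τ hτ =>
      mem_closedBall_zero_iff.2 (hwη τ hτ)
    have h1 := hasDerivWithinAt_flow_neg (ω := ω) (F := F) (f := f) (w := w)
      (a := min 0 t) (b := max 0 t) (hK.continuousOn.comp (hwc.mono hsub) hmem)
      (fun τ hτ => hf _ (hwη τ hτ)) (fun τ hτ j => by
        obtain ⟨v, hv, hve⟩ := hwd τ (hsub hτ) j
        exact ⟨v, hv.mono hsub, hve⟩)
    have h2 : ∀ τ ∈ uIcc 0 t, HasDerivWithinAt (fun τ => Sob.flow s ω (-τ) (w τ) - u τ)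
        (Sob.flow s ω (-τ) ((-Complex.I) • f (w τ))
          - Sob.flow s ω (-τ) ((-Complex.I) • f (Sob.flow s ω τ (u τ)))) (uIcc 0 t) τ :=
      fun τ hτ => (h1 τ hτ).sub ((hu τ (hsub hτ)).2.mono hsub)
    have h3 := norm_le_exp_of_norm_deriv_le (K := K) h2 fun τ hτ => by
      rw [← map_sub, Sob.norm_flow, ← smul_sub, norm_smul, norm_neg, Complex.norm_I, one_mul,
        ← Sob.norm_flow ω τ (Sob.flow s ω (-τ) (w τ) - u τ), map_sub, Sob.flow_flow_neg]
      have := hK.dist_le_mul _ (hmem τ hτ) (Sob.flow s ω τ (u τ))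
        (mem_closedBall_zero_iff.2 (by
          rw [Sob.norm_flow]
          exact (hu τ (hsub hτ)).1.trans hεη.le))
      rwa [dist_eq_norm, dist_eq_norm] at this
    rw [neg_zero, Sob.flow_zero, hw0, sub_self, norm_zero, zero_mul, norm_le_zero_iff,
      sub_eq_zero] at h3
    rw [← h3, Sob.flow_flow_neg]
  have hle : ∀ t ∈ Icc (-T) T, ‖w t‖ ≤ ε :=
    bootstrap hεη hwc.norm (by rw [hw0]; exact (hu 0 h0mem).1) fun t ht h => by
      rw [key t ht h, Sob.norm_flow]
      exact (hu t ht).1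
  exact fun t ht => key t ht fun τ hτ => (hle τ (uIcc_subset_Icc h0mem ht hτ)).trans hεη.le

/-- The converse of `hasDerivWithinAt_flow_neg`: back from the interaction picture. -/
theorem isSolution_flow {F : (Mode N → ℂ) → (Mode N → ℂ)} {f : Sob N s → Sob N s} {T : ℝ}
    {u : ℝ → Sob N s}
    (hu : ∀ τ ∈ Icc (-T) T, (f (Sob.flow s ω τ (u τ))).seq = F (Sob.flow s ω τ (u τ)).seq ∧
      HasDerivWithinAt u
        (Sob.flow s ω (-τ) ((-Complex.I) • f (Sob.flow s ω τ (u τ)))) (Icc (-T) T) τ) :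
    IsSolution ω F T fun τ => Sob.flow s ω τ (u τ) := by
  refine ⟨?_, fun t ht j => ⟨_, hasDerivWithinAt_flow_seq (hu t ht).2 j, ?_⟩⟩
  · have h1 : ContinuousOn (fun τ => (τ, u τ)) (Icc (-T) T) :=
      continuousOn_id.prodMk fun τ hτ => (hu τ hτ).2.continuousWithinAt
    have h2 := (Sob.continuous_flow_uncurry (s := s) ω).comp_continuousOn h1
    exact h2
  · rw [Sob.seq_smul, ← (hu t ht).1]
    linear_combination (-(ω j : ℂ) * (Sob.flow s ω t (u t)).seq j
      - (f (Sob.flow s ω t (u t))).seq j) * Complex.I_mul_I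

end System

end RevSys

end

theorem corollary1 (d : ℕ) (hd : 1 ≤ d) (N : Set (Fin d → ℤ))
    (hN : N = Set.univ ∨ N = {a | ∀ i, 0 ≤ a i})
    (ω : RevSys.Mode N → ℝ) (p : ℝ) (hp : 0 < p)
    (hω_odd : ∀ j, ω (RevSys.conjMode j) = -ω j)
    (hω_bound : ∃ C : ℝ, 0 < C ∧ ∀ a : N, |ω (a, 1)| ≤ C * RevSys.latAbs (a : Fin d → ℤ) ^ p)
    (hω : RevSys.NonResonant ω)
    (F : (RevSys.Mode N → ℂ) → (RevSys.Mode N → ℂ)) (hF : RevSys.ReversibleClassT F)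
    (r : ℕ) (hr : 3 ≤ r) :
    ∃ s₀ : ℝ, 0 < s₀ ∧ ∀ s : ℝ, s₀ < s → ∃ εs : ℝ, 0 < εs ∧
      ∀ z₀ : RevSys.Sob N s, RevSys.IsReal z₀.seq → ‖z₀‖ < εs / 2 →
        ∀ T : ℝ, 0 < T → T * ‖z₀‖ ^ r ≤ 1 →
          ∃ z : ℝ → RevSys.Sob N s,
            z 0 = z₀ ∧ RevSys.IsSolution ω F T z ∧
            (∀ T' : ℝ, 0 < T' → T' ≤ T → ∀ w : ℝ → RevSys.Sob N s,
              w 0 = z₀ → RevSys.IsSolution ω F T' w → Set.EqOn w z (Set.Icc (-T') T')) ∧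
            (∀ t ∈ Set.Icc (-T) T, ‖z t‖ ≤ 2 * ‖z₀‖) ∧
            (∃ y : ℝ → RevSys.Sob N (s - p), ContDiffOn ℝ 1 y (Set.Icc (-T) T) ∧
              ∀ t ∈ Set.Icc (-T) T, (y t).seq = (z t).seq) ∧
            ((∃ y₀ : RevSys.Sob N s, ∀ j, y₀.seq j = (ω j : ℂ) * z₀.seq j) →
              ContDiffOn ℝ 1 z (Set.Icc (-T) T)) := by
  have hNle : ∃ C : ℝ, 0 ≤ C ∧ ∀ j : RevSys.Mode N, |ω j| ≤ C * RevSys.wt p j := by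
    obtain ⟨C, hC, hb⟩ := hω_bound
    refine ⟨C, hC.le, fun j => ?_⟩
    rcases Int.units_eq_one_or j.2 with h | h
    · have e : j = (j.1, 1) := Prod.ext rfl h
      rw [e]
      exact hb j.1
    · have e : j = RevSys.conjMode (j.1, 1) := Prod.ext rfl h
      rw [e, hω_odd, abs_neg]
      exact hb j.1
  obtain ⟨Cω, hCω, hωle⟩ := hNle
  obtain ⟨s₀, hs₀, hgrow⟩ := RevSys.exists_growth_bound hω_odd hω hF hr
  refine ⟨s₀, hs₀, fun s hs => ?_⟩
  obtain ⟨hreg, ε₁, hε₁, hgrow⟩ := hgrow s hs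
  obtain ⟨η, hη, f, X, K, M, hf, hfK, hX, hXM, hXr, hX0, hXf⟩ := RevSys.exists_global_field hreg
  refine ⟨min ε₁ η, lt_min hε₁ hη, fun z₀ hz₀ hz₀ε T hT hTε => ?_⟩
  have hε1 : ‖z₀‖ < ε₁ := by
    have := min_le_left ε₁ η
    linarith
  have hε2 : 2 * ‖z₀‖ < η := by
    have := min_le_right ε₁ η
    linarith
  -- solved on a larger interval, as regularity in `𝒫_s` is obtained from forward differences
  obtain ⟨u, hu0, hu⟩ := RevSys.exists_solution hX hXM ω z₀ (T := T + 1) (by linarith)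
  have hsub : Set.Icc (-T) T ⊆ Set.Icc (-(T + 1)) (T + 1) :=
    Set.Icc_subset_Icc (by linarith) (by linarith)
  have h0mem : (0 : ℝ) ∈ Set.Icc (-T) T := ⟨by linarith, hT.le⟩
  have hudT : ∀ τ ∈ Set.Icc (-T) T, HasDerivWithinAt u
      (RevSys.Sob.flow s ω (-τ) (X (RevSys.Sob.flow s ω τ (u τ)))) (Set.Icc (-T) T) τ :=
    fun τ hτ => (hu τ (hsub hτ)).mono hsub
  have hreal : ∀ τ ∈ Set.Icc (-T) T, RevSys.IsReal (RevSys.Sob.flow s ω τ (u τ)).seq :=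
    fun τ hτ => RevSys.isReal_flow hω_odd (RevSys.isReal_of_hasDerivWithinAt hT.le
      (by rwa [hu0]) hudT (fun σ => RevSys.isReal_flow hω_odd (hXr _) _) τ hτ) τ
  have hbound : ∀ t ∈ Set.Icc (-T) T, ‖u t‖ ≤ 2 * ‖z₀‖ := by
    rcases (norm_nonneg z₀).eq_or_lt with hε0 | hε0
    -- for the zero datum the long-time estimate is void, and the solution vanishes identically
    · intro t ht
      have hsub' : Set.uIcc 0 t ⊆ Set.Icc (-T) T := Set.uIcc_subset_Icc h0mem ht
      have h1 := RevSys.norm_le_exp_of_norm_deriv_le (K := K)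
        (fun τ hτ => (hudT τ (hsub' hτ)).mono hsub') fun τ _ => by
          have := hX.dist_le_mul (RevSys.Sob.flow s ω τ (u τ)) 0
          rw [hX0, dist_zero_right, dist_zero_right, RevSys.Sob.norm_flow] at this
          rwa [RevSys.Sob.norm_flow]
      rw [hu0, ← hε0, zero_mul] at h1
      rwa [← hε0, mul_zero]
    · have huc : ContinuousOn u (Set.Icc (-T) T) := fun τ hτ => (hudT τ hτ).continuousWithinAt
      have h1 := RevSys.bootstrap (φ := fun τ => ‖u τ‖) (a := 3 / 2 * ‖z₀‖) (b := 2 * ‖z₀‖)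
        (T := T) (by linarith) huc.norm (by rw [hu0]; linarith) fun t ht hle => by
          have hsub' : Set.uIcc 0 t ⊆ Set.Icc (-T) T := Set.uIcc_subset_Icc h0mem ht
          have h2 := hgrow u (fun τ => f (RevSys.Sob.flow s ω τ (u τ))) t (by rwa [hu0])
            (by rwa [hu0]) (by
              rw [hu0]
              refine le_trans ?_ hTε
              gcongr
              exact abs_le.2 ht) fun τ hτ => by
                have hn : ‖RevSys.Sob.flow s ω τ (u τ)‖ ≤ η := by
                  rw [RevSys.Sob.norm_flow]
                  exact (hle τ hτ).trans hε2.le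
                refine ⟨by rw [hu0]; exact hle τ hτ, hreal τ (hsub' hτ), hf _ hn, ?_⟩
                rw [← hXf _ (hreal τ (hsub' hτ)) hn]
                exact (hudT τ (hsub' hτ)).mono hsub'
          rwa [hu0] at h2
      exact fun t ht => (h1 t ht).trans (by linarith)
  have hzη : ∀ t ∈ Set.Icc (-T) T, ‖RevSys.Sob.flow s ω t (u t)‖ ≤ η := fun t ht => by
    rw [RevSys.Sob.norm_flow]
    exact (hbound t ht).trans hε2.le
  have hud : ∀ τ ∈ Set.Icc (-T) T, HasDerivWithinAt u
      (RevSys.Sob.flow s ω (-τ) ((-Complex.I) • f (RevSys.Sob.flow s ω τ (u τ))))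
      (Set.Icc (-T) T) τ := fun τ hτ => by
    rw [← hXf _ (hreal τ hτ) (hzη τ hτ)]
    exact hudT τ hτ
  have hsol := RevSys.isSolution_flow (ω := ω) (F := F) fun τ hτ =>
    ⟨hf _ (hzη τ hτ), hud τ hτ⟩
  refine ⟨fun τ => RevSys.Sob.flow s ω τ (u τ), ?_, hsol, ?_, fun t ht => ?_, ?_, ?_⟩
  · show RevSys.Sob.flow s ω 0 (u 0) = z₀
    rw [RevSys.Sob.flow_zero, hu0]
  · intro T' hT' hT'T w hw0 hw
    have hsub' : Set.Icc (-T') T' ⊆ Set.Icc (-T) T := Set.Icc_subset_Icc (by linarith) hT'T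
    exact RevSys.eqOn_of_isSolution hf hfK hε2 hT'.le (hw0.trans hu0.symm) hw
      fun τ hτ => ⟨hbound τ (hsub' hτ), (hud τ (hsub' hτ)).mono hsub'⟩
  · rw [RevSys.Sob.norm_flow]
    exact hbound t ht
  · obtain ⟨Ω, hΩ, hΩc⟩ := RevSys.exists_omega_map hCω hωle s
    have hsp : s - p ≤ s := by linarith
    refine ⟨fun τ => RevSys.Sob.incl hsp (RevSys.Sob.flow s ω τ (u τ)), ?_,
      fun t _ => RevSys.Sob.incl_seq' hsp _⟩
    have hg : ContinuousOn (fun τ => (-Complex.I) • Ω (RevSys.Sob.flow s ω τ (u τ))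
        + RevSys.Sob.incl hsp (X (RevSys.Sob.flow s ω τ (u τ)))) (Set.Icc (-T) T) := by
      have h1 := (hΩc.comp_continuousOn hsol.1).const_smul (-Complex.I)
      have h2 := (RevSys.Sob.incl hsp).continuous.comp_continuousOn
        (hX.continuous.comp_continuousOn hsol.1)
      exact h1.add h2
    refine RevSys.contDiffOn_one_of_hasDerivWithinAt (by linarith) hg
      (RevSys.hasDerivWithinAt_of_coord hg fun t ht j => ?_)
    simp only [RevSys.Sob.incl_seq, RevSys.Sob.seq_add, RevSys.Sob.seq_smul, hΩ, ← mul_assoc]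
    exact RevSys.hasDerivWithinAt_flow_seq (hudT t ht) j
  · rintro ⟨y₀, hy₀⟩
    exact RevSys.contDiffOn_one_of_domain hX hXM hT hu (fun j => by rw [hy₀, hu0])
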